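/- **Model.** There are $n$ asynchronous sequential processes $p_0,\dots,p_{n-1}$, of which fewer than $n/2$ may crash; a process that crashes is called *faulty*. They communicate by reliable FIFO channels: every message sent to a non-faulty process is eventually received. Messages of a process to itself are received instantaneously, that is, before any further event of that process other than a crash. To broadcast is to send to all processes; a process that crashes during a broadcast may have sent the message to only some of them. **Algorithm (code for $p_i$).** The local variables are $X_i,VC_i\in\mathbb N^n$ (initially $0$), $SC_i\in\mathbb N$ (initially $0$), a set $G_i$ (initially $\emptyset$) of entries $g=(g.v,g.k,g.t,g.cl)$ with $g.cl\in(\mathbb N\cup\{\infty\})^n$, and $V_i\in\mathbb N\cup\{\bot\}$ (initially $\bot$). * $\mathrm{write}(v)$: if $g.k\ne i$ for all $g\in G_i$, increment $SC_i$ and broadcast $M(v,i,SC_i,SC_i)$; otherwise set $V_i\leftarrow v$ (the write is *postponed*). The operation then returns. * $\mathrm{snapshot}()$: wait until $V_i=\bot$ and $g.k\neq i$ for all $g\in G_i$; then return $X_i$. * On reception of $M(v,k,t,cl)$ from $p_j$: 1. If $t>VC_i[k]$: if some $g\in G_i$ has $(g.k,g.t)=(k,t)$, set $g.cl[j]\leftarrow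 cl$. Otherwise, first, if $k\ne i$, increment $SC_i$ and broadcast $M(v,k,t,SC_i)$; then add to $G_i$ the entry $(v,k,t,c)$ with $c[j]=cl$ and $c[l]=\infty$ for $l\neq j$. 2. Let $G'=\{g\in G_i: |\{l: g.cl[l]<\infty\}|>n/2\}$. While there are $g\in G_i\setminus G'$ and $g'\in G'$ with $|\{l: g'.cl[l]<g.cl[l]\}|\le n/2$, remove such a $g'$ from $G'$. Then set $G_i\leftarrow G_i\setminus G'$, and for every $g\in G'$, if $VC_i[g.k]<g.t$, set $VC_i[g.k]\leftarrow g.t$ and $X_i[g.k]\leftarrow g.v$. 3. If $V_i\ne\bot$ and $g.k\ne i$ for all $g\in G_i$: increment $SC_i$, broadcast $M(V_i,i,SC_i,SC_i)$, and set $V_i\leftarrow\bot$. **Histories.** A history is a set of operations labelled by their process, their call and their return value, and partially ordered by the process order. The sequential specification of the snapshot memory is the set of finite or infinite words of operations in which each snapshot returns the array whose entry $j$ is the last value written before it by $p_j$, or $0$ if there is none. A history is *sequentially consistent* if its operations have a total order that contains the process order, in which each operation has a finite past, and such that the word of all operations in this order belongs to the specification. Call a write operation that has returned *lost* if it was postponed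 by a faulty process that crashed before completing any later execution of step 3 that sets its $V_i$ back to $\bot$. **Proposition.** Every execution of the algorithm is modelled by a sequentially consistent history of the snapshot memory. This history contains only invoked operations, with the return values they have in the execution if they returned. It contains all operations that returned, except that, if infinitely many snapshots return in the execution, it may omit lost writes. In particular it contains all operations that returned if no process crashes with a postponed write that has not been broadcast, or if only finitely many snapshots return. -/

import Mathlib

namespace SnapMem

/-! ### Histories, linear extensions and sequential consistency -/

/-- A history: a set of operations, each labelled by a letter of an alphabet (the call together
with its return value), partially ordered by the process order. -/
structure History (A : Type) where
  Op : Type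
  letter : Op → A
  precedes : Op → Op → Prop

/-- A linear extension: a total order on the operations that contains the process order and in
which every operation has a finite past. -/
structure History.IsLinearExtension {A : Type} (H : History A) (le : H.Op → H.Op → Prop) :
    Prop where
  refl : ∀ a, le a a
  antisymm : ∀ a b, le a b → le b a → a = b
  trans : ∀ a b c, le a b → le b c → le a c
  total : ∀ a b, le a b ∨ le b a
  contains_process_order : ∀ a b, H.precedes a b → le a b
  finite_past : ∀ a, {b | le b a}.Finite

/-- `w` is the (finite or infinite) word of all the operations of `H`, ordered by `le`: the letter
number `k` of `w` is the label of the operation that has exactly `k` strict predecessors. -/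
def History.IsWord {A : Type} (H : History A) (le : H.Op → H.Op → Prop) (w : Stream'.Seq A) :
    Prop :=
  ∀ k a, w.get? k = some a ↔ ∃ o, {b | le b o ∧ b ≠ o}.ncard = k ∧ H.letter o = a

/-- Sequential consistency of `H` for the sequential specification `T`, a set of finite and
infinite words. -/
def SequentiallyConsistent {A : Type} (T : Set (Stream'.Seq A)) (H : History A) : Prop :=
  ∃ le, H.IsLinearExtension le ∧ ∃ w ∈ T, H.IsWord le w

/-! ### The snapshot memory -/

/-- Operations of the snapshot memory on `n` single-writer registers: `write i v` is the call of
`REG.write(v)` by process `i`; `snap i r` is a call of `REG.snapshot()` by process `i` that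
returns the array `r`. -/
inductive Letter (n : ℕ) where
  | write (i : Fin n) (v : ℕ)
  | snap (i : Fin n) (r : Fin n → ℕ)

/-- The process that performs an operation. -/
def Letter.proc {n : ℕ} : Letter n → Fin n
  | .write i _ => i
  | .snap i _ => i

/-- The content of the registers after a finite sequence of operations; the default value of every
register is `0`. -/
def registers {n : ℕ} (l : List (Letter n)) : Fin n → ℕ :=
  l.foldl (fun reg a => match a with
    | .write i v => Function.update reg i v
    | .snap _ _ => reg) (fun _ => 0)

/-- The sequential specification of the snapshot memory: every snapshot returns the current content
of all the registers. -/
def snapshotSpec (n : ℕ) : Set (Stream'.Seq (Letter n)) :=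
  {w | ∀ k i r, w.get? k = some (Letter.snap i r) → r = registers (w.take k)}

/-! ### The algorithm -/

/-- A message `M(v, k, t, cl)`: value `v` written by process `k`, stamp `t` given by the writer
`k`, stamp `cl` given by the sender of the message. -/
structure Msg (n : ℕ) where
  v : ℕ
  k : Fin n
  t : ℕ
  cl : ℕ

/-- An entry of the set `G` of updates known to a process and not yet validated by it; `cl l` is
the stamp given by process `l`, or `⊤` as long as it is unknown. -/
@[ext]
structure Entry (n : ℕ) where
  v : ℕ
  k : Fin n
  t : ℕ
  cl : Fin n → ℕ∞

/-- Local state of a process: the five variables of the algorithm, whether the process is inside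
a snapshot operation, and whether it has crashed. -/
structure Loc (n : ℕ) where
  X : Fin n → ℕ
  VC : Fin n → ℕ
  SC : ℕ
  G : Finset (Entry n)
  V : Option ℕ
  inSnap : Bool
  crashed : Bool

/-- Initial local state. -/
def Loc.initial (n : ℕ) : Loc n where
  X := fun _ => 0
  VC := fun _ => 0
  SC := 0
  G := ∅
  V := none
  inSnap := false
  crashed := false

/-- No update of process `i` is waiting for validation in `G`. -/
def Loc.NoOwn {n : ℕ} (s : Loc n) (i : Fin n) : Prop := ∀ g ∈ s.G, g.k ≠ i

/-- Increment the clock and broadcast the new update `v` of process `i`: new local state and the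
list of messages that are broadcast. -/
def newUpdate {n : ℕ} (i : Fin n) (v : ℕ) (s : Loc n) : Loc n × List (Msg n) :=
  ({ s with SC := s.SC + 1 }, [⟨v, i, s.SC + 1, s.SC + 1⟩])

open Classical in
/-- Code of `write(v)` at process `i`: new local state and messages broadcast. -/
noncomputable def writeCode {n : ℕ} (i : Fin n) (v : ℕ) (s : Loc n) : Loc n × List (Msg n) :=
  if s.NoOwn i then newUpdate i v s else ({ s with V := some v }, [])

open Classical in
/-- First part of the code executed by process `i` when it receives `m` from process `j`: record
the stamp, and, at the first message on this update, forward the update with an own stamp (unless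
`i` is the writer) and create an entry in `G`. -/
noncomputable def recordMsg {n : ℕ} (i j : Fin n) (m : Msg n) (s : Loc n) :
    Loc n × List (Msg n) :=
  if s.VC m.k < m.t then
    if ∃ g ∈ s.G, g.k = m.k ∧ g.t = m.t then
      ({ s with
          G := s.G.image fun g =>
            if g.k = m.k ∧ g.t = m.t then { g with cl := Function.update g.cl j (m.cl : ℕ∞) }
            else g }, [])
    else
      let e : Entry n := ⟨m.v, m.k, m.t, Function.update (fun _ => ⊤) j (m.cl : ℕ∞)⟩
      if m.k = i then ({ s with G := insert e s.G }, [])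
      else ({ s with SC := s.SC + 1, G := insert e s.G }, [⟨m.v, m.k, m.t, s.SC + 1⟩])
  else (s, [])

open Classical in
/-- The updates of `G` that have been stamped by a majority of the processes. -/
noncomputable def stamped {n : ℕ} (G : Finset (Entry n)) : Finset (Entry n) :=
  G.filter fun g => n < 2 * (Finset.univ.filter fun l => g.cl l < ⊤).card

open Classical in
/-- One iteration of the `while` loop: remove from `G₁` some `g'` such that, for some
`g ∈ G \ G₁`, it is not the case that a majority of the processes stamped `g'` before `g`. -/
def LoopStep {n : ℕ} (G G₁ G₂ : Finset (Entry n)) : Prop :=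
  ∃ g ∈ G \ G₁, ∃ g' ∈ G₁,
    2 * (Finset.univ.filter fun l => g'.cl l < g.cl l).card ≤ n ∧ G₂ = G₁.erase g'

/-- `G'` is a possible result of the `while` loop, i.e. a set of updates to validate. -/
def LoopResult {n : ℕ} (G G' : Finset (Entry n)) : Prop :=
  Relation.ReflTransGen (LoopStep G) (stamped G) G' ∧ ∀ G₂, ¬ LoopStep G G' G₂

/-- Body of the `for` loop that validates the update `g`. -/
def validateOne {n : ℕ} (s : Loc n) (g : Entry n) : Loc n :=
  if s.VC g.k < g.t then
    { s with VC := Function.update s.VC g.k g.t, X := Function.update s.X g.k g.v }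
  else s

open Classical in
/-- Second part of the code executed at a reception: compute the set `G'` of updates that can be
validated, remove it from `G` and validate its elements, in an arbitrary order. -/
def ValidateStep {n : ℕ} (s s' : Loc n) : Prop :=
  ∃ G', LoopResult s.G G' ∧ ∃ l : List (Entry n), l.Nodup ∧ l.toFinset = G' ∧
    s' = l.foldl validateOne { s with G := s.G \ G' }

open Classical in
/-- Last part of the code executed at a reception by process `i`: broadcast the postponed update,
if there is one and no update of `i` is waiting for validation. -/
noncomputable def flush {n : ℕ} (i : Fin n) (s : Loc n) : Loc n × List (Msg n) :=
  match s.V with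
  | none => (s, [])
  | some v =>
    if s.NoOwn i then ({ (newUpdate i v s).1 with V := none }, (newUpdate i v s).2) else (s, [])

/-- The code executed by process `i` when it receives `m` from `j`, run from local state `s`, can
lead to local state `s'` and broadcasts the messages `out`, in this order. -/
def Handle {n : ℕ} (i j : Fin n) (m : Msg n) (s s' : Loc n) (out : List (Msg n)) : Prop :=
  ∃ s₁, ValidateStep (recordMsg i j m s).1 s₁ ∧ s' = (flush i s₁).1 ∧
    out = (recordMsg i j m s).2 ++ (flush i s₁).2

/-! ### Executions in the asynchronous message-passing system with crashes -/

/-- A global configuration: local states, and FIFO channels, `chan i j` being the queue of messages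
in transit from `i` to `j` (oldest first). -/
structure Config (n : ℕ) where
  loc : Fin n → Loc n
  chan : Fin n → Fin n → List (Msg n)

/-- Initial configuration. -/
def Config.initial (n : ℕ) : Config n where
  loc := fun _ => Loc.initial n
  chan := fun _ _ => []

/-- Process `i` moves to local state `s` and appends the list `sent j` to its channel to each
process `j`. -/
def Config.act {n : ℕ} (c : Config n) (i : Fin n) (s : Loc n) (sent : Fin n → List (Msg n)) :
    Config n where
  loc := Function.update c.loc i s
  chan := Function.update c.chan i (fun j => c.chan i j ++ sent j)

/-- Replace the content of the channel from `j` to `i`. -/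
def Config.setChan {n : ℕ} (c : Config n) (j i : Fin n) (q : List (Msg n)) : Config n where
  loc := c.loc
  chan := Function.update c.chan j (Function.update (c.chan j) i q)

/-- What may have been sent by a process that had to broadcast the messages of `out` one after the
other and crashed meanwhile: some of the broadcasts are complete, the next one may have reached
only the channels to the processes of a set `D`, and the others have not been started. -/
def PartialBroadcast {n : ℕ} (out : List (Msg n)) (sent : Fin n → List (Msg n)) : Prop :=
  ∃ (b : ℕ) (D : Set (Fin n)), ∀ j,
    (j ∈ D → sent j = out.take (b + 1)) ∧ (j ∉ D → sent j = out.take b)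

/-- The events of an execution. `write i v` is a complete write operation, `callSnap i` and
`retSnap i r` are the invocation and the return of a snapshot operation, `receive i j` is the
reception by `i` of a message of `j`; `crashWrite` and `crashReceive` are events during which `i`
crashes; `crash i` is a crash between two events of `i`. -/
inductive Event (n : ℕ) where
  | idle
  | write (i : Fin n) (v : ℕ)
  | crashWrite (i : Fin n) (v : ℕ)
  | callSnap (i : Fin n)
  | retSnap (i : Fin n) (r : Fin n → ℕ)
  | receive (i j : Fin n)
  | crashReceive (i j : Fin n)
  | crash (i : Fin n)

/-- Process `i` has not crashed, and has received all the messages it sent to itself. -/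
def Config.Ready {n : ℕ} (c : Config n) (i : Fin n) : Prop :=
  (c.loc i).crashed = false ∧ c.chan i i = []

/-- The transitions of the system. Messages sent by a process to itself are received
instantaneously: no other event of the process, except a crash, happens before their reception.
The local memory of a process that crashes during an event is left as it was before it. -/
inductive Step {n : ℕ} : Config n → Event n → Config n → Prop
  | idle (c) : Step c .idle c
  | write (c i v) : c.Ready i → (c.loc i).inSnap = false →
      Step c (.write i v)
        (c.act i (writeCode i v (c.loc i)).1 (fun _ => (writeCode i v (c.loc i)).2))
  | crashWrite (c i v sent) : c.Ready i → (c.loc i).inSnap = false →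
      PartialBroadcast (writeCode i v (c.loc i)).2 sent →
      Step c (.crashWrite i v) (c.act i { c.loc i with crashed := true } sent)
  | callSnap (c i) : c.Ready i → (c.loc i).inSnap = false →
      Step c (.callSnap i) (c.act i { c.loc i with inSnap := true } (fun _ => []))
  | retSnap (c i) : c.Ready i → (c.loc i).inSnap = true →
      (c.loc i).V = none → (c.loc i).NoOwn i →
      Step c (.retSnap i (c.loc i).X) (c.act i { c.loc i with inSnap := false } (fun _ => []))
  | receive (c i j m q s' out) : (c.loc i).crashed = false → (j = i ∨ c.chan i i = []) →
      c.chan j i = m :: q → Handle i j m (c.loc i) s' out →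
      Step c (.receive i j) ((c.setChan j i q).act i s' (fun _ => out))
  | crashReceive (c i j m q s' out sent) : (c.loc i).crashed = false →
      (j = i ∨ c.chan i i = []) → c.chan j i = m :: q → Handle i j m (c.loc i) s' out →
      PartialBroadcast out sent →
      Step c (.crashReceive i j)
        ((c.setChan j i q).act i { c.loc i with crashed := true } sent)
  | crash (c i) : (c.loc i).crashed = false →
      Step c (.crash i) (c.act i { c.loc i with crashed := true } (fun _ => []))

/-- An execution of the algorithm by `n` processes. Channels are reliable: a process that never
crashes eventually receives the messages in transit to it. A finite execution is continued by
`idle` events. -/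
structure Execution (n : ℕ) where
  conf : ℕ → Config n
  event : ℕ → Event n
  init : conf 0 = Config.initial n
  step : ∀ τ, Step (conf τ) (event τ) (conf (τ + 1))
  reliable : ∀ τ i j, (∀ σ, ((conf σ).loc i).crashed = false) → (conf τ).chan j i ≠ [] →
    ∃ σ, τ ≤ σ ∧ event σ = Event.receive i j

/-- The faulty processes of an execution. -/
def Execution.faulty {n : ℕ} (E : Execution n) : Set (Fin n) :=
  {i | ∃ τ, ((E.conf τ).loc i).crashed = true}

/-! An operation of an execution is identified with the time `τ` of its invocation. -/

/-- The snapshot operation invoked by `i` at time `τ` returns `r`. -/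
def Execution.SnapReturns {n : ℕ} (E : Execution n) (τ : ℕ) (i : Fin n) (r : Fin n → ℕ) : Prop :=
  E.event τ = .callSnap i ∧ ∃ σ, τ < σ ∧ E.event σ = .retSnap i r ∧
    ∀ ρ, τ < ρ → ρ < σ → E.event ρ ≠ .callSnap i

/-- An operation is invoked at time `τ`, and the letter describes it, its return value being the
actual one if the operation returns. -/
def Execution.Invoked {n : ℕ} (E : Execution n) (τ : ℕ) : Letter n → Prop
  | .write i v => E.event τ = .write i v ∨ E.event τ = .crashWrite i v
  | .snap i r => E.event τ = .callSnap i ∧ ∀ r', E.SnapReturns τ i r' → r = r'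

/-- An operation is invoked at time `τ` and returns. -/
def Execution.Returned {n : ℕ} (E : Execution n) (τ : ℕ) : Prop :=
  (∃ i v, E.event τ = .write i v) ∨ ∃ i r, E.SnapReturns τ i r

/-- The write operation invoked at time `τ` was postponed by a faulty process, that crashed before
it completed the broadcast of its postponed update; and infinitely many snapshot operations
return in the execution. -/
def Execution.LostWrite {n : ℕ} (E : Execution n) (τ : ℕ) : Prop :=
  (∃ i v, E.event τ = .write i v ∧ i ∈ E.faulty ∧ ∀ σ, τ < σ → ((E.conf σ).loc i).V ≠ none) ∧
    {σ | ∃ i r, E.SnapReturns σ i r}.Infinite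

/-- The history `H` models the execution: it contains only invoked operations, with the return
values they have in the execution, it contains all the operations that return (except that it may
omit lost writes), and it is ordered by the process order. -/
def Execution.ModelledBy {n : ℕ} (E : Execution n) (H : History (Letter n)) : Prop :=
  ∃ inv : H.Op → ℕ, Function.Injective inv ∧
    (∀ o, E.Invoked (inv o) (H.letter o)) ∧
    (∀ τ, E.Returned τ → ¬ E.LostWrite τ → τ ∈ Set.range inv) ∧
    ∀ o o', H.precedes o o' ↔ (H.letter o).proc = (H.letter o').proc ∧ inv o < inv o'

end SnapMem

namespace SnapMem

variable {n : ℕ}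

/-! ### The `while` loop and the `for` loop -/

/-! Call an update a pair of a writer `k` and a stamp `t`. Every process stamps an update at most
once, with its own increasing clock, and sends the updates of one writer in order (`SentInv`). Say
that u' is before u if a majority of the processes stamped u', and each of them stamped u later or
never. Two majorities meet, so this relation is asymmetric (`Before.asymm`). The loop computes the
largest part of `G` that is stamped before the rest, so every update validated by a process is
before every update not yet validated by it (`before`). Hence any two vectors `VC`, of whichever
processes and times, are comparable (`VC_total`): otherwise two updates would be before each other.

So the snapshots that return are ordered by their views. A write goes just before the first snapshot
that sees it; a write invoked by `i` with clock value `SC` counts as seen when entry `i` of the view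
exceeds `SC`. This also handles postponed writes that are overwritten: an update carries the value
of the last write before its broadcast (`exists_write_of_sent`), and the writes it absorbs come
earlier in the process order. A snapshot waits for the validation of the writes of its process,
which gives compatibility with the process order (`key_le_of_precedes`); that it reads the last
values is `lastValue_snap`.

Finite pasts (`finite_past`) and the presence of all required operations (`modelledBy_history`) rest
on liveness: an update known to a correct process is eventually validated by all correct processes
(`exists_validates`). If finitely many updates are known, all stamps of correct processes eventually
arrive and nothing blocks the loop. Otherwise some writer `k` has infinitely many known updates; it
is correct, and it validates each of them before broadcasting its next one. An update never
validated by `k` would be stamped after each of these by some correct process, but only finitely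
many stamps precede it there. So `k` validates all known updates. What `k` has validated at a late
enough time is finite and stamped before the rest by majorities of correct processes, hence passes
the loop everywhere.

If infinitely many snapshots return, each returned write that is not lost is thus seen by one of
them. If finitely many return, the unseen writes go to the end, in the order of their invocations.
-/

open Classical in
/-- `D` can be validated together: all its updates are stamped by a majority, and each of them is
stamped before every update of `G \ D` by a majority. -/
def Closed (G D : Finset (Entry n)) : Prop :=
  D ⊆ stamped G ∧ ∀ g ∈ G, g ∉ D → ∀ g' ∈ D,
    n < 2 * (Finset.univ.filter fun l => g'.cl l < g.cl l).card

lemma stamped_subset (G : Finset (Entry n)) : stamped G ⊆ G := by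
  classical
  exact Finset.filter_subset _ _

lemma Closed.subset {G D : Finset (Entry n)} (h : Closed G D) : D ⊆ G :=
  h.1.trans (stamped_subset G)

lemma LoopResult.closed {G G' : Finset (Entry n)} (h : LoopResult G G') : Closed G G' := by
  classical
  obtain ⟨h1, h2⟩ := h
  refine ⟨?_, ?_⟩
  · clear h2
    induction h1 with
    | refl => exact subset_rfl
    | tail _ hs ih =>
      obtain ⟨g, -, g', -, -, rfl⟩ := hs
      exact (Finset.erase_subset _ _).trans ih
  · intro g hg hgn g' hg'
    by_contra hc
    refine h2 (G'.erase g') ⟨g, ?_, g', hg', not_lt.mp hc, ?_⟩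
    · simp [hg, hgn]
    · congr

/-- No iteration can erase an element of `D`: the witness `g` lies outside the current set, hence
outside `D`, and closedness of `D` contradicts the test. With `LoopResult.closed`, the result is the
largest closed set, whatever choices the loop makes. -/
lemma LoopResult.subset_of_closed {G G' D : Finset (Entry n)} (h : LoopResult G G')
    (hD : Closed G D) : D ⊆ G' := by
  classical
  obtain ⟨h1, -⟩ := h
  induction h1 with
  | refl => exact hD.1
  | tail _ hs ih =>
    obtain ⟨g, hg, g', hg', hle, rfl⟩ := hs
    intro d hd
    simp only [Finset.mem_sdiff] at hg
    refine Finset.mem_erase.2 ⟨?_, ih hd⟩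
    rintro rfl
    exact absurd (hD.2 g hg.1 (fun hgD => hg.2 (ih hgD)) d hd) (not_lt.mpr hle)

open Classical in
-- `G' ∪ D` is closed in `G`, so maximality of `G'` applies. This is why nothing can be validated
-- between two events.
lemma LoopResult.eq_empty_of_closed_sdiff {G G' D : Finset (Entry n)} (h : LoopResult G G')
    (hD : Closed (G \ G') D) : D = ∅ := by
  have hsub : ∀ d ∈ D, d ∈ G ∧ d ∉ G' := fun d hd => by simpa using hD.subset hd
  have hc : Closed G (G' ∪ D) := by
    refine ⟨?_, ?_⟩
    · intro d hd
      rcases Finset.mem_union.1 hd with hd | hd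
      · exact h.closed.1 hd
      · have := hD.1 hd
        simp only [stamped, Finset.mem_filter, Finset.mem_sdiff] at this ⊢
        exact ⟨this.1.1, this.2⟩
    · intro g hg hgn g' hg'
      simp only [Finset.mem_union, not_or] at hgn
      rcases Finset.mem_union.1 hg' with hd | hd
      · exact h.closed.2 g hg hgn.1 g' hd
      · exact hD.2 g (by simp [hg, hgn.1]) hgn.2 g' hd
  refine Finset.eq_empty_of_forall_notMem fun d hd => ?_
  exact (hsub d hd).2 (h.subset_of_closed hc (Finset.mem_union_right _ hd))

/-- The properties of the validation of a list of updates that are used below. -/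
structure Validated (s s' : Loc n) (P : Entry n → Prop) : Prop where
  SC : s'.SC = s.SC
  V : s'.V = s.V
  inSnap : s'.inSnap = s.inSnap
  crashed : s'.crashed = s.crashed
  mono : ∀ k, s.VC k ≤ s'.VC k
  le : ∀ g, P g → g.t ≤ s'.VC g.k
  cases : ∀ k, (s'.VC k = s.VC k ∧ s'.X k = s.X k) ∨
    ∃ g, P g ∧ g.k = k ∧ s'.VC k = g.t ∧ s'.X k = g.v

lemma validated_foldl (l : List (Entry n)) (s : Loc n) :
    (l.foldl validateOne s).G = s.G ∧ Validated s (l.foldl validateOne s) (· ∈ l) := by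
  induction l generalizing s with
  | nil => exact ⟨rfl, rfl, rfl, rfl, rfl, fun _ => le_rfl, by simp, fun k => .inl ⟨rfl, rfl⟩⟩
  | cons g l ih =>
    obtain ⟨hG, h⟩ := ih (validateOne s g)
    simp only [List.foldl_cons]
    have hm : ∀ k, s.VC k ≤ (validateOne s g).VC k := by
      intro k
      unfold validateOne
      split_ifs with hlt
      · by_cases hk : k = g.k
        · subst hk; simpa using hlt.le
        · simp [hk]
      · exact le_rfl
    refine ⟨?_, ?_, ?_, ?_, ?_, fun k => (hm k).trans (h.mono k), ?_, fun k => ?_⟩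
    · rw [hG]; unfold validateOne; split_ifs <;> rfl
    · rw [h.SC]; unfold validateOne; split_ifs <;> rfl
    · rw [h.V]; unfold validateOne; split_ifs <;> rfl
    · rw [h.inSnap]; unfold validateOne; split_ifs <;> rfl
    · rw [h.crashed]; unfold validateOne; split_ifs <;> rfl
    · intro g1 hg1
      rcases List.mem_cons.1 hg1 with rfl | hg1
      · refine le_trans ?_ (h.mono _)
        unfold validateOne
        split_ifs with hlt
        · simp
        · exact not_lt.mp hlt
      · exact h.le _ hg1
    · rcases h.cases k with ⟨h1, h2⟩ | ⟨g1, hg1, h1⟩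
      · rw [h1, h2]
        unfold validateOne
        split_ifs with hlt
        · by_cases hk : k = g.k
          · subst hk
            exact .inr ⟨g, List.mem_cons_self, rfl, by simp, by simp⟩
          · simp [hk]
        · exact .inl ⟨rfl, rfl⟩
      · exact .inr ⟨g1, List.mem_cons_of_mem _ hg1, h1⟩

open Classical in
lemma ValidateStep.spec {s s' : Loc n} (h : ValidateStep s s') :
    ∃ G', LoopResult s.G G' ∧ s'.G = s.G \ G' ∧ Validated s s' (· ∈ G') := by
  obtain ⟨G', hG', l, -, rfl, rfl⟩ := h
  obtain ⟨h1, h2⟩ := validated_foldl l { s with G := s.G \ l.toFinset }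
  refine ⟨_, hG', h1, h2.SC, h2.V, h2.inSnap, h2.crashed, h2.mono, ?_, ?_⟩
  · simpa using h2.le
  · simpa using h2.cases

/-! ### Invariants of the sequences of messages that are broadcast -/

/-- The sequences `S l` of the messages broadcast by the processes `l` are well formed: the stamps
of the senders increase, an update is sent at most once by each process, messages originate from
the writer, and each process sends the updates of a writer in order. -/
structure SentInv (S : Fin n → List (Msg n)) : Prop where
  sorted : ∀ l, (S l).Pairwise (fun a b => a.cl < b.cl)
  key : ∀ l, ∀ m ∈ S l, ∀ m' ∈ S l, m.k = m'.k → m.t = m'.t → m = m'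
  origin : ∀ l, ∀ m ∈ S l, ∃ m₀ ∈ S m.k, m₀.k = m.k ∧ m₀.t = m.t ∧ m₀.v = m.v
  own : ∀ l, ∀ m ∈ S l, m.k = l → m.t = m.cl
  pos : ∀ l, ∀ m ∈ S l, 0 < m.t
  fifo : ∀ l, ∀ m ∈ S l, ∀ m' ∈ S m.k, m'.k = m.k → m'.t < m.t →
    ∃ m'' ∈ S l, m''.k = m.k ∧ m''.t = m'.t ∧ m''.cl < m.cl

lemma mem_update_append {S : Fin n → List (Msg n)} {i l : Fin n} {out : List (Msg n)}
    {m : Msg n} :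
    m ∈ Function.update S i (S i ++ out) l ↔ m ∈ S l ∨ (l = i ∧ m ∈ out) := by
  by_cases h : l = i
  · subst h; simp
  · simp [h]

lemma SentInv.cl_inj {S : Fin n → List (Msg n)} (h : SentInv S) {l : Fin n} {m m' : Msg n}
    (hm : m ∈ S l) (hm' : m' ∈ S l) (hc : m.cl = m'.cl) : m = m' := by
  have := h.sorted l
  rw [List.pairwise_iff_getElem] at this
  obtain ⟨a, ha, rfl⟩ := List.getElem_of_mem hm
  obtain ⟨b, hb, rfl⟩ := List.getElem_of_mem hm'
  rcases lt_trichotomy a b with hab | rfl | hab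
  · exact absurd hc (this a b ha hb hab).ne
  · rfl
  · exact absurd hc (this b a hb ha hab).ne'

/-- A prefix of a sequence of messages contains all messages with a smaller stamp. -/
lemma SentInv.mem_of_prefix {S : Fin n → List (Msg n)} (h : SentInv S) {l : Fin n}
    {r : List (Msg n)} (hr : r <+: S l) {m m' : Msg n} (hm : m ∈ r) (hm' : m' ∈ S l)
    (hc : m'.cl ≤ m.cl) : m' ∈ r := by
  obtain ⟨q, hq⟩ := hr
  have hs := h.sorted l
  rw [← hq] at hm' hs
  rcases List.mem_append.1 hm' with h1 | h1
  · exact h1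
  · exact absurd ((List.pairwise_append.1 hs).2.2 m hm m' h1) (not_lt.mpr hc)

lemma pairwise_update_append {S : Fin n → List (Msg n)} {i : Fin n} {m : Msg n}
    (h : ∀ l, (S l).Pairwise (fun a b => a.cl < b.cl)) (hm : ∀ a ∈ S i, a.cl < m.cl) (l : Fin n) :
    (Function.update S i (S i ++ [m]) l).Pairwise (fun a b => a.cl < b.cl) := by
  by_cases hl : l = i
  · subst hl
    simp only [Function.update_self, List.pairwise_append]
    exact ⟨h l, by simp, by simpa using hm⟩
  · simpa [hl] using h l

lemma SentInv.append_own {S : Fin n → List (Msg n)} (h : SentInv S) {i : Fin n} (v c : ℕ)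
    (hc : ∀ m ∈ S i, m.cl < c) (h0 : 0 < c) :
    SentInv (Function.update S i (S i ++ [⟨v, i, c, c⟩])) := by
  have hold : ∀ m ∈ S i, m.k = i → m.t < c := fun m hm hk => h.own i m hm hk ▸ hc m hm
  -- Messages on updates of `i` sent by other processes originate from `i`, so the fresh stamp
  -- exceeds all of theirs too.
  have hold' : ∀ l, ∀ m ∈ S l, m.k = i → m.t < c := by
    intro l m hm hk
    obtain ⟨m₀, h1, h2, h3, -⟩ := h.origin l m hm
    rw [hk] at h1 h2
    exact h3 ▸ hold m₀ h1 h2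
  refine ⟨pairwise_update_append h.sorted hc, ?_, ?_, ?_, ?_, ?_⟩
  · simp only [mem_update_append, List.mem_singleton]
    rintro l m (hm | ⟨rfl, rfl⟩) m' (hm' | ⟨hl, rfl⟩) hk ht
    · exact h.key l m hm m' hm' hk ht
    · exact absurd ht (hold' l m hm hk).ne
    · exact absurd ht (hold' l m' hm' hk.symm).ne'
    · rfl
  · simp only [mem_update_append, List.mem_singleton]
    rintro l m (hm | ⟨rfl, rfl⟩)
    · obtain ⟨m₀, h1, h2⟩ := h.origin l m hm
      exact ⟨m₀, .inl h1, h2⟩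
    · exact ⟨_, .inr ⟨rfl, rfl⟩, rfl, rfl, rfl⟩
  · simp only [mem_update_append, List.mem_singleton]
    rintro l m (hm | ⟨rfl, rfl⟩) hk
    · exact h.own l m hm hk
    · rfl
  · simp only [mem_update_append, List.mem_singleton]
    rintro l m (hm | ⟨rfl, rfl⟩)
    · exact h.pos l m hm
    · exact h0
  · simp only [mem_update_append, List.mem_singleton]
    rintro l m (hm | ⟨rfl, rfl⟩) m' (hm' | ⟨hl, rfl⟩) hk ht
    · obtain ⟨m'', h1, h2⟩ := h.fifo l m hm m' hm' hk ht
      exact ⟨m'', .inl h1, h2⟩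
    · exact absurd ht (hold' l m hm hl).le.not_gt
    · exact ⟨m', .inl hm', hk, rfl, hc m' hm'⟩
    · exact absurd ht (lt_irrefl _)

lemma SentInv.append_forward {S : Fin n → List (Msg n)} (h : SentInv S) {i j : Fin n} {m₀ : Msg n}
    {c : ℕ} (hm₀ : m₀ ∈ S j) (hi : m₀.k ≠ i) (hc : ∀ m ∈ S i, m.cl < c)
    (hnew : ∀ m ∈ S i, m.k = m₀.k → m.t ≠ m₀.t)
    (hf : ∀ m ∈ S m₀.k, m.k = m₀.k → m.t < m₀.t → ∃ m' ∈ S i, m'.k = m₀.k ∧ m'.t = m.t) :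
    SentInv (Function.update S i (S i ++ [⟨m₀.v, m₀.k, m₀.t, c⟩])) := by
  refine ⟨pairwise_update_append h.sorted hc, ?_, ?_, ?_, ?_, ?_⟩
  · simp only [mem_update_append, List.mem_singleton]
    rintro l m (hm | ⟨rfl, rfl⟩) m' (hm' | ⟨hl, rfl⟩) hk ht
    · exact h.key l m hm m' hm' hk ht
    · subst hl
      exact absurd ht (hnew m hm hk)
    · exact absurd ht.symm (hnew m' hm' hk.symm)
    · rfl
  · simp only [mem_update_append, List.mem_singleton]
    rintro l m (hm | ⟨rfl, rfl⟩)
    · obtain ⟨m₁, h1, h2⟩ := h.origin l m hm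
      exact ⟨m₁, .inl h1, h2⟩
    · obtain ⟨m₁, h1, h2⟩ := h.origin j m₀ hm₀
      exact ⟨m₁, .inl h1, h2⟩
  · simp only [mem_update_append, List.mem_singleton]
    rintro l m (hm | ⟨rfl, rfl⟩) hk
    · exact h.own l m hm hk
    · exact absurd hk hi
  · simp only [mem_update_append, List.mem_singleton]
    rintro l m (hm | ⟨rfl, rfl⟩)
    · exact h.pos l m hm
    · exact h.pos j m₀ hm₀
  · simp only [mem_update_append, List.mem_singleton]
    rintro l m (hm | ⟨rfl, rfl⟩) m' (hm' | ⟨hl, rfl⟩) hk ht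
    · obtain ⟨m'', h1, h2⟩ := h.fifo l m hm m' hm' hk ht
      exact ⟨m'', .inl h1, h2⟩
    · exact absurd (hk.trans hl) hi
    · obtain ⟨m'', h1, h2, h3⟩ := hf m' hm' hk ht
      exact ⟨m'', .inl h1, h2, h3, hc m'' h1⟩
    · exact absurd hl hi

/-! ### Invariants of the local states -/

/-- Invariant of the local state `s` of process `i`, where `Si` is the sequence of messages that it
has broadcast and `R l` is the sequence of messages of `l` that it has processed. -/
structure LocInv (i : Fin n) (s : Loc n) (Si : List (Msg n)) (R : Fin n → List (Msg n)) :
    Prop where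
  g_sent : ∀ e ∈ s.G, ∃ m ∈ Si, m.k = e.k ∧ m.t = e.t ∧ m.v = e.v
  vc_sent : ∀ k, (s.VC k = 0 ∧ s.X k = 0) ∨ ∃ m ∈ Si, m.k = k ∧ m.t = s.VC k ∧ m.v = s.X k
  g_vc : ∀ e ∈ s.G, s.VC e.k < e.t
  g_uniq : ∀ e ∈ s.G, ∀ e' ∈ s.G, e.k = e'.k → e.t = e'.t → e = e'
  g_rcv : ∀ e ∈ s.G, ∀ l, ∀ c : ℕ, e.cl l = c → ∃ m ∈ R l, m.k = e.k ∧ m.t = e.t ∧ m.cl = c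
  r_known : ∀ l, ∀ m ∈ R l, m.t ≤ s.VC m.k ∨ ∃ e ∈ s.G, e.k = m.k ∧ e.t = m.t ∧ e.cl l = m.cl

/-- Further invariant of the local state of a process that has not crashed. -/
structure AliveInv (i : Fin n) (s : Loc n) (Si : List (Msg n)) : Prop where
  sc : ∀ m ∈ Si, m.cl ≤ s.SC
  s_known : ∀ m ∈ Si, m.k ≠ i → m.t ≤ s.VC m.k ∨ ∃ e ∈ s.G, e.k = m.k ∧ e.t = m.t

/-- Of two updates of `i`, the first one is validated by `i`. -/
def OwnDone (i : Fin n) (s : Loc n) (Si : List (Msg n)) : Prop :=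
  ∀ m ∈ Si, ∀ m' ∈ Si, m.k = i → m'.k = i → m.t < m'.t → m.t ≤ s.VC i

/-- Invariant of the local states between two events. -/
structure RestInv (i : Fin n) (s : Loc n) : Prop where
  eq_empty : ∀ D, Closed s.G D → D = ∅
  postponed : s.V ≠ none → ¬ s.NoOwn i

lemma LocInv.mono {i : Fin n} {s : Loc n} {Si : List (Msg n)} {R : Fin n → List (Msg n)}
    (h : LocInv i s Si R) (out : List (Msg n)) : LocInv i s (Si ++ out) R := by
  refine ⟨fun e he => ?_, fun k => ?_, h.g_vc, h.g_uniq, h.g_rcv, h.r_known⟩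
  · obtain ⟨m, hm, h'⟩ := h.g_sent e he
    exact ⟨m, List.mem_append_left _ hm, h'⟩
  · rcases h.vc_sent k with h' | ⟨m, hm, h'⟩
    · exact .inl h'
    · exact .inr ⟨m, List.mem_append_left _ hm, h'⟩

/-! ### Effect of the code of a process on its local invariants -/

lemma recordMsg_frame (i j : Fin n) (m : Msg n) (s : Loc n) :
    (recordMsg i j m s).1.V = s.V ∧ (recordMsg i j m s).1.VC = s.VC ∧
    (recordMsg i j m s).1.X = s.X ∧ (recordMsg i j m s).1.inSnap = s.inSnap ∧
    (recordMsg i j m s).1.crashed = s.crashed ∧ s.SC ≤ (recordMsg i j m s).1.SC ∧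
    ∀ m' ∈ (recordMsg i j m s).2, m'.k ≠ i := by
  unfold recordMsg
  split_ifs with h1 h2 h3
  · simp
  · simp
  · simp [h3]
  · simp

open Classical in
/-- The three possible effects of the first part of the code of a reception. -/
lemma recordMsg_cases (i j : Fin n) (m : Msg n) (s : Loc n) :
    (m.t ≤ s.VC m.k ∧ recordMsg i j m s = (s, [])) ∨
    (s.VC m.k < m.t ∧ (∃ g ∈ s.G, g.k = m.k ∧ g.t = m.t) ∧
      recordMsg i j m s = ({ s with
          G := s.G.image fun g =>
            if g.k = m.k ∧ g.t = m.t then { g with cl := Function.update g.cl j (m.cl : ℕ∞) }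
            else g }, [])) ∨
    (s.VC m.k < m.t ∧ (¬ ∃ g ∈ s.G, g.k = m.k ∧ g.t = m.t) ∧
      (recordMsg i j m s).1.G =
        insert ⟨m.v, m.k, m.t, Function.update (fun _ => ⊤) j (m.cl : ℕ∞)⟩ s.G ∧
      ((m.k = i ∧ (recordMsg i j m s).1.SC = s.SC ∧ (recordMsg i j m s).2 = []) ∨
       (m.k ≠ i ∧ (recordMsg i j m s).1.SC = s.SC + 1 ∧
        (recordMsg i j m s).2 = [⟨m.v, m.k, m.t, s.SC + 1⟩]))) := by
  unfold recordMsg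
  split_ifs with h1 h2 h3
  · exact .inr (.inl ⟨h1, h2, rfl⟩)
  · exact .inr (.inr ⟨h1, h2, rfl, .inl ⟨h3, rfl, rfl⟩⟩)
  · exact .inr (.inr ⟨h1, h2, rfl, .inr ⟨h3, rfl, rfl⟩⟩)
  · exact .inl ⟨not_lt.mp h1, rfl⟩

/-- The invariants of the local state of `i` relative to the sequences of messages `S` broadcast by
all processes. -/
structure FullInv (S : Fin n → List (Msg n)) (i : Fin n) (s : Loc n) (R : Fin n → List (Msg n)) :
    Prop where
  sent : SentInv S
  pre : ∀ l, R l <+: S l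
  loc : LocInv i s (S i) R
  alive : AliveInv i s (S i)

/-- The order in which `l` sends the updates of one writer is visible at the receiver: the earlier
message has a smaller stamp, and what has been received is a prefix of what was sent. -/
lemma FullInv.fifo {S : Fin n → List (Msg n)} {i : Fin n} {s : Loc n} {R : Fin n → List (Msg n)}
    (h : FullInv S i s R) {l : Fin n} {m m' : Msg n} (hm : m ∈ R l) (hm' : m' ∈ S i)
    (hk : m'.k = m.k) (ht : m'.t < m.t) :
    ∃ m'' ∈ R l, m''.k = m.k ∧ m''.t = m'.t ∧ m''.cl < m.cl := by
  obtain ⟨m₀, h1, h2, h3, -⟩ := h.sent.origin i m' hm'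
  rw [hk] at h1
  have hmS := (h.pre l).subset hm
  obtain ⟨m'', h4, h5, h6, h7⟩ := h.sent.fifo l m hmS m₀ h1 (h2.trans hk) (h3 ▸ ht)
  exact ⟨m'', h.sent.mem_of_prefix (h.pre l) hm h4 h7.le, h5, h6.trans h3, h7⟩

lemma FullInv.append_own {S : Fin n → List (Msg n)} {i : Fin n} {s : Loc n}
    {R : Fin n → List (Msg n)} (h : FullInv S i s R) (v : ℕ) (V : Option ℕ) :
    FullInv (Function.update S i (S i ++ [⟨v, i, s.SC + 1, s.SC + 1⟩])) i
      { s with SC := s.SC + 1, V := V } R := by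
  refine ⟨h.sent.append_own v _ (fun m hm => Nat.lt_succ_of_le (h.alive.sc m hm)) (by omega),
    fun l => ?_, ?_, ?_, ?_⟩
  · by_cases hl : l = i
    · subst hl
      simpa using (h.pre l).trans (List.prefix_append _ _)
    · simpa [hl] using h.pre l
  · have := h.loc.mono [⟨v, i, s.SC + 1, s.SC + 1⟩]
    simp only [Function.update_self]
    exact ⟨this.1, this.2, this.3, this.4, this.5, this.6⟩
  · simp only [Function.update_self, List.mem_append, List.mem_singleton]
    rintro m (hm | rfl)
    · exact (h.alive.sc m hm).trans (Nat.le_succ _)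
    · exact le_rfl
  · simp only [Function.update_self, List.mem_append, List.mem_singleton]
    rintro m (hm | rfl) hk
    · exact h.alive.s_known m hm hk
    · exact absurd rfl hk

/-- Every message received is followed, at the receiver, by a message on the same update. -/
lemma FullInv.exists_sent {S : Fin n → List (Msg n)} {i : Fin n} {s : Loc n}
    {R : Fin n → List (Msg n)} (h : FullInv S i s R) {l k : Fin n} {m m₀ : Msg n} (hm : m ∈ R l)
    (hk : m.k = k) (h₀ : m₀ ∈ S k) (hk₀ : m₀.k = k) (ht₀ : m₀.t = m.t) :
    ∃ m' ∈ S i, m'.k = m.k ∧ m'.t = m.t := by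
  rcases h.loc.r_known l m hm with h1 | ⟨e, he, h1, h2, -⟩
  · rcases h.loc.vc_sent m.k with h2 | ⟨m', h2, h3, h4, -⟩
    · have := h.sent.pos l m ((h.pre l).subset hm)
      omega
    -- The last validated update of this writer may be later than that of `m`; then `i`, which sends
    -- the updates of a writer in order, has sent the one of `m` before it.
    · rcases h1.lt_or_eq with h1 | h1
      · obtain ⟨m'', h5, h6, h7, -⟩ := h.sent.fifo i m' h2 m₀ (by rwa [h3, hk])
          (by rw [hk₀, h3, hk]) (by omega)
        exact ⟨m'', h5, h6.trans h3, h7.trans ht₀⟩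
      · exact ⟨m', h2, h3, h4.trans h1.symm⟩
  · obtain ⟨m', h3, h4, h5, -⟩ := h.loc.g_sent e he
    exact ⟨m', h3, h4.trans h1, h5.trans h2⟩

/-- The delicate case is a forwarded update, which must not overtake earlier updates of the same
writer. The sender `j` sent those before `m`, so they have already been received through the FIFO
channel, and `FullInv.exists_sent` shows that `i` has sent them. -/
lemma FullInv.record {S : Fin n → List (Msg n)} {i j : Fin n} {s : Loc n}
    {R : Fin n → List (Msg n)} (h : FullInv S i s R) {m : Msg n} (hm : R j ++ [m] <+: S j) :
    FullInv (Function.update S i (S i ++ (recordMsg i j m s).2)) i (recordMsg i j m s).1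
      (Function.update R j (R j ++ [m])) := by
  classical
  have hmS : m ∈ S j := hm.subset (by simp)
  have hpre : ∀ l, Function.update R j (R j ++ [m]) l <+: S l := by
    intro l
    by_cases hl : l = j
    · subst hl; simpa using hm
    · simpa [hl] using h.pre l
  -- A sender stamps an update once, so recording the stamp of `m` overwrites no stamp already
  -- received.
  have hfresh : ∀ m' ∈ R j, m'.k = m.k → m'.t ≠ m.t := by
    intro m' hm' hk ht
    have h1 := h.sent.key j m' ((h.pre j).subset hm') m hmS hk ht
    subst h1
    have h2 := (h.sent.sorted j).sublist hm.sublist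
    exact absurd ((List.pairwise_append.1 h2).2.2 m' hm' m' (by simp)) (lt_irrefl _)
  rcases recordMsg_cases i j m s with ⟨hle, heq⟩ | ⟨hlt, ⟨g, hg, hgk, hgt⟩, heq⟩ |
    ⟨hlt, hno, hG, hout⟩
  · rw [heq]
    simp only [List.append_nil, Function.update_eq_self]
    refine ⟨h.sent, hpre, ⟨h.loc.1, h.loc.2, h.loc.3, h.loc.4, ?_, ?_⟩, h.alive⟩
    · intro e he l c hc
      obtain ⟨m', h1, h2⟩ := h.loc.g_rcv e he l c hc
      exact ⟨m', mem_update_append.2 (.inl h1), h2⟩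
    · intro l m' hm'
      replace hm' := mem_update_append.1 hm'
      rcases hm' with hm' | ⟨rfl, hm'⟩
      · exact h.loc.r_known l m' hm'
      · obtain rfl := List.mem_singleton.1 hm'
        exact .inl hle
  · rw [heq]
    simp only [List.append_nil, Function.update_eq_self]
    set f : Entry n → Entry n := fun g =>
      if g.k = m.k ∧ g.t = m.t then { g with cl := Function.update g.cl j (m.cl : ℕ∞) } else g
      with hf
    have hfk : ∀ e, (f e).k = e.k := fun e => by simp only [hf]; split_ifs <;> rfl
    have hft : ∀ e, (f e).t = e.t := fun e => by simp only [hf]; split_ifs <;> rfl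
    have hfv : ∀ e, (f e).v = e.v := fun e => by simp only [hf]; split_ifs <;> rfl
    refine ⟨h.sent, hpre, ⟨?_, h.loc.2, ?_, ?_, ?_, ?_⟩, h.alive.1, ?_⟩
    · simp only [Finset.mem_image]
      rintro _ ⟨e, he, rfl⟩
      rw [hfk, hft, hfv]
      exact h.loc.g_sent e he
    · simp only [Finset.mem_image]
      rintro _ ⟨e, he, rfl⟩
      rw [hfk, hft]
      exact h.loc.g_vc e he
    · simp only [Finset.mem_image]
      rintro _ ⟨e, he, rfl⟩ _ ⟨e', he', rfl⟩
      rw [hfk, hft, hfk, hft]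
      intro h1 h2
      rw [h.loc.g_uniq e he e' he' h1 h2]
    · simp only [Finset.mem_image]
      rintro _ ⟨e, he, rfl⟩ l c hc
      rw [hfk, hft]
      by_cases hcond : e.k = m.k ∧ e.t = m.t
      · simp only [hf, if_pos hcond] at hc
        by_cases hl : l = j
        · subst hl
          simp only [Function.update_self, Nat.cast_inj] at hc
          exact ⟨m, by simp, hcond.1.symm, hcond.2.symm, hc⟩
        · simp only [Function.update_of_ne hl] at hc
          obtain ⟨m', h1, h2⟩ := h.loc.g_rcv e he l c hc
          exact ⟨m', mem_update_append.2 (.inl h1), h2⟩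
      · simp only [hf, if_neg hcond] at hc
        obtain ⟨m', h1, h2⟩ := h.loc.g_rcv e he l c hc
        exact ⟨m', mem_update_append.2 (.inl h1), h2⟩
    · intro l m' hm'
      replace hm' := mem_update_append.1 hm'
      rcases hm' with hm' | ⟨rfl, hm'⟩
      · rcases h.loc.r_known l m' hm' with h1 | ⟨e, he, h1, h2, h3⟩
        · exact .inl h1
        · refine .inr ⟨f e, Finset.mem_image_of_mem _ he, by rw [hfk, h1], by rw [hft, h2], ?_⟩
          simp only [hf]
          split_ifs with hcond
          · have hl : l ≠ j := by
              rintro rfl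
              exact hfresh m' hm' (h1.symm.trans hcond.1) (h2.symm.trans hcond.2)
            simpa [hl] using h3
          · exact h3
      · obtain rfl := List.mem_singleton.1 hm'
        refine .inr ⟨f g, Finset.mem_image_of_mem _ hg, by rw [hfk, hgk], by rw [hft, hgt], ?_⟩
        simp [hf, hgk, hgt]
    · intro m' hm' hk
      rcases h.alive.s_known m' hm' hk with h1 | ⟨e, he, h1, h2⟩
      · exact .inl h1
      · exact .inr ⟨f e, Finset.mem_image_of_mem _ he, by rw [hfk, h1], by rw [hft, h2]⟩
  · obtain ⟨-, hVC, hX, -, -, -, -⟩ := recordMsg_frame i j m s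
    set s₁ := (recordMsg i j m s).1
    set out := (recordMsg i j m s).2
    have hsent : SentInv (Function.update S i (S i ++ out)) := by
      rcases hout with ⟨-, -, ho⟩ | ⟨hk, -, ho⟩
      · rw [ho]; simpa using h.sent
      · rw [ho]
        refine h.sent.append_forward hmS hk
          (fun m hm => Nat.lt_succ_of_le (h.alive.sc m hm)) ?_ ?_
        · intro m' hm' hk' ht'
          rcases h.alive.s_known m' hm' (hk'.trans_ne hk) with h1 | ⟨e, he, h1, h2⟩
          · rw [hk', ht'] at h1; omega
          · exact hno ⟨e, he, h1.trans hk', h2.trans ht'⟩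
        · intro m' hm' hk' ht'
          obtain ⟨m'', h1, h2, h3, h4⟩ := h.sent.fifo j m hmS m' hm' hk' ht'
          have h5 : m'' ∈ R j := by
            have := h.sent.mem_of_prefix hm (m := m) (by simp) h1 h4.le
            rcases List.mem_append.1 this with h5 | h5
            · exact h5
            · rw [List.mem_singleton.1 h5] at h4; omega
          obtain ⟨m₃, h6, h7, h8⟩ := h.exists_sent h5 h2 hm' hk' h3.symm
          exact ⟨m₃, h6, h7.trans h2, h8.trans h3⟩
    have hSi : Function.update S i (S i ++ out) i = S i ++ out := by simp
    refine ⟨hsent, fun l => ?_, ?_, ?_, ?_⟩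
    · refine (hpre l).trans ?_
      by_cases hl : l = i
      · subst hl; simp
      · simp [hl]
    · rw [hSi]
      have hL := h.loc.mono out
      refine ⟨?_, ?_, ?_, ?_, ?_, ?_⟩
      · rw [hG]
        intro e he
        rcases Finset.mem_insert.1 he with rfl | he
        · rcases hout with ⟨hk, -, ho⟩ | ⟨hk, -, ho⟩
          · obtain ⟨m₀, h1, h2, h3, h4⟩ := h.sent.origin j m hmS
            rw [hk] at h1
            exact ⟨m₀, by simp [h1], h2, h3, h4⟩
          · exact ⟨⟨m.v, m.k, m.t, s.SC + 1⟩, by simp [ho], rfl, rfl, rfl⟩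
        · exact hL.g_sent e he
      · rw [hVC, hX]; exact hL.vc_sent
      · rw [hVC, hG]
        intro e he
        rcases Finset.mem_insert.1 he with rfl | he
        · exact hlt
        · exact hL.g_vc e he
      · rw [hG]
        intro e he e' he' hk ht
        rcases Finset.mem_insert.1 he with rfl | he <;>
          rcases Finset.mem_insert.1 he' with rfl | he'
        · rfl
        · exact absurd ⟨e', he', hk.symm, ht.symm⟩ hno
        · exact absurd ⟨e, he, hk, ht⟩ hno
        · exact hL.g_uniq e he e' he' hk ht
      · rw [hG]
        intro e he l c hc
        rcases Finset.mem_insert.1 he with rfl | he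
        · by_cases hl : l = j
          · subst hl
            simp only [Function.update_self, Nat.cast_inj] at hc
            exact ⟨m, by simp, rfl, rfl, hc⟩
          · simp [hl] at hc
        · obtain ⟨m', h1, h2⟩ := hL.g_rcv e he l c hc
          exact ⟨m', mem_update_append.2 (.inl h1), h2⟩
      · rw [hG, hVC]
        intro l m' hm'
        replace hm' := mem_update_append.1 hm'
        rcases hm' with hm' | ⟨rfl, hm'⟩
        · rcases hL.r_known l m' hm' with h1 | ⟨e, he, h1⟩
          · exact .inl h1
          · exact .inr ⟨e, Finset.mem_insert_of_mem he, h1⟩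
        · obtain rfl := List.mem_singleton.1 hm'
          exact .inr ⟨_, Finset.mem_insert_self _ _, rfl, rfl, by simp⟩
    · rw [hSi]
      intro m' hm'
      rcases List.mem_append.1 hm' with hm' | hm'
      · have := h.alive.sc m' hm'
        rcases hout with ⟨-, h1, -⟩ | ⟨-, h1, -⟩ <;> omega
      · rcases hout with ⟨-, h1, ho⟩ | ⟨-, h1, ho⟩
        · simp [ho] at hm'
        · rw [ho] at hm'
          rw [h1, List.mem_singleton.1 hm']
    · rw [hSi, hG, hVC]
      intro m' hm' hk'
      rcases List.mem_append.1 hm' with hm' | hm'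
      · rcases h.alive.s_known m' hm' hk' with h1 | ⟨e, he, h1⟩
        · exact .inl h1
        · exact .inr ⟨e, Finset.mem_insert_of_mem he, h1⟩
      · rcases hout with ⟨-, h1, ho⟩ | ⟨-, h1, ho⟩
        · simp [ho] at hm'
        · rw [ho] at hm'
          rw [List.mem_singleton.1 hm']
          exact .inr ⟨_, Finset.mem_insert_self _ _, rfl, rfl⟩

/-- What could fail is that a remaining entry `e` is overtaken by a validated entry `g` of the same
writer with a larger stamp. Closedness provides a process `l` with `g.cl l < e.cl l`; but `l` sent
the two updates in the writer's order and its message on `e` has also arrived, so `e.cl l < g.cl l`.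
-/
lemma FullInv.validate {S : Fin n → List (Msg n)} {i : Fin n} {s s' : Loc n}
    {R : Fin n → List (Msg n)} (h : FullInv S i s R) (hv : ValidateStep s s') :
    FullInv S i s' R := by
  classical
  obtain ⟨G', hl, hG, hV⟩ := hv.spec
  have hsub : ∀ e ∈ G', e ∈ s.G := fun e he => hl.closed.subset he
  refine ⟨h.sent, h.pre, ⟨?_, ?_, ?_, ?_, ?_, ?_⟩, ?_, ?_⟩
  · intro e he
    rw [hG, Finset.mem_sdiff] at he
    exact h.loc.g_sent e he.1
  · intro k
    rcases hV.cases k with ⟨h1, h2⟩ | ⟨g, hg, rfl, h1, h2⟩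
    · rw [h1, h2]; exact h.loc.vc_sent k
    · rw [h1, h2]; exact .inr (h.loc.g_sent g (hsub g hg))
  · intro e he
    rw [hG, Finset.mem_sdiff] at he
    rcases hV.cases e.k with ⟨h1, -⟩ | ⟨g, hg, hk, h1, -⟩
    · rw [h1]; exact h.loc.g_vc e he.1
    · rw [h1]
      by_contra hle
      have hne : e.t ≠ g.t := fun ht =>
        he.2 (h.loc.g_uniq e he.1 g (hsub g hg) hk.symm ht ▸ hg)
      have hlt : e.t < g.t := lt_of_le_of_ne (not_lt.mp hle) hne
      have hmaj := hl.closed.2 e he.1 he.2 g hg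
      have hpos : 0 < (Finset.univ.filter fun l => g.cl l < e.cl l).card := by omega
      obtain ⟨l, hl'⟩ := Finset.card_pos.1 hpos
      have hcl := (Finset.mem_filter.1 hl').2
      obtain ⟨c, hc⟩ := ENat.ne_top_iff_exists.1 hcl.ne_top
      obtain ⟨m, h2, h3, h4, h5⟩ := h.loc.g_rcv g (hsub g hg) l c hc.symm
      obtain ⟨m₁, h6, h7, h8, -⟩ := h.loc.g_sent e he.1
      obtain ⟨m₂, h9, h10, h11, h12⟩ := h.fifo h2 h6 (by rw [h7, h3, hk]) (by omega)
      have hk2 : m₂.k = e.k := by rw [h10, h3, hk]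
      rcases h.loc.r_known l m₂ h9 with h13 | ⟨e', he', h13, h14, h15⟩
      · have := h.loc.g_vc e he.1
        rw [hk2] at h13; omega
      · have : e' = e := h.loc.g_uniq e' he' e he.1 (h13.trans hk2) (h14.trans (h11.trans h8))
        subst this
        rw [h15, ← hc, Nat.cast_lt] at hcl
        omega
  · intro e he e' he'
    rw [hG, Finset.mem_sdiff] at he he'
    exact h.loc.g_uniq e he.1 e' he'.1
  · intro e he
    rw [hG, Finset.mem_sdiff] at he
    exact h.loc.g_rcv e he.1
  · intro l m hm
    rcases h.loc.r_known l m hm with h1 | ⟨e, he, h1, h2, h3⟩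
    · exact .inl (h1.trans (hV.mono _))
    · by_cases hg : e ∈ G'
      · exact .inl (h1 ▸ h2 ▸ hV.le e hg)
      · exact .inr ⟨e, by simp [hG, he, hg], h1, h2, h3⟩
  · rw [hV.SC]; exact h.alive.sc
  · intro m hm hk
    rcases h.alive.s_known m hm hk with h1 | ⟨e, he, h1, h2⟩
    · exact .inl (h1.trans (hV.mono _))
    · by_cases hg : e ∈ G'
      · exact .inl (h1 ▸ h2 ▸ hV.le e hg)
      · exact .inr ⟨e, by simp [hG, he, hg], h1, h2⟩

lemma ValidateStep.eq_empty {s s' : Loc n} (hv : ValidateStep s s') :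
    ∀ D, Closed s'.G D → D = ∅ := by
  obtain ⟨G', hl, hG, -⟩ := hv.spec
  intro D hD
  rw [hG] at hD
  exact hl.eq_empty_of_closed_sdiff hD

open Classical in
lemma flush_cases (i : Fin n) (s : Loc n) :
    ((s.V ≠ none → ¬ s.NoOwn i) ∧ flush i s = (s, [])) ∨
    (∃ v, s.V = some v ∧ s.NoOwn i ∧
      flush i s = ({ s with SC := s.SC + 1, V := none }, [⟨v, i, s.SC + 1, s.SC + 1⟩])) := by
  unfold flush
  split
  · next h => exact .inl ⟨fun h' => absurd h h', rfl⟩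
  · next v h =>
    split_ifs with hN
    · exact .inr ⟨v, h, hN, rfl⟩
    · exact .inl ⟨fun _ => hN, rfl⟩

open Classical in
lemma writeCode_cases (i : Fin n) (v : ℕ) (s : Loc n) :
    (s.NoOwn i ∧ writeCode i v s = ({ s with SC := s.SC + 1 }, [⟨v, i, s.SC + 1, s.SC + 1⟩])) ∨
    (¬ s.NoOwn i ∧ writeCode i v s = ({ s with V := some v }, [])) := by
  unfold writeCode
  split_ifs with h
  · exact .inl ⟨h, rfl⟩
  · exact .inr ⟨h, rfl⟩

/-- The effect of the code of a reception on the variables, and the updates it broadcasts. -/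
structure HandleFrame (i : Fin n) (s s' : Loc n) (out : List (Msg n)) : Prop where
  SC : s.SC ≤ s'.SC
  mono : ∀ k, s.VC k ≤ s'.VC k
  inSnap : s'.inSnap = s.inSnap
  crashed : s'.crashed = s.crashed
  own : ∀ m ∈ out, m.k = i → s.V = some m.v ∧ s.SC < m.t
  V : (s'.V = s.V ∧ ∀ m ∈ out, m.k ≠ i) ∨ (s'.V = none ∧ ∃ m ∈ out, m.k = i)
  rest : RestInv i s'

lemma Handle.frame {i j : Fin n} {m : Msg n} {s s' : Loc n} {out : List (Msg n)}
    (h : Handle i j m s s' out) : HandleFrame i s s' out := by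
  classical
  obtain ⟨s₁, hv, rfl, rfl⟩ := h
  obtain ⟨hV, hVC, -, hin, hcr, hSC, ho⟩ := recordMsg_frame i j m s
  obtain ⟨G', -, -, hs⟩ := hv.spec
  have hS : s.SC ≤ s₁.SC := hs.SC ▸ hSC
  rcases flush_cases i s₁ with ⟨h1, h2⟩ | ⟨v, h1, h2, h3⟩
  · rw [h2]
    simp only [List.append_nil]
    exact ⟨hS, fun k => hVC ▸ hs.mono k, hs.inSnap.trans hin, hs.crashed.trans hcr,
      fun m hm hk => absurd hk (ho m hm), .inl ⟨hs.V.trans hV, ho⟩, hv.eq_empty, h1⟩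
  · rw [h3]
    refine ⟨hS.trans (Nat.le_succ _), fun k => hVC ▸ hs.mono k, hs.inSnap.trans hin,
      hs.crashed.trans hcr, ?_, .inr ⟨rfl, ?_⟩, hv.eq_empty, fun h => absurd rfl h⟩
    · simp only [List.mem_append, List.mem_singleton]
      rintro m' (hm | rfl) hk
      · exact absurd hk (ho m' hm)
      · exact ⟨by rw [← hV, ← hs.V, h1], Nat.lt_succ_of_le hS⟩
    · exact ⟨⟨v, i, s₁.SC + 1, s₁.SC + 1⟩, by simp, rfl⟩

lemma OwnDone.append_own {i : Fin n} {s : Loc n} {Si : List (Msg n)} {v c : ℕ}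
    (hc : ∀ m ∈ Si, m.k = i → m.t ≤ s.VC i ∧ m.t < c) :
    OwnDone i s (Si ++ [⟨v, i, c, c⟩]) := by
  intro m hm m' hm' hk hk' ht
  simp only [List.mem_append, List.mem_singleton] at hm hm'
  rcases hm with hm | rfl
  · exact (hc m hm hk).1
  · rcases hm' with hm' | rfl
    · exact absurd ht (hc m' hm' hk').2.le.not_gt
    · exact absurd ht (lt_irrefl _)

lemma OwnDone.append_forward {i : Fin n} {s : Loc n} {Si out : List (Msg n)}
    (h : OwnDone i s Si) (ho : ∀ m ∈ out, m.k ≠ i) : OwnDone i s (Si ++ out) := by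
  intro m hm m' hm' hk hk' ht
  rcases List.mem_append.1 hm with hm | hm
  · rcases List.mem_append.1 hm' with hm' | hm'
    · exact h m hm m' hm' hk hk' ht
    · exact absurd hk' (ho _ hm')
  · exact absurd hk (ho _ hm)

lemma FullInv.own_lt {S : Fin n → List (Msg n)} {i : Fin n} {s : Loc n} {R : Fin n → List (Msg n)}
    (h : FullInv S i s R) {m : Msg n} (hm : m ∈ S i) (hk : m.k = i) : m.t < s.SC + 1 :=
  h.sent.own i m hm hk ▸ Nat.lt_succ_of_le (h.alive.sc m hm)

/-- An own message that has been received is either validated or still an entry of `G`, and the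
latter is what `NoOwn` excludes. -/
lemma FullInv.own_validated {S : Fin n → List (Msg n)} {i : Fin n} {s : Loc n}
    {R : Fin n → List (Msg n)} (h : FullInv S i s R) (hN : s.NoOwn i) {m : Msg n} (hm : m ∈ R i)
    (hk : m.k = i) : m.t ≤ s.VC i := by
  rcases h.loc.r_known i m hm with h1 | ⟨e, he, h1, -⟩
  · rwa [hk] at h1
  · exact absurd (h1.trans hk) (hN e he)

/-- The hypothesis `hown` serves `OwnDone`: when the postponed write is broadcast, all earlier own
updates have come back and none is left in `G`, so they are all validated. -/
lemma FullInv.handle {S : Fin n → List (Msg n)} {i j : Fin n} {s s' : Loc n}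
    {R : Fin n → List (Msg n)} (h : FullInv S i s R) {m : Msg n} (hm : R j ++ [m] <+: S j)
    {out : List (Msg n)} (hH : Handle i j m s s' out)
    (hown : s.V ≠ none → ∀ m' ∈ S i, m'.k = i → m' ∈ R i) (hd : OwnDone i s (S i)) :
    FullInv (Function.update S i (S i ++ out)) i s' (Function.update R j (R j ++ [m])) ∧
      OwnDone i s' (S i ++ out) := by
  classical
  obtain ⟨s₁, hv, rfl, rfl⟩ := hH
  have h1 := (h.record hm).validate hv
  obtain ⟨hV, hVC, -, hin, hcr, hSC, ho⟩ := recordMsg_frame i j m s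
  obtain ⟨G', -, -, hs⟩ := hv.spec
  have hd1 : OwnDone i s₁ (S i ++ (recordMsg i j m s).2) := by
    have := hd.append_forward ho
    intro m₁ h1 m₂ h2 h3 h4 h5
    exact (this m₁ h1 m₂ h2 h3 h4 h5).trans (hVC ▸ hs.mono i)
  rcases flush_cases i s₁ with ⟨-, h3⟩ | ⟨v, h2, h3, h4⟩
  · rw [h3]
    simp only [List.append_nil]
    exact ⟨h1, hd1⟩
  · rw [h4]
    have h5 := h1.append_own v none
    simp only [Function.update_self, Function.update_idem, List.append_assoc] at h5
    refine ⟨h5, ?_⟩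
    have h6 := OwnDone.append_own (s := s₁) (i := i)
      (Si := S i ++ (recordMsg i j m s).2) (v := v) (c := s₁.SC + 1) ?_
    · rw [List.append_assoc] at h6
      exact h6
    · intro m' hm' hk
      refine ⟨?_, h1.own_lt (by simpa using hm') hk⟩
      refine h1.own_validated h3 (m := m') (mem_update_append.2 (.inl ?_)) hk
      refine hown ?_ m' ?_ hk
      · rw [← hV, ← hs.V, h2]; simp
      · exact (List.mem_append.1 hm').resolve_right fun h' => ho m' h' hk

lemma FullInv.write {S : Fin n → List (Msg n)} {i : Fin n} {s : Loc n}
    {R : Fin n → List (Msg n)} (h : FullInv S i s R) (v : ℕ)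
    (hown : ∀ m' ∈ S i, m' ∈ R i) (hd : OwnDone i s (S i)) :
    FullInv (Function.update S i (S i ++ (writeCode i v s).2)) i (writeCode i v s).1 R ∧
      OwnDone i (writeCode i v s).1 (S i ++ (writeCode i v s).2) := by
  rcases writeCode_cases i v s with ⟨h1, h2⟩ | ⟨h1, h2⟩
  · rw [h2]
    refine ⟨h.append_own v s.V, OwnDone.append_own fun m hm hk => ?_⟩
    exact ⟨h.own_validated h1 (hown m hm) hk, h.own_lt hm hk⟩
  · rw [h2]
    simp only [List.append_nil, Function.update_eq_self]
    exact ⟨⟨h.sent, h.pre, ⟨h.loc.1, h.loc.2, h.loc.3, h.loc.4, h.loc.5, h.loc.6⟩,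
      h.alive.1, h.alive.2⟩, hd⟩

/-! ### Global invariant -/

/-- A configuration together with the sequences `S l` of the messages broadcast by the processes
`l` (including those whose broadcast was interrupted by a crash), and the sequences `R i l` of the
messages of `l` that have been processed by `i`. -/
structure Ghost (n : ℕ) where
  c : Config n
  S : Fin n → List (Msg n)
  R : Fin n → Fin n → List (Msg n)

/-- `e` is a write event of process `i` with value `v`. -/
def Event.IsWrite (e : Event n) (i : Fin n) (v : ℕ) : Prop := e = .write i v ∨ e = .crashWrite i v

/-- The transitions, with the sequences of messages that are broadcast and processed. -/
inductive GhostStep : Ghost n → Event n → Ghost n → Prop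
  | idle (g) : GhostStep g .idle g
  | quiet (g e i a b) : ((g.c.loc i).crashed = true → b = true) →
      (∀ i v, ¬ e.IsWrite i v) → (∀ i j, e ≠ .receive i j) →
      GhostStep g e ⟨g.c.act i { g.c.loc i with inSnap := a, crashed := b } (fun _ => []), g.S, g.R⟩
  | write (g i v) : g.c.Ready i →
      GhostStep g (.write i v)
        ⟨g.c.act i (writeCode i v (g.c.loc i)).1 (fun _ => (writeCode i v (g.c.loc i)).2),
          Function.update g.S i (g.S i ++ (writeCode i v (g.c.loc i)).2), g.R⟩
  | crashWrite (g i v sent) : g.c.Ready i →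
      PartialBroadcast (writeCode i v (g.c.loc i)).2 sent →
      GhostStep g (.crashWrite i v)
        ⟨g.c.act i { g.c.loc i with crashed := true } sent,
          Function.update g.S i (g.S i ++ (writeCode i v (g.c.loc i)).2), g.R⟩
  | receive (g i j m q s' out) : (g.c.loc i).crashed = false →
      g.c.chan j i = m :: q → Handle i j m (g.c.loc i) s' out →
      GhostStep g (.receive i j)
        ⟨(g.c.setChan j i q).act i s' (fun _ => out), Function.update g.S i (g.S i ++ out),
          Function.update g.R i (Function.update (g.R i) j (g.R i j ++ [m]))⟩
  | crashReceive (g i j m q s' out sent) : (g.c.loc i).crashed = false →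
      g.c.chan j i = m :: q → Handle i j m (g.c.loc i) s' out → PartialBroadcast out sent →
      GhostStep g (.crashReceive i j)
        ⟨(g.c.setChan j i q).act i { g.c.loc i with crashed := true } sent,
          Function.update g.S i (g.S i ++ out), g.R⟩

lemma Step.ghost {c c' : Config n} {e : Event n} (h : Step c e c') (S : Fin n → List (Msg n))
    (R : Fin n → Fin n → List (Msg n)) : ∃ g', g'.c = c' ∧ GhostStep ⟨c, S, R⟩ e g' := by
  cases h with
  | idle => exact ⟨_, rfl, .idle _⟩
  | write i v h1 h2 => exact ⟨_, rfl, .write _ i v h1⟩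
  | crashWrite i v sent h1 h2 h3 => exact ⟨_, rfl, .crashWrite _ i v sent h1 h3⟩
  | callSnap i h1 h2 =>
    exact ⟨_, rfl, .quiet _ _ i true (c.loc i).crashed id (by simp [Event.IsWrite]) (by simp)⟩
  | retSnap i h1 h2 h3 h4 =>
    exact ⟨_, rfl, .quiet _ _ i false (c.loc i).crashed id (by simp [Event.IsWrite]) (by simp)⟩
  | receive i j m q s' out h1 h2 h3 h4 => exact ⟨_, rfl, .receive _ i j m q s' out h1 h3 h4⟩
  | crashReceive i j m q s' out sent h1 h2 h3 h4 h5 =>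
    exact ⟨_, rfl, .crashReceive _ i j m q s' out sent h1 h3 h4 h5⟩
  | crash i h1 =>
    exact ⟨_, rfl, .quiet _ _ i (c.loc i).inSnap true (fun _ => rfl) (by simp [Event.IsWrite])
      (by simp)⟩

/-- Global invariant of the executions. -/
structure Inv (g : Ghost n) : Prop where
  sent : SentInv g.S
  pre : ∀ i l, g.R i l <+: g.S l
  chan : ∀ i l, (g.c.loc i).crashed = false → g.R i l ++ g.c.chan l i <+: g.S l
  chan_eq : ∀ i l, (g.c.loc i).crashed = false → (g.c.loc l).crashed = false →
    g.R i l ++ g.c.chan l i = g.S l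
  loc : ∀ i, LocInv i (g.c.loc i) (g.S i) (g.R i)
  rest : ∀ i, RestInv i (g.c.loc i)
  alive : ∀ i, (g.c.loc i).crashed = false → AliveInv i (g.c.loc i) (g.S i)
  done : ∀ i, (g.c.loc i).crashed = false → OwnDone i (g.c.loc i) (g.S i)
  post : ∀ i, (g.c.loc i).crashed = false → (g.c.loc i).V ≠ none → ∀ m ∈ g.c.chan i i, m.k ≠ i

lemma Inv.full {g : Ghost n} (h : Inv g) {i : Fin n} (hi : (g.c.loc i).crashed = false) :
    FullInv g.S i (g.c.loc i) (g.R i) :=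
  ⟨h.sent, h.pre i, h.loc i, h.alive i hi⟩

lemma inv_initial : Inv (⟨Config.initial n, fun _ => [], fun _ _ => []⟩ : Ghost n) := by
  refine ⟨⟨?_, ?_, ?_, ?_, ?_, ?_⟩, ?_, ?_, ?_, fun i => ⟨?_, ?_, ?_, ?_, ?_, ?_⟩,
    fun i => ⟨?_, ?_⟩, fun i _ => ⟨?_, ?_⟩, ?_, ?_⟩ <;>
    try simp [Config.initial, Loc.initial, OwnDone]
  intro D hD
  simpa using hD.subset

lemma Config.act_loc (c : Config n) (i : Fin n) (s : Loc n) (sent : Fin n → List (Msg n))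
    (l : Fin n) : (c.act i s sent).loc l = if l = i then s else c.loc l := by
  simp [Config.act, Function.update_apply]

lemma Config.act_chan (c : Config n) (i : Fin n) (s : Loc n) (sent : Fin n → List (Msg n))
    (l j : Fin n) : (c.act i s sent).chan l j = if l = i then c.chan i j ++ sent j else c.chan l j := by
  by_cases h : l = i <;> simp [Config.act, h]

lemma Config.setChan_chan (c : Config n) (j i : Fin n) (q : List (Msg n)) (l k : Fin n) :
    (c.setChan j i q).chan l k = if l = j ∧ k = i then q else c.chan l k := by
  by_cases h : l = j
  · subst h
    by_cases h' : k = i <;> simp [Config.setChan, h']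
  · simp [Config.setChan, h]

lemma PartialBroadcast.prefix {out : List (Msg n)} {sent : Fin n → List (Msg n)}
    (h : PartialBroadcast out sent) (j : Fin n) : sent j <+: out := by
  obtain ⟨b, D, h⟩ := h
  by_cases hj : j ∈ D
  · rw [(h j).1 hj]; exact List.take_prefix _ _
  · rw [(h j).2 hj]; exact List.take_prefix _ _

/-- The invariant is preserved when process `i` goes to state `s'` and broadcasts `out`, given the
invariants of its new local state. -/
lemma Inv.act {g : Ghost n} (h : Inv g) {i : Fin n} {s' : Loc n} {out : List (Msg n)}
    {c₁ : Config n} {R' : Fin n → Fin n → List (Msg n)} (hcr : (g.c.loc i).crashed = false)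
    (hloc : ∀ l, l ≠ i → c₁.loc l = g.c.loc l)
    (hR : ∀ j l, R' j l ++ c₁.chan l j = g.R j l ++ g.c.chan l j)
    (hpre : ∀ l, R' i l <+: g.S l)
    (hRi : ∀ j, j ≠ i → R' j = g.R j)
    (hf : FullInv (Function.update g.S i (g.S i ++ out)) i s' (R' i))
    (hrest : RestInv i s') (hd : OwnDone i s' (g.S i ++ out))
    (hpost : s'.V ≠ none → ∀ m ∈ c₁.chan i i ++ out, m.k ≠ i) :
    Inv ⟨c₁.act i s' (fun _ => out), Function.update g.S i (g.S i ++ out), R'⟩ := by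
  have hSi : Function.update g.S i (g.S i ++ out) i = g.S i ++ out := by simp
  have hSl : ∀ l, l ≠ i → Function.update g.S i (g.S i ++ out) l = g.S l := fun l hl => by
    simp [hl]
  have hpr : ∀ l, g.S l <+: Function.update g.S i (g.S i ++ out) l := fun l => by
    by_cases hl : l = i
    · subst hl; simp
    · simp [hl]
  have hcrash : ∀ l, ((c₁.act i s' (fun _ => out)).loc l).crashed = false →
      (g.c.loc l).crashed = false := by
    intro l hl
    by_cases hli : l = i
    · rw [hli, hcr]
    · rwa [Config.act_loc, if_neg hli, hloc l hli] at hl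
  refine ⟨hf.sent, fun j l => ?_, fun j l hj => ?_, fun j l hj hl => ?_, fun j => ?_, fun j => ?_,
    fun j hj => ?_, fun j hj => ?_, fun j hj => ?_⟩
  · refine List.IsPrefix.trans ?_ (hpr l)
    by_cases hji : j = i
    · subst hji; exact hpre l
    · show R' j l <+: g.S l
      rw [hRi j hji]; exact h.pre j l
  · have hj' := hcrash j hj
    simp only [Config.act_chan]
    by_cases hl : l = i
    · subst hl
      rw [if_pos rfl, ← List.append_assoc, hR, h.chan_eq j l hj' hcr, hSi]
    · rw [if_neg hl, hR, hSl l hl]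
      exact h.chan j l hj'
  · have hj' := hcrash j hj
    simp only [Config.act_chan]
    by_cases hl' : l = i
    · subst hl'
      rw [if_pos rfl, ← List.append_assoc, hR, h.chan_eq j l hj' hcr, hSi]
    · rw [if_neg hl', hR, hSl l hl']
      exact h.chan_eq j l hj' (hcrash l hl)
  · simp only [Config.act_loc]
    by_cases hji : j = i
    · subst hji
      rw [if_pos rfl]; exact hf.loc
    · rw [if_neg hji, hSl j hji, hRi j hji, hloc j hji]; exact h.loc j
  · simp only [Config.act_loc]
    by_cases hji : j = i
    · subst hji
      rw [if_pos rfl]; exact hrest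
    · rw [if_neg hji, hloc j hji]; exact h.rest j
  · have hj' := hcrash j hj
    simp only [Config.act_loc]
    by_cases hji : j = i
    · subst hji
      rw [if_pos rfl]; exact hf.alive
    · rw [if_neg hji, hloc j hji, hSl j hji]; exact h.alive j hj'
  · have hj' := hcrash j hj
    simp only [Config.act_loc]
    by_cases hji : j = i
    · subst hji
      rw [if_pos rfl, hSi]; exact hd
    · rw [if_neg hji, hloc j hji, hSl j hji]; exact h.done j hj'
  · have hj' := hcrash j hj
    simp only [Config.act_loc, Config.act_chan]
    by_cases hji : j = i
    · subst hji
      rw [if_pos rfl, if_pos rfl]; exact hpost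
    · rw [if_neg hji, if_neg hji, hloc j hji]
      intro hV m hm
      have h1 := h.chan_eq j j hj' hj'
      have h2 := hR j j
      rw [hRi j hji] at h2
      rw [List.append_cancel_left h2] at hm
      exact h.post j hj' hV m hm

/-- The invariant is preserved when process `i` crashes during an event. -/
lemma Inv.fail {g : Ghost n} (h : Inv g) {i : Fin n} {out : List (Msg n)}
    {c₁ : Config n} {sent : Fin n → List (Msg n)} (hcr : (g.c.loc i).crashed = false)
    (hloc : ∀ l, l ≠ i → c₁.loc l = g.c.loc l)
    (hch : ∀ l j, j ≠ i → c₁.chan l j = g.c.chan l j)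
    (hsent : ∀ j, sent j <+: out)
    (hS : SentInv (Function.update g.S i (g.S i ++ out))) :
    Inv ⟨c₁.act i { g.c.loc i with crashed := true } sent,
      Function.update g.S i (g.S i ++ out), g.R⟩ := by
  have hSi : Function.update g.S i (g.S i ++ out) i = g.S i ++ out := by simp
  have hSl : ∀ l, l ≠ i → Function.update g.S i (g.S i ++ out) l = g.S l := fun l hl => by
    simp [hl]
  have hne : ∀ l, ((c₁.act i { g.c.loc i with crashed := true } sent).loc l).crashed = false →
      l ≠ i ∧ (g.c.loc l).crashed = false := by
    intro l hl
    by_cases hli : l = i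
    · simp [Config.act_loc, hli] at hl
    · rw [Config.act_loc, if_neg hli, hloc l hli] at hl
      exact ⟨hli, hl⟩
  refine ⟨hS, fun j l => ?_, fun j l hj => ?_, fun j l hj hl => ?_, fun j => ?_, fun j => ?_,
    fun j hj => ?_, fun j hj => ?_, fun j hj => ?_⟩
  · refine (h.pre j l).trans ?_
    by_cases hl : l = i
    · subst hl; simp
    · simp [hl]
  · obtain ⟨hji, hj'⟩ := hne j hj
    simp only [Config.act_chan]
    by_cases hl : l = i
    · subst hl
      -- `S` also counts the messages that the crash prevented from being sent. So from here on only
      -- the prefix relation `chan`, and no longer `chan_eq`, holds for the channels leaving this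
      -- process.
      rw [if_pos rfl, ← List.append_assoc, hch l j hji, h.chan_eq j l hj' hcr, hSi,
        List.prefix_append_right_inj]
      exact hsent j
    · rw [if_neg hl, hch l j hji, hSl l hl]
      exact h.chan j l hj'
  · obtain ⟨hji, hj'⟩ := hne j hj
    obtain ⟨hli, hl'⟩ := hne l hl
    simp only [Config.act_chan]
    rw [if_neg hli, hch l j hji, hSl l hli]
    exact h.chan_eq j l hj' hl'
  · simp only [Config.act_loc]
    by_cases hji : j = i
    · subst hji
      have h1 := (h.loc j).mono out
      rw [if_pos rfl, hSi]
      exact ⟨h1.1, h1.2, h1.3, h1.4, h1.5, h1.6⟩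
    · rw [if_neg hji, hSl j hji, hloc j hji]; exact h.loc j
  · simp only [Config.act_loc]
    by_cases hji : j = i
    · subst hji
      rw [if_pos rfl]
      exact ⟨(h.rest j).1, (h.rest j).2⟩
    · rw [if_neg hji, hloc j hji]; exact h.rest j
  · obtain ⟨hji, hj'⟩ := hne j hj
    simp only [Config.act_loc]
    rw [if_neg hji, hloc j hji, hSl j hji]; exact h.alive j hj'
  · obtain ⟨hji, hj'⟩ := hne j hj
    simp only [Config.act_loc]
    rw [if_neg hji, hloc j hji, hSl j hji]; exact h.done j hj'
  · obtain ⟨hji, hj'⟩ := hne j hj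
    simp only [Config.act_loc, Config.act_chan]
    rw [if_neg hji, if_neg hji, hloc j hji, hch j j hji]
    exact h.post j hj'

lemma Inv.mem_received {g : Ghost n} (h : Inv g) {i : Fin n} (hi : (g.c.loc i).crashed = false)
    {m : Msg n} (hm : m ∈ g.S i) (hc : m ∉ g.c.chan i i) : m ∈ g.R i i := by
  rw [← h.chan_eq i i hi hi] at hm
  exact (List.mem_append.1 hm).resolve_right hc

lemma GhostStep.inv {g g' : Ghost n} {e : Event n} (hs : GhostStep g e g') (h : Inv g) :
    Inv g' := by
  cases hs with
  | idle => exact h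
  | quiet _ i a b hb _ _ =>
    have hcr : ∀ l, ((g.c.act i { g.c.loc i with inSnap := a, crashed := b }
        (fun _ => [])).loc l).crashed = false → (g.c.loc l).crashed = false := by
      intro l hl
      by_cases hli : l = i
      · subst hli
        simp only [Config.act_loc] at hl
        by_contra hc
        simp [hb (by simpa using hc)] at hl
      · rwa [Config.act_loc, if_neg hli] at hl
    have hch : ∀ l j, (g.c.act i { g.c.loc i with inSnap := a, crashed := b }
        (fun _ => [])).chan l j = g.c.chan l j := by
      intro l j
      rw [Config.act_chan]
      split_ifs with hl
      · simp [hl]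
      · rfl
    refine ⟨h.sent, h.pre, fun j l hj => ?_, fun j l hj hl => ?_, fun j => ?_, fun j => ?_,
      fun j hj => ?_, fun j hj => ?_, fun j hj => ?_⟩
    · rw [hch]; exact h.chan j l (hcr j hj)
    · rw [hch]; exact h.chan_eq j l (hcr j hj) (hcr l hl)
    · have h1 := h.loc j
      rw [Config.act_loc]
      split_ifs with hji
      · subst hji; exact ⟨h1.1, h1.2, h1.3, h1.4, h1.5, h1.6⟩
      · exact h1
    · have h1 := h.rest j
      rw [Config.act_loc]
      split_ifs with hji
      · subst hji; exact ⟨h1.1, h1.2⟩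
      · exact h1
    · have h1 := h.alive j (hcr j hj)
      rw [Config.act_loc]
      split_ifs with hji
      · subst hji; exact ⟨h1.1, h1.2⟩
      · exact h1
    · have h1 := h.done j (hcr j hj)
      rw [Config.act_loc]
      split_ifs with hji
      · subst hji; exact h1
      · exact h1
    · have h1 := h.post j (hcr j hj)
      rw [Config.act_loc, hch]
      split_ifs with hji
      · subst hji; exact h1
      · exact h1
  | write i v hr =>
    have hf := (h.full hr.1).write v (fun m hm => h.mem_received hr.1 hm (by simp [hr.2]))
      (h.done i hr.1)
    have hV : (writeCode i v (g.c.loc i)).1.V ≠ none →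
        (writeCode i v (g.c.loc i)).2 = [] ∧ ¬ (g.c.loc i).NoOwn i := by
      rcases writeCode_cases i v (g.c.loc i) with ⟨h1, h2⟩ | ⟨h1, h2⟩
      · rw [h2]
        intro hV
        exact absurd h1 ((h.rest i).postponed hV)
      · rw [h2]
        exact fun _ => ⟨rfl, h1⟩
    have hG : (writeCode i v (g.c.loc i)).1.G = (g.c.loc i).G := by
      rcases writeCode_cases i v (g.c.loc i) with ⟨h1, h2⟩ | ⟨h1, h2⟩ <;> rw [h2]
    refine h.act hr.1 (fun _ _ => rfl) (fun _ _ => rfl) (h.pre i)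
      (fun _ _ => rfl) hf.1 ⟨?_, fun hV' => ?_⟩ hf.2 ?_
    · rw [hG]; exact (h.rest i).eq_empty
    · have := (hV hV').2
      unfold Loc.NoOwn at this ⊢
      rwa [hG]
    -- A write leaves `V` nonempty only if it is postponed, hence broadcasts nothing, and a ready
    -- process has an empty channel to itself.
    · intro hV' m hm
      rw [hr.2, (hV hV').1] at hm
      simp at hm
  | crashWrite i v sent hr hp =>
    have hf := (h.full hr.1).write v (fun m hm => h.mem_received hr.1 hm (by simp [hr.2]))
      (h.done i hr.1)
    exact h.fail hr.1 (fun _ _ => rfl) (fun _ _ _ => rfl) hp.prefix hf.1.sent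
  | receive i j m q s' out hcr hq hH =>
    have hm : g.R i j ++ [m] <+: g.S j := by
      refine List.IsPrefix.trans ?_ (h.chan i j hcr)
      rw [hq, List.prefix_append_right_inj]
      exact ⟨q, rfl⟩
    have hown : (g.c.loc i).V ≠ none → ∀ m' ∈ g.S i, m'.k = i → m' ∈ g.R i i := by
      intro hV m' hm' hk
      exact h.mem_received hcr hm' fun hc => h.post i hcr hV m' hc hk
    have hf := (h.full hcr).handle hm hH hown (h.done i hcr)
    have hfr := hH.frame
    refine h.act (c₁ := g.c.setChan j i q)
      (R' := Function.update g.R i (Function.update (g.R i) j (g.R i j ++ [m])))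
      hcr (fun _ _ => rfl) ?_ ?_ (fun _ hj => by simp [hj])
      (by simpa using hf.1) hfr.rest hf.2 ?_
    · intro j' l
      rw [Config.setChan_chan]
      by_cases hj : j' = i
      · subst hj
        by_cases hl : l = j
        · subst hl; simp [hq]
        · simp [hl]
      · simp [hj]
    · intro l
      by_cases hl : l = j
      · subst hl; simpa using hm
      · simpa [hl] using h.pre i l
    · intro hV m' hm'
      rcases hfr.V with ⟨h1, h2⟩ | ⟨h1, -⟩
      · rcases List.mem_append.1 hm' with hm' | hm'
        · refine h.post i hcr (h1 ▸ hV) m' ?_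
          rw [Config.setChan_chan] at hm'
          split_ifs at hm' with hc
          · rw [← hc.1] at hq
            rw [hq]; exact List.mem_cons_of_mem _ hm'
          · exact hm'
        · exact h2 m' hm'
      · exact absurd h1 hV
  | crashReceive i j m q s' out sent hcr hq hH hp =>
    have hm : g.R i j ++ [m] <+: g.S j := by
      refine List.IsPrefix.trans ?_ (h.chan i j hcr)
      rw [hq, List.prefix_append_right_inj]
      exact ⟨q, rfl⟩
    have hown : (g.c.loc i).V ≠ none → ∀ m' ∈ g.S i, m'.k = i → m' ∈ g.R i i := by
      intro hV m' hm' hk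
      exact h.mem_received hcr hm' fun hc => h.post i hcr hV m' hc hk
    -- The state `s'` is never reached because of the crash; it is used only to obtain `SentInv` for
    -- the sequence that includes the interrupted broadcast.
    have hf := (h.full hcr).handle hm hH hown (h.done i hcr)
    refine h.fail hcr (fun _ _ => rfl) ?_ hp.prefix hf.1.sent
    intro l j' hj
    rw [Config.setChan_chan, if_neg (fun hc => hj hc.2)]

/-! ### Executions with their sequences of messages -/

namespace Execution

variable (E : Execution n)

/-- The sequences of messages of an execution at time `τ`, with the configuration. -/
noncomputable def ghostAux : (τ : ℕ) → {g : Ghost n // g.c = E.conf τ}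
  | 0 => ⟨⟨E.conf 0, fun _ => [], fun _ _ => []⟩, rfl⟩
  | τ + 1 =>
    have h : Step (ghostAux τ).1.c (E.event τ) (E.conf (τ + 1)) := by
      rw [(ghostAux τ).2]; exact E.step τ
    ⟨(h.ghost (ghostAux τ).1.S (ghostAux τ).1.R).choose,
      (h.ghost (ghostAux τ).1.S (ghostAux τ).1.R).choose_spec.1⟩

/-- The messages broadcast by `l` before time `τ`. -/
noncomputable def S (τ : ℕ) (l : Fin n) : List (Msg n) := (E.ghostAux τ).1.S l

/-- The messages of `l` processed by `i` before time `τ`. -/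
noncomputable def R (τ : ℕ) (i l : Fin n) : List (Msg n) := (E.ghostAux τ).1.R i l

/-- The local state of `i` at time `τ`. -/
def loc (τ : ℕ) (i : Fin n) : Loc n := (E.conf τ).loc i

lemma ghostStep (τ : ℕ) :
    GhostStep ⟨E.conf τ, E.S τ, E.R τ⟩ (E.event τ) ⟨E.conf (τ + 1), E.S (τ + 1), E.R (τ + 1)⟩ := by
  have h : Step (E.ghostAux τ).1.c (E.event τ) (E.conf (τ + 1)) := by
    rw [(E.ghostAux τ).2]; exact E.step τ
  have h1 := (h.ghost (E.ghostAux τ).1.S (E.ghostAux τ).1.R).choose_spec.2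
  have h2 : ∀ g : Ghost n, ∀ c, g.c = c → g = ⟨c, g.S, g.R⟩ := by rintro g _ rfl; rfl
  have h3 := h2 _ _ (E.ghostAux (τ + 1)).2
  have h4 := h2 _ _ (E.ghostAux τ).2
  have h5 : GhostStep (E.ghostAux τ).1 (E.event τ) (E.ghostAux (τ + 1)).1 := h1
  rw [h3, h4] at h5
  exact h5

lemma inv (τ : ℕ) : Inv ⟨E.conf τ, E.S τ, E.R τ⟩ := by
  induction τ with
  | zero =>
    rw [E.init]
    exact inv_initial
  | succ τ ih => exact (E.ghostStep τ).inv ih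

end Execution

/-! ### Monotone quantities, and majorities at a single transition -/

/-- What is monotone along the transitions. -/
lemma GhostStep.mono {g g' : Ghost n} {e : Event n} (hs : GhostStep g e g') :
    (∀ l, g.S l <+: g'.S l) ∧ (∀ i l, g.R i l <+: g'.R i l) ∧
    (∀ i k, (g.c.loc i).VC k ≤ (g'.c.loc i).VC k) ∧ (∀ i, (g.c.loc i).SC ≤ (g'.c.loc i).SC) ∧
    (∀ i, (g.c.loc i).crashed = true →
      (g'.c.loc i).crashed = true ∧ g'.S i = g.S i) := by
  have hS : ∀ i out l, g.S l <+: Function.update g.S i (g.S i ++ out) l := by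
    intro i out l
    by_cases hl : l = i
    · subst hl; simp
    · simp [hl]
  have hS' : ∀ i out l, (g.c.loc i).crashed = false → (g.c.loc l).crashed = true →
      l ≠ i ∧ Function.update g.S i (g.S i ++ out) l = g.S l := by
    intro i out l hi hl
    have hli : l ≠ i := by rintro rfl; simp [hi] at hl
    exact ⟨hli, by simp [hli]⟩
  cases hs with
  | idle => exact ⟨by simp, by simp, by simp, by simp, by simp⟩
  | quiet e i a b hb _ _ =>
    refine ⟨by simp, by simp, fun j k => ?_, fun j => ?_, fun j hj => ⟨?_, rfl⟩⟩
    · rw [Config.act_loc]; split_ifs with h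
      · rw [h]
      · exact le_rfl
    · rw [Config.act_loc]; split_ifs with h
      · rw [h]
      · exact le_rfl
    · rw [Config.act_loc]; split_ifs with h
      · exact hb (h ▸ hj)
      · exact hj
  | write i v hr =>
    have h : (writeCode i v (g.c.loc i)).1.VC = (g.c.loc i).VC ∧
        (g.c.loc i).SC ≤ (writeCode i v (g.c.loc i)).1.SC := by
      rcases writeCode_cases i v (g.c.loc i) with ⟨-, h⟩ | ⟨-, h⟩ <;> rw [h] <;> simp
    refine ⟨hS _ _, by simp, fun j k => ?_, fun j => ?_, fun j hj => ⟨?_, (hS' i _ j hr.1 hj).2⟩⟩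
    · rw [Config.act_loc]; split_ifs with hj
      · rw [hj, h.1]
      · exact le_rfl
    · rw [Config.act_loc]; split_ifs with hj
      · rw [hj]; exact h.2
      · exact le_rfl
    · rwa [Config.act_loc, if_neg (hS' i [] j hr.1 hj).1]
  | crashWrite i v sent hr hp =>
    refine ⟨hS _ _, by simp, fun j k => ?_, fun j => ?_, fun j hj => ⟨?_, (hS' i _ j hr.1 hj).2⟩⟩
    · rw [Config.act_loc]; split_ifs with hj
      · rw [hj]
      · exact le_rfl
    · rw [Config.act_loc]; split_ifs with hj
      · rw [hj]
      · exact le_rfl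
    · rwa [Config.act_loc, if_neg (hS' i [] j hr.1 hj).1]
  | receive i j m q s' out hcr hq hH =>
    have hf := hH.frame
    refine ⟨hS _ _, fun i' l => ?_, fun j k => ?_, fun j => ?_,
      fun j hj => ⟨?_, (hS' i _ j hcr hj).2⟩⟩
    · by_cases hi : i' = i
      · subst hi
        by_cases hl : l = j
        · subst hl; simp
        · simp [hl]
      · simp [hi]
    · rw [Config.act_loc]; split_ifs with hj
      · rw [hj]; exact hf.mono k
      · exact le_rfl
    · rw [Config.act_loc]; split_ifs with hj
      · rw [hj]; exact hf.SC
      · exact le_rfl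
    · rw [Config.act_loc, if_neg (hS' i [] j hcr hj).1]; exact hj
  | crashReceive i j m q s' out sent hcr hq hH hp =>
    refine ⟨hS _ _, by simp, fun j k => ?_, fun j => ?_, fun j hj => ⟨?_, (hS' i _ j hcr hj).2⟩⟩
    · rw [Config.act_loc]; split_ifs with hj
      · rw [hj]
      · exact le_rfl
    · rw [Config.act_loc]; split_ifs with hj
      · rw [hj]
      · exact le_rfl
    · rw [Config.act_loc, if_neg (hS' i [] j hcr hj).1]; exact hj

open Classical in
/-- Among the updates known to `i`, an update validated during a validation step was stamped, by a
majority of the processes, before any update that is not validated yet. -/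
lemma FullInv.before_of_validate {S : Fin n → List (Msg n)} {i : Fin n} {s s' : Loc n}
    {R : Fin n → List (Msg n)} (h : FullInv S i s R) (hv : ValidateStep s s') {k' : Fin n}
    (hk' : s.VC k' < s'.VC k') {k : Fin n} {t : ℕ} (ht : s'.VC k < t) :
    n < 2 * (Finset.univ.filter fun l => ∃ m' ∈ R l, m'.k = k' ∧ m'.t = s'.VC k' ∧
      ∀ m ∈ R l, m.k = k → m.t = t → m'.cl < m.cl).card := by
  obtain ⟨G', hl, hG, hV⟩ := hv.spec
  have hsub : ∀ e ∈ G', e ∈ s.G := fun e he => hl.closed.subset he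
  rcases hV.cases k' with ⟨h1, -⟩ | ⟨g, hg, rfl, h1, -⟩
  · omega
  -- If the second update is an unvalidated entry, closedness compares the stamps. If it is not an
  -- entry, no message on it has been received, and the majority that stamped `g` suffices.
  · by_cases hx : ∃ e ∈ s.G, e.k = k ∧ e.t = t
    · obtain ⟨e, he, hek, het⟩ := hx
      have hne : e ∉ G' := fun hc => by
        have := hV.le e hc
        rw [hek] at this; omega
      refine (hl.closed.2 e he hne g hg).trans_le
        (Nat.mul_le_mul_left 2 (Finset.card_le_card ?_))
      intro l hl'
      have hcl := (Finset.mem_filter.1 hl').2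
      obtain ⟨c, hc⟩ := ENat.ne_top_iff_exists.1 hcl.ne_top
      obtain ⟨m', h2, h3, h4, h5⟩ := h.loc.g_rcv g (hsub g hg) l c hc.symm
      refine Finset.mem_filter.2 ⟨Finset.mem_univ _, m', h2, h3, h4.trans h1.symm, ?_⟩
      intro m hm hmk hmt
      rcases h.loc.r_known l m hm with h6 | ⟨e', he', h6, h7, h8⟩
      · have := hV.mono k
        rw [hmk] at h6; omega
      · have : e' = e :=
          h.loc.g_uniq e' he' e he (h6.trans (hmk.trans hek.symm)) (h7.trans (hmt.trans het.symm))
        rw [← this, h8, ← hc, Nat.cast_lt] at hcl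
        omega
    · have := (Finset.mem_filter.1 (hl.closed.1 hg)).2
      refine this.trans_le (Nat.mul_le_mul_left 2 (Finset.card_le_card ?_))
      intro l hl'
      have hcl := (Finset.mem_filter.1 hl').2
      obtain ⟨c, hc⟩ := ENat.ne_top_iff_exists.1 hcl.ne_top
      obtain ⟨m', h2, h3, h4, h5⟩ := h.loc.g_rcv g (hsub g hg) l c hc.symm
      refine Finset.mem_filter.2 ⟨Finset.mem_univ _, m', h2, h3, h4.trans h1.symm, ?_⟩
      intro m hm hmk hmt
      rcases h.loc.r_known l m hm with h6 | ⟨e', he', h6, h7, h8⟩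
      · have := hV.mono k
        rw [hmk] at h6; omega
      · exact absurd ⟨e', he', h6.trans hmk, h7.trans hmt⟩ hx

open Classical in
-- Only a completed reception changes `VC`, and within it only the validation step does; recording
-- and flushing leave `VC` alone, so `FullInv.before_of_validate` applies to the intermediate state.
lemma GhostStep.before {g g' : Ghost n} {e : Event n} (hs : GhostStep g e g') (h : Inv g)
    (i : Fin n) {k' : Fin n} (hk' : (g.c.loc i).VC k' < (g'.c.loc i).VC k') {k : Fin n} {t : ℕ}
    (ht : (g'.c.loc i).VC k < t) :
    n < 2 * (Finset.univ.filter fun l => ∃ m' ∈ g'.R i l, m'.k = k' ∧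
      m'.t = (g'.c.loc i).VC k' ∧ ∀ m ∈ g'.R i l, m.k = k → m.t = t → m'.cl < m.cl).card := by
  cases hs with
  | idle => exact absurd hk' (lt_irrefl _)
  | quiet e j a b hb _ _ =>
    simp only [Config.act_loc] at hk'
    split_ifs at hk' with hij
    · subst hij; exact absurd hk' (lt_irrefl _)
    · exact absurd hk' (lt_irrefl _)
  | write j v hr =>
    simp only [Config.act_loc] at hk'
    split_ifs at hk' with hij
    · subst hij
      rcases writeCode_cases i v (g.c.loc i) with ⟨-, h1⟩ | ⟨-, h1⟩ <;> rw [h1] at hk' <;>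
      exact absurd hk' (lt_irrefl _)
    · exact absurd hk' (lt_irrefl _)
  | crashWrite j v sent hr hp =>
    simp only [Config.act_loc] at hk'
    split_ifs at hk' with hij
    · subst hij; exact absurd hk' (lt_irrefl _)
    · exact absurd hk' (lt_irrefl _)
  | crashReceive j j' m q s' out sent hcr hq hH hp =>
    simp only [Config.act_loc] at hk'
    split_ifs at hk' with hij
    · subst hij; exact absurd hk' (lt_irrefl _)
    · exact absurd hk' (lt_irrefl _)
  | receive j j' m q s' out hcr hq hH =>
    simp only [Config.act_loc] at hk' ht ⊢
    split_ifs at hk' ht ⊢ with hij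
    · subst hij
      have hm : g.R i j' ++ [m] <+: g.S j' := by
        refine List.IsPrefix.trans ?_ (h.chan i j' hcr)
        rw [hq, List.prefix_append_right_inj]
        exact ⟨q, rfl⟩
      obtain ⟨s₁, hv, rfl, rfl⟩ := hH
      have hfl : (flush i s₁).1.VC = s₁.VC := by
        rcases flush_cases i s₁ with ⟨-, h1⟩ | ⟨v, -, -, h1⟩ <;> rw [h1]
      rw [hfl] at hk' ht ⊢
      have := ((h.full hcr).record hm).before_of_validate hv (k' := k')
        (by rwa [(recordMsg_frame i j' m (g.c.loc i)).2.1]) ht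
      simpa using this
    · exact absurd hk' (lt_irrefl _)

/-! ### Comparability of the memory states seen by the processes -/

namespace Execution

variable (E : Execution n)

lemma mono_of_step {α : Type*} {r : α → α → Prop} (hr : ∀ a, r a a)
    (ht : ∀ a b c, r a b → r b c → r a c) (f : ℕ → α) (h : ∀ τ, r (f τ) (f (τ + 1)))
    {τ σ : ℕ} (hτ : τ ≤ σ) : r (f τ) (f σ) := by
  induction hτ with
  | refl => exact hr _
  | step _ ih => exact ht _ _ _ ih (h _)

lemma S_mono {τ σ : ℕ} (h : τ ≤ σ) (l : Fin n) : E.S τ l <+: E.S σ l :=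
  mono_of_step (r := (· <+: ·)) List.prefix_refl (fun _ _ _ => List.IsPrefix.trans)
    (fun τ => E.S τ l) (fun τ => (E.ghostStep τ).mono.1 l) h

lemma R_mono {τ σ : ℕ} (h : τ ≤ σ) (i l : Fin n) : E.R τ i l <+: E.R σ i l :=
  mono_of_step (r := (· <+: ·)) List.prefix_refl (fun _ _ _ => List.IsPrefix.trans)
    (fun τ => E.R τ i l) (fun τ => (E.ghostStep τ).mono.2.1 i l) h

lemma VC_mono {τ σ : ℕ} (h : τ ≤ σ) (i k : Fin n) : (E.loc τ i).VC k ≤ (E.loc σ i).VC k :=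
  mono_of_step (r := (· ≤ ·)) (fun _ => le_rfl) (fun _ _ _ => le_trans)
    (fun τ => (E.loc τ i).VC k) (fun τ => (E.ghostStep τ).mono.2.2.1 i k) h

lemma SC_mono {τ σ : ℕ} (h : τ ≤ σ) (i : Fin n) : (E.loc τ i).SC ≤ (E.loc σ i).SC :=
  mono_of_step (r := (· ≤ ·)) (fun _ => le_rfl) (fun _ _ _ => le_trans)
    (fun τ => (E.loc τ i).SC) (fun τ => (E.ghostStep τ).mono.2.2.2.1 i) h

lemma crashed_mono {τ σ : ℕ} (h : τ ≤ σ) {i : Fin n} (hi : (E.loc τ i).crashed = true) :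
    (E.loc σ i).crashed = true :=
  mono_of_step (r := fun a b : Bool => a = true → b = true) (fun _ => id)
    (fun _ _ _ h h' => h' ∘ h) (fun τ => (E.loc τ i).crashed)
    (fun τ h => ((E.ghostStep τ).mono.2.2.2.2 i h).1) h hi

lemma not_crashed_of_le {τ σ : ℕ} (h : τ ≤ σ) {i : Fin n} (hi : (E.loc σ i).crashed = false) :
    (E.loc τ i).crashed = false := by
  by_contra hc
  simp [E.crashed_mono h (by simpa using hc)] at hi

lemma S_eq_of_crashed {τ σ : ℕ} (h : τ ≤ σ) {i : Fin n} (hi : (E.loc τ i).crashed = true) :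
    E.S σ i = E.S τ i := by
  induction h with
  | refl => rfl
  | step h ih => exact ((E.ghostStep _).mono.2.2.2.2 i (E.crashed_mono h hi)).2.trans ih

lemma not_crashed {i : Fin n} (hi : i ∉ E.faulty) (τ : ℕ) : (E.loc τ i).crashed = false := by
  by_contra hc
  exact hi ⟨τ, (Bool.not_eq_false _).mp hc⟩

/-- `m` is broadcast by `l` at some time. -/
def Sent (l : Fin n) (m : Msg n) : Prop := ∃ τ, m ∈ E.S τ l

variable {E}

lemma Sent.key {l : Fin n} {m m' : Msg n} (h : E.Sent l m) (h' : E.Sent l m') (hk : m.k = m'.k)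
    (ht : m.t = m'.t) : m = m' := by
  obtain ⟨τ, h⟩ := h
  obtain ⟨σ, h'⟩ := h'
  exact (E.inv (max τ σ)).sent.key l m ((E.S_mono (le_max_left _ _) l).subset h) m'
    ((E.S_mono (le_max_right _ _) l).subset h') hk ht

lemma Sent.cl_inj {l : Fin n} {m m' : Msg n} (h : E.Sent l m) (h' : E.Sent l m')
    (hc : m.cl = m'.cl) : m = m' := by
  obtain ⟨τ, h⟩ := h
  obtain ⟨σ, h'⟩ := h'
  exact (E.inv (max τ σ)).sent.cl_inj ((E.S_mono (le_max_left _ _) l).subset h)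
    ((E.S_mono (le_max_right _ _) l).subset h') hc

lemma Sent.origin {l : Fin n} {m : Msg n} (h : E.Sent l m) :
    ∃ m₀, E.Sent m.k m₀ ∧ m₀.k = m.k ∧ m₀.t = m.t ∧ m₀.v = m.v := by
  obtain ⟨τ, h⟩ := h
  obtain ⟨m₀, h1, h2⟩ := (E.inv τ).sent.origin l m h
  exact ⟨m₀, ⟨τ, h1⟩, h2⟩

lemma Sent.pos {l : Fin n} {m : Msg n} (h : E.Sent l m) : 0 < m.t := by
  obtain ⟨τ, h⟩ := h
  exact (E.inv τ).sent.pos l m h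

lemma Sent.fifo {l k : Fin n} {m m' : Msg n} (h : E.Sent l m) (hk : m.k = k) (h' : E.Sent k m')
    (hk' : m'.k = k) (ht : m'.t < m.t) :
    ∃ m'', E.Sent l m'' ∧ m''.k = k ∧ m''.t = m'.t ∧ m''.cl < m.cl := by
  subst hk
  obtain ⟨τ, h⟩ := h
  obtain ⟨σ, h'⟩ := h'
  obtain ⟨m'', h1, h2⟩ := (E.inv (max τ σ)).sent.fifo l m
    ((E.S_mono (le_max_left _ _) l).subset h) m'
    ((E.S_mono (le_max_right _ _) _).subset h') hk' ht
  exact ⟨m'', ⟨_, h1⟩, h2⟩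

lemma sent_of_mem_R {τ : ℕ} {i l : Fin n} {m : Msg n} (h : m ∈ E.R τ i l) : E.Sent l m :=
  ⟨τ, ((E.inv τ).pre i l).subset h⟩

lemma mem_R_of_cl_le {τ : ℕ} {i l : Fin n} {m m' : Msg n} (h : m ∈ E.R τ i l) (h' : E.Sent l m')
    (hc : m'.cl ≤ m.cl) : m' ∈ E.R τ i l := by
  obtain ⟨σ, h'⟩ := h'
  exact (E.inv (max τ σ)).sent.mem_of_prefix
    (((E.inv τ).pre i l).trans (E.S_mono (le_max_left _ _) l)) h
    ((E.S_mono (le_max_right _ _) l).subset h') hc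

variable (E)

open Classical in
/-- The update `(k', t')` is stamped before the update `(k, t)` by a majority. -/
def Before (k' : Fin n) (t' : ℕ) (k : Fin n) (t : ℕ) : Prop :=
  n < 2 * (Finset.univ.filter fun l => ∃ m', E.Sent l m' ∧ m'.k = k' ∧ m'.t = t' ∧
    ∀ m, E.Sent l m → m.k = k → m.t = t → m'.cl < m.cl).card

lemma exists_mem_of_majorities {A B : Finset (Fin n)} (hA : n < 2 * A.card)
    (hB : n < 2 * B.card) : ∃ l ∈ A, l ∈ B := by
  by_contra hc
  push Not at hc
  have hd : Disjoint A B := Finset.disjoint_left.2 hc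
  have h1 := Finset.card_union_of_disjoint hd
  have h2 := Finset.card_le_univ (A ∪ B)
  simp only [Fintype.card_fin] at h2
  omega

/-- A process common to both majorities would have given each of the two updates a smaller stamp
than the other. -/
lemma Before.asymm {k' k : Fin n} {t' t : ℕ} (h : E.Before k' t' k t) :
    ¬ E.Before k t k' t' := by
  classical
  intro h'
  obtain ⟨l, h1, h2⟩ := exists_mem_of_majorities h h'
  obtain ⟨m', h3, h4, h5, h6⟩ := (Finset.mem_filter.1 h1).2
  obtain ⟨m, h7, h8, h9, h10⟩ := (Finset.mem_filter.1 h2).2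
  exact absurd (h6 m h7 h8 h9) (h10 m' h3 h4 h5).not_gt

/-- An update validated by a process precedes every update not yet validated by it. -/
lemma before (τ : ℕ) (i : Fin n) {k' k : Fin n} {m₀ : Msg n} {t : ℕ} (h₀ : E.Sent k' m₀)
    (hk₀ : m₀.k = k') (ht₀ : m₀.t ≤ (E.loc τ i).VC k') (ht : (E.loc τ i).VC k < t) :
    E.Before k' m₀.t k t := by
  classical
  induction τ with
  | zero =>
    have := h₀.pos
    have h1 : (E.loc 0 i).VC k' = 0 := by
      unfold Execution.loc
      rw [E.init]; rfl
    omega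
  | succ τ ih =>
    rcases le_or_gt m₀.t ((E.loc τ i).VC k') with h1 | h1
    · exact ih h1 ((E.VC_mono (Nat.le_succ τ) i k).trans_lt ht)
    · have h2 := (E.ghostStep τ).before (E.inv τ) i (h1.trans_le ht₀) ht
      refine h2.trans_le (Nat.mul_le_mul_left 2 (Finset.card_le_card ?_))
      intro l hl
      obtain ⟨m', h3, h4, h5, h6⟩ := (Finset.mem_filter.1 hl).2
      have h3' : m' ∈ E.R (τ + 1) i l := h3
      -- From received messages to all messages ever sent: one with a stamp at most `m'.cl` would
      -- already have been received.
      have h7 : ∀ m, E.Sent l m → m.k = k → m.t = t → m'.cl < m.cl := by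
        intro m hm hk ht
        by_contra hc
        exact hc (h6 m (mem_R_of_cl_le h3' hm (not_lt.mp hc)) hk ht)
      refine Finset.mem_filter.2 ⟨Finset.mem_univ _, ?_⟩
      -- `VC` may jump past `m₀.t`; FIFO then provides a message of `l` on the update of `m₀`, with
      -- an even smaller stamp.
      rcases ht₀.lt_or_eq with h8 | h8
      · obtain ⟨m'', h9, h10, h11, h12⟩ := (sent_of_mem_R h3').fifo h4 h₀ hk₀ (h8.trans_eq h5.symm)
        exact ⟨m'', h9, h10, h11, fun m hm hk ht => h12.trans (h7 m hm hk ht)⟩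
      · exact ⟨m', sent_of_mem_R h3', h4, h5.trans h8.symm, h7⟩

lemma exists_sent_VC (τ : ℕ) (i k : Fin n) (h : 0 < (E.loc τ i).VC k) :
    ∃ m, E.Sent k m ∧ m.k = k ∧ m.t = (E.loc τ i).VC k ∧ m.v = (E.loc τ i).X k := by
  rcases ((E.inv τ).loc i).vc_sent k with ⟨h1, -⟩ | ⟨m, h1, rfl, h3, h4⟩
  · exact absurd h1 h.ne'
  · obtain ⟨m₀, h5, h6, h7, h8⟩ := Sent.origin (E := E) ⟨τ, h1⟩
    exact ⟨m₀, h5, h6, h7.trans h3, h8.trans h4⟩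

/-- The states of the memory seen by all the processes are totally ordered. -/
lemma VC_total (τ σ : ℕ) (i j : Fin n) :
    (E.loc τ i).VC ≤ (E.loc σ j).VC ∨ (E.loc σ j).VC ≤ (E.loc τ i).VC := by
  by_contra hc
  simp only [Pi.le_def, not_or, not_forall, not_le] at hc
  obtain ⟨⟨k', hk'⟩, k, hk⟩ := hc
  obtain ⟨m', h1, h2, h3, -⟩ := E.exists_sent_VC τ i k' (by omega)
  obtain ⟨m, h4, h5, h6, -⟩ := E.exists_sent_VC σ j k (by omega)
  have hb := E.before τ i h1 h2 h3.le (hk.trans_eq h6.symm)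
  have hb' := E.before σ j h4 h5 h6.le (hk'.trans_eq h3.symm)
  exact hb.asymm E hb'

/-! ### Liveness -/

/-- Reliable channels: a correct process processes all the messages that have been sent to it. -/
lemma exists_received {j : Fin n} (hj : j ∉ E.faulty) (l : Fin n) (τ : ℕ) :
    ∃ σ, E.R τ j l ++ (E.conf τ).chan l j <+: E.R σ j l := by
  -- The messages processed or in transit: a reception moves the boundary between the two parts, and
  -- sending appends at the end, so `H` only grows as a prefix.
  set H : ℕ → List (Msg n) := fun τ => E.R τ j l ++ (E.conf τ).chan l j with hH
  have hHm : ∀ τ σ, τ ≤ σ → H τ <+: H σ := by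
    intro τ σ h
    refine mono_of_step (r := (· <+: ·)) List.prefix_refl (fun _ _ _ => List.IsPrefix.trans)
      H (fun τ => ?_) h
    have h3 := E.ghostStep τ
    generalize E.event τ = e at h3
    have h4 : ((E.conf (τ + 1)).loc j).crashed = false := E.not_crashed hj (τ + 1)
    generalize hg : (⟨E.conf τ, E.S τ, E.R τ⟩ : Ghost n) = g at h3
    generalize hg' : (⟨E.conf (τ + 1), E.S (τ + 1), E.R (τ + 1)⟩ : Ghost n) = g' at h3
    have hτ : H τ = g.R j l ++ g.c.chan l j := by rw [← hg]
    have hτ' : H (τ + 1) = g'.R j l ++ g'.c.chan l j := by rw [← hg']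
    have h4' : (g'.c.loc j).crashed = false := by rw [← hg']; exact h4
    rw [hτ, hτ']
    cases h3 with
    | idle => exact List.prefix_refl _
    | quiet e i a b hb _ _ =>
      rw [Config.act_chan, List.prefix_append_right_inj]
      split_ifs with hl
      · simp [hl]
      · exact List.prefix_refl _
    | write i v hr =>
      rw [Config.act_chan, List.prefix_append_right_inj]
      split_ifs with hl
      · simp [hl]
      · exact List.prefix_refl _
    | crashWrite i v sent hr hp =>
      rw [Config.act_chan, List.prefix_append_right_inj]
      split_ifs with hl
      · simp [hl]
      · exact List.prefix_refl _
    | receive i j' m q s' out hcr hq hHa =>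
      rw [Config.act_chan]
      simp only [Config.setChan_chan]
      by_cases hji : j = i
      · subst hji
        by_cases hl : l = j'
        · subst hl
          by_cases hlj : l = j
          · rw [hlj] at hq
            simp [hlj, hq]
          · simp [hlj, hq]
        · by_cases hlj : l = j
          · subst hlj
            simp [hl]
          · simp [hl, hlj]
      · by_cases hli : l = i
        · simp [hli, hji]
        · simp [hli, hji]
    | crashReceive i j' m q s' out sent hcr hq hHa hp =>
      rw [Config.act_chan]
      simp only [Config.setChan_chan]
      have hji : j ≠ i := by
        rintro rfl
        simp [Config.act_loc] at h4'
      by_cases hli : l = i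
      · simp [hli, hji]
      · simp [hli, hji]
  -- As long as fewer messages are processed than `H τ` contains, the channel is nonempty, and
  -- reliability yields one more reception.
  have key : ∀ p, p ≤ (H τ).length → ∃ σ, τ ≤ σ ∧ p ≤ (E.R σ j l).length := by
    intro p
    induction p with
    | zero => exact fun _ => ⟨τ, le_rfl, Nat.zero_le _⟩
    | succ p ih =>
      intro hp
      obtain ⟨σ, h1, h2⟩ := ih (by omega)
      by_cases h3 : p + 1 ≤ (E.R σ j l).length
      · exact ⟨σ, h1, h3⟩
      · have h4 := (hHm τ σ h1).length_le
        have h5 : (E.conf σ).chan l j ≠ [] := by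
          intro hc
          simp only [hH, hc, List.append_nil] at h4 hp
          omega
        obtain ⟨ρ, h6, h7⟩ := E.reliable σ j l (E.not_crashed hj) h5
        refine ⟨ρ + 1, by omega, ?_⟩
        have h8 := E.ghostStep ρ
        have h10 : (E.R σ j l).length ≤ (E.R ρ j l).length := (E.R_mono h6 j l).length_le
        rw [h7] at h8
        generalize hg : (⟨E.conf ρ, E.S ρ, E.R ρ⟩ : Ghost n) = g at h8
        generalize hg' : (⟨E.conf (ρ + 1), E.S (ρ + 1), E.R (ρ + 1)⟩ : Ghost n) = g' at h8
        have h9 : E.R (ρ + 1) j l = g'.R j l := by rw [← hg']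
        have h11 : E.R ρ j l = g.R j l := by rw [← hg]
        rw [h9]
        rw [h11] at h10
        cases h8 with
        | quiet e i a b hb _ hc => exact absurd rfl (hc j l)
        | receive i j' m q s' out hcr hq hHa =>
          simp only [Function.update_self, List.length_append, List.length_singleton]
          omega
  obtain ⟨σ, h1, h2⟩ := key _ le_rfl
  exact ⟨σ, List.prefix_of_prefix_length_le (hHm τ σ h1) (List.prefix_append _ _) h2⟩

/-- A correct process processes all the messages whose broadcast is complete. -/
lemma exists_mem_R {j l : Fin n} (hj : j ∉ E.faulty) {τ : ℕ} (hl : (E.loc τ l).crashed = false)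
    {m : Msg n} (hm : m ∈ E.S τ l) : ∃ σ, ∀ ρ, σ ≤ ρ → m ∈ E.R ρ j l := by
  obtain ⟨σ, h⟩ := E.exists_received hj l τ
  have h1 := (E.inv τ).chan_eq j l (E.not_crashed hj τ) hl
  simp only at h1
  rw [h1] at h
  exact ⟨σ, fun ρ hρ => (E.R_mono hρ j l).subset (h.subset hm)⟩

end Execution

/-- The update a message is about: its writer and the stamp given by the writer. -/
def Msg.key (m : Msg n) : Fin n × ℕ := (m.k, m.t)

/-! ### Validation of all known updates by the correct processes -/

namespace Execution

variable (E : Execution n)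

/-- The updates known to some correct process. -/
def known : Set (Fin n × ℕ) := {u | ∃ l ∉ E.faulty, ∃ m, E.Sent l m ∧ m.key = u}

/-- The updates validated by `i` at time `τ`. -/
def Validates (τ : ℕ) (i : Fin n) (u : Fin n × ℕ) : Prop := u.2 ≤ (E.loc τ i).VC u.1

variable {E}

lemma Validates.mono {τ σ : ℕ} {i : Fin n} {u : Fin n × ℕ} (h : E.Validates τ i u) (hτ : τ ≤ σ) :
    E.Validates σ i u :=
  le_trans h (E.VC_mono hτ i _)

lemma eventually_received {u : Fin n × ℕ} {l j : Fin n} {m : Msg n} (hm : E.Sent l m)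
    (hu : m.key = u) (hl : l ∉ E.faulty) (hj : j ∉ E.faulty) :
    ∃ σ, ∀ ρ, σ ≤ ρ → ∃ m ∈ E.R ρ j l, m.key = u := by
  obtain ⟨τ, hm⟩ := hm
  obtain ⟨σ, h⟩ := E.exists_mem_R hj (E.not_crashed hl τ) hm
  exact ⟨σ, fun ρ hρ => ⟨m, h ρ hρ, hu⟩⟩

/-- A correct process broadcasts all the updates that it receives. -/
lemma exists_sent_of_mem_R {τ : ℕ} {j l : Fin n} {m : Msg n} (hj : j ∉ E.faulty)
    (hm : m ∈ E.R τ j l) : ∃ m', E.Sent j m' ∧ m'.key = m.key := by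
  have hf := (E.inv τ).full (E.not_crashed hj τ)
  obtain ⟨m₀, h1, h2, h3, -⟩ := (E.inv τ).sent.origin l m (((E.inv τ).pre j l).subset hm)
  obtain ⟨m', h4, h5, h6⟩ := hf.exists_sent hm rfl h1 h2 h3
  exact ⟨m', ⟨τ, h4⟩, by simp [Msg.key, h5, h6]⟩

lemma exists_sent_of_known {u : Fin n × ℕ} (h : u ∈ E.known) {j : Fin n} (hj : j ∉ E.faulty) :
    ∃ m, E.Sent j m ∧ m.key = u := by
  obtain ⟨l, hl, m, hm, hu⟩ := h
  obtain ⟨σ, h⟩ := eventually_received hm hu hl hj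
  obtain ⟨m', h1, h2⟩ := h σ le_rfl
  obtain ⟨m'', h3, h4⟩ := exists_sent_of_mem_R hj h1
  exact ⟨m'', h3, h4.trans h2⟩

lemma exists_own_of_known {u : Fin n × ℕ} (h : u ∈ E.known) : ∃ m, E.Sent u.1 m ∧ m.key = u := by
  obtain ⟨l, hl, m, hm, rfl⟩ := h
  obtain ⟨m₀, h1, h2, h3, -⟩ := hm.origin
  exact ⟨m₀, h1, by simp [Msg.key, h2, h3]⟩

open Classical in
lemma correct_majority (hE : 2 * E.faulty.ncard < n) :
    n < 2 * (Finset.univ.filter fun l => l ∉ E.faulty).card := by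
  have h1 := Finset.card_filter_add_card_filter_not (s := (Finset.univ : Finset (Fin n)))
    (fun l => l ∈ E.faulty)
  have h2 : (Finset.univ.filter fun l => l ∈ E.faulty).card = E.faulty.ncard := by
    rw [← Set.ncard_coe_finset]; simp
  simp only [Finset.card_univ, Fintype.card_fin] at h1
  omega

lemma exists_forall_sent {i : Fin n} (hi : i ∈ E.faulty) : ∃ τ, ∀ m, E.Sent i m → m ∈ E.S τ i := by
  obtain ⟨τ, h⟩ := hi
  refine ⟨τ, fun m ⟨σ, hm⟩ => ?_⟩
  rw [← E.S_eq_of_crashed (le_max_left τ σ) h]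
  exact (E.S_mono (le_max_right τ σ) i).subset hm

lemma finite_sent_of_faulty {i : Fin n} (hi : i ∈ E.faulty) : {m | E.Sent i m}.Finite := by
  obtain ⟨τ, h⟩ := exists_forall_sent hi
  exact (List.finite_toSet (E.S τ i)).subset h

lemma finite_sent_cl_lt (l : Fin n) (c : ℕ) : {m | E.Sent l m ∧ m.cl < c}.Finite := by
  refine Set.Finite.of_finite_image (f := Msg.cl) ((Set.finite_Iio c).subset ?_) ?_
  · rintro _ ⟨m, hm, rfl⟩
    exact hm.2
  · exact fun m hm m' hm' h => hm.1.cl_inj hm'.1 h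

lemma finite_sent_key (l : Fin n) {D : Set (Fin n × ℕ)} (hD : D.Finite) :
    {m | E.Sent l m ∧ m.key ∈ D}.Finite := by
  refine Set.Finite.of_finite_image (f := Msg.key) (hD.subset ?_) ?_
  · rintro _ ⟨m, hm, rfl⟩
    exact hm.2
  · intro m hm m' hm' h
    simp only [Msg.key, Prod.mk.injEq] at h
    exact hm.1.key hm'.1 h.1 h.2

lemma finite_validated (τ : ℕ) (i : Fin n) : {u | E.Validates τ i u}.Finite := by
  refine (Set.finite_iUnion fun k => (Set.finite_Iic ((E.loc τ i).VC k)).image (Prod.mk k)).subset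
    fun u hu => ?_
  exact Set.mem_iUnion.2 ⟨u.1, u.2, hu, rfl⟩

open Classical in
/-- `u'` is stamped before `u` by a majority consisting of correct processes. -/
def CorrectBefore (E : Execution n) (u' u : Fin n × ℕ) : Prop :=
  n < 2 * (Finset.univ.filter fun l => l ∉ E.faulty ∧ ∃ m', E.Sent l m' ∧ m'.key = u' ∧
    ∀ m, E.Sent l m → m.key = u → m'.cl < m.cl).card

/-- A correct process validates the updates of a finite set that are stamped before all others by
majorities of correct processes. -/
lemma exists_validates_of_finite (hE : 2 * E.faulty.ncard < n) {D : Set (Fin n × ℕ)}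
    (hfin : D.Finite) (hD : D ⊆ E.known)
    (hb : ∀ u' ∈ D, ∀ u ∈ E.known, u ∉ D → E.CorrectBefore u' u) {j : Fin n} (hj : j ∉ E.faulty)
    {u₀ : Fin n × ℕ} (hu₀ : u₀ ∈ D) : ∃ σ, E.Validates σ j u₀ := by
  classical
  by_contra hno
  push Not at hno
  have hev : ∀ᶠ σ in Filter.atTop, ∀ u ∈ D, ∀ l, l ∉ E.faulty → ∃ m ∈ E.R σ j l, m.key = u := by
    refine (Filter.eventually_all_finite hfin).2 fun u hu => Filter.eventually_all.2 fun l => ?_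
    by_cases hl : l ∈ E.faulty
    · exact Filter.Eventually.of_forall fun _ h => absurd hl h
    · obtain ⟨m, hm, hk⟩ := exists_sent_of_known (hD hu) hl
      obtain ⟨σ, h⟩ := eventually_received hm hk hl hj
      exact Filter.eventually_atTop.2 ⟨σ, fun ρ hρ _ => h ρ hρ⟩
  obtain ⟨σ, hσ⟩ := hev.exists
  have hL : LocInv j (E.loc σ j) (E.S σ j) (E.R σ j) := (E.inv σ).loc j
  have hcl : ∀ e ∈ (E.loc σ j).G, (e.k, e.t) ∈ D → ∀ l, l ∉ E.faulty →
      ∃ m, E.Sent l m ∧ m.key = (e.k, e.t) ∧ e.cl l = m.cl := by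
    intro e he heD l hl
    obtain ⟨m, h1, h2⟩ := hσ _ heD l hl
    refine ⟨m, sent_of_mem_R h1, h2, ?_⟩
    simp only [Msg.key, Prod.mk.injEq] at h2
    rcases hL.r_known l m h1 with h3 | ⟨e', h3, h4, h5, h6⟩
    · have := hL.g_vc e he
      rw [h2.1, h2.2] at h3; omega
    · rw [← hL.g_uniq e' h3 e he (h4.trans h2.1) (h5.trans h2.2), h6]
  -- By time `σ` process `j` has all stamps of correct processes on `D`. So the entries that belong
  -- to `D` form a closed set, which must be empty between two events; yet `u₀` has been received
  -- and is not validated.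
  have hempty := ((E.inv σ).rest j).eq_empty
    ((E.loc σ j).G.filter fun e => (e.k, e.t) ∈ D) ⟨?_, ?_⟩
  · obtain ⟨m, h1, h2⟩ := hσ u₀ hu₀ j hj
    have hno' := hno σ
    rcases hL.r_known j m h1 with h3 | ⟨e, he, h4, h5, -⟩
    · rw [← h2] at hno'
      exact hno' h3
    · have : e ∈ (E.loc σ j).G.filter fun e => (e.k, e.t) ∈ D := by
        refine Finset.mem_filter.2 ⟨he, ?_⟩
        rw [h4, h5]
        have h2 : (m.k, m.t) = u₀ := h2
        rwa [h2]
      rw [hempty] at this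
      simp at this
  · intro e he
    obtain ⟨he, heD⟩ := Finset.mem_filter.1 he
    refine Finset.mem_filter.2 ⟨he, (correct_majority hE).trans_le
      (Nat.mul_le_mul_left 2 (Finset.card_le_card fun l hl => ?_))⟩
    obtain ⟨m, -, -, h3⟩ := hcl e he heD l (Finset.mem_filter.1 hl).2
    exact Finset.mem_filter.2 ⟨Finset.mem_univ _, by rw [h3]; exact ENat.natCast_lt_top _⟩
  · intro e he heD e' he'
    obtain ⟨he', heD'⟩ := Finset.mem_filter.1 he'
    have heD : (e.k, e.t) ∉ D := fun h => heD (Finset.mem_filter.2 ⟨he, h⟩)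
    obtain ⟨m, h1, h2, h3, -⟩ := hL.g_sent e he
    have hkn : (e.k, e.t) ∈ E.known := ⟨j, hj, m, ⟨σ, h1⟩, by simp [Msg.key, h2, h3]⟩
    refine (hb _ heD' _ hkn heD).trans_le
      (Nat.mul_le_mul_left 2 (Finset.card_le_card fun l hl => ?_))
    obtain ⟨-, hl, m', h4, h5, h6⟩ := Finset.mem_filter.1 hl
    obtain ⟨m'', h7, h8, h9⟩ := hcl e' he' heD' l hl
    have h10 : m'' = m' := by
      have := h8.trans h5.symm
      simp only [Msg.key, Prod.mk.injEq] at this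
      exact h7.key h4 this.1 this.2
    refine Finset.mem_filter.2 ⟨Finset.mem_univ _, ?_⟩
    rw [h9, h10]
    by_cases htop : e.cl l = ⊤
    · rw [htop]; exact ENat.natCast_lt_top _
    · obtain ⟨c, hc⟩ := ENat.ne_top_iff_exists.1 htop
      obtain ⟨m₁, h11, h12, h13, h14⟩ := hL.g_rcv e he l c hc.symm
      rw [← hc, ← h14, Nat.cast_lt]
      exact h6 m₁ (sent_of_mem_R h11) (by simp [Msg.key, h12, h13])

/-- If infinitely many updates are known to the correct processes, then some correct process
validates all the updates that are known to correct processes. -/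
lemma exists_validates_known (hE : 2 * E.faulty.ncard < n) (hinf : E.known.Infinite) :
    ∃ k, ∀ u ∈ E.known, ∃ σ, E.Validates σ k u := by
  classical
  obtain ⟨k, hk⟩ : ∃ k, {t | (k, t) ∈ E.known}.Infinite := by
    by_contra hc
    push Not at hc
    refine hinf ((Set.finite_iUnion fun k => (hc k).image (Prod.mk k)).subset
      fun u hu => ?_)
    exact Set.mem_iUnion.2 ⟨u.1, u.2, hu, rfl⟩
  -- A later update of `k` exists, and `OwnDone` says that the earlier one is validated once the
  -- later one is broadcast.
  have hown : ∀ t, (k, t) ∈ E.known → ∃ σ, E.Validates σ k (k, t) := by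
    intro t ht
    obtain ⟨t', ht', hlt⟩ := hk.exists_gt t
    obtain ⟨m, ⟨τ, h1⟩, h2⟩ := exists_own_of_known ht
    obtain ⟨m', ⟨τ', h3⟩, h4⟩ := exists_own_of_known ht'
    simp only [Msg.key, Prod.mk.injEq] at h2 h4
    have hkc : k ∉ E.faulty := by
      intro hkf
      refine hk (((finite_sent_of_faulty hkf).image Msg.t).subset fun t ht => ?_)
      obtain ⟨m, h1, h2⟩ := exists_own_of_known ht
      simp only [Msg.key, Prod.mk.injEq] at h2
      exact ⟨m, h1, h2.2⟩
    refine ⟨max τ τ', ?_⟩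
    have := (E.inv (max τ τ')).done k (E.not_crashed hkc _) m
      ((E.S_mono (le_max_left _ _) k).subset h1) m'
      ((E.S_mono (le_max_right _ _) k).subset h3) h2.1 h4.1 (by omega)
    rw [h2.2] at this
    exact this
  refine ⟨k, fun u hu => ?_⟩
  by_contra hno
  push Not at hno
  have hC : ∀ l, ∃ c, l ∉ E.faulty → ∃ m, E.Sent l m ∧ m.key = u ∧ m.cl = c := by
    intro l
    by_cases hl : l ∈ E.faulty
    · exact ⟨0, fun h => absurd hl h⟩
    · obtain ⟨m, h1, h2⟩ := exists_sent_of_known hu hl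
      exact ⟨m.cl, fun _ => ⟨m, h1, h2, rfl⟩⟩
  choose C hC using hC
  -- Each known update of `k` is before `u`, so some correct `l` stamped it below its own stamp `C
  -- l` of `u`. Finitely many updates satisfy this, against the choice of `k`.
  refine hk ((Set.finite_iUnion fun l => (finite_sent_cl_lt (E := E) l (C l)).image Msg.t).subset
    fun t ht => ?_)
  obtain ⟨σ, hσ⟩ := hown t ht
  obtain ⟨m₀, h1, h2⟩ := exists_own_of_known ht
  simp only [Msg.key, Prod.mk.injEq] at h2
  have hbef := E.before σ k h1 h2.1 (h2.2 ▸ hσ) (not_le.mp (hno σ))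
  obtain ⟨l, h3, h4⟩ := exists_mem_of_majorities hbef (correct_majority hE)
  obtain ⟨m', h5, h6, h7, h8⟩ := (Finset.mem_filter.1 h3).2
  obtain ⟨m, h9, h10, h11⟩ := hC l (Finset.mem_filter.1 h4).2
  simp only [Msg.key, Prod.ext_iff] at h10
  refine Set.mem_iUnion.2 ⟨l, m', ⟨h5, ?_⟩, h7.trans h2.2⟩
  rw [← h11]
  exact h8 m h9 h10.1 h10.2

/-- Every update known to a correct process is eventually validated by all correct processes. -/
theorem exists_validates (hE : 2 * E.faulty.ncard < n) {u : Fin n × ℕ} (hu : u ∈ E.known)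
    {j : Fin n} (hj : j ∉ E.faulty) : ∃ σ, E.Validates σ j u := by
  classical
  by_cases hfin : E.known.Finite
  · exact exists_validates_of_finite hE hfin subset_rfl (fun _ _ _ h h' => absurd h h') hj hu
  obtain ⟨k, hk⟩ := exists_validates_known hE hfin
  have hev : ∀ X : Set (Fin n × ℕ), X.Finite → X ⊆ E.known →
      ∃ τ, ∀ σ, τ ≤ σ → ∀ v ∈ X, E.Validates σ k v := by
    intro X hX hXk
    refine Filter.eventually_atTop.1 ((Filter.eventually_all_finite hX).2 fun v hv => ?_)
    obtain ⟨σ, h⟩ := hk v (hXk hv)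
    exact Filter.eventually_atTop.2 ⟨σ, fun ρ hρ => h.mono hρ⟩
  -- A faulty process sends finitely many messages. After `τ₀`, process `k` has validated `u` and
  -- all known updates that a faulty process ever stamps.
  have hF : (insert u {v ∈ E.known | ∃ l ∈ E.faulty, ∃ m, E.Sent l m ∧ m.key = v}).Finite := by
    refine Set.Finite.insert _ ?_
    refine (Set.Finite.biUnion (Set.toFinite E.faulty)
      fun l hl => (finite_sent_of_faulty hl).image Msg.key).subset fun v hv => ?_
    obtain ⟨-, l, hl, m, hm, hkey⟩ := hv
    exact Set.mem_biUnion hl ⟨m, hm, hkey⟩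
  obtain ⟨τ₀, h₀⟩ := hev _ hF (Set.insert_subset hu (Set.sep_subset _ _))
  -- The known updates that some process stamps no later than an update validated at `τ₀`. After
  -- `τ₁` they are validated too.
  have hBad : {v ∈ E.known | ∃ l, ∃ m, E.Sent l m ∧ m.key = v ∧
      ∃ m', E.Sent l m' ∧ E.Validates τ₀ k m'.key ∧ m.cl ≤ m'.cl}.Finite := by
    refine (Set.finite_iUnion fun l => Set.Finite.biUnion
      (finite_sent_key (E := E) l (finite_validated (E := E) τ₀ k))
      fun m' _ => (finite_sent_cl_lt (E := E) l (m'.cl + 1)).image Msg.key).subset fun v hv => ?_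
    obtain ⟨-, l, m, hm, hkey, m', hm', hval, hle⟩ := hv
    exact Set.mem_iUnion.2 ⟨l, Set.mem_biUnion (show m' ∈ {m | E.Sent l m ∧
      m.key ∈ {u | E.Validates τ₀ k u}} from ⟨hm', hval⟩) ⟨m, ⟨hm, Nat.lt_succ_of_le hle⟩, hkey⟩⟩
  obtain ⟨τ₁, h₁⟩ := hev _ hBad (Set.sep_subset _ _)
  refine exists_validates_of_finite hE (D := {v ∈ E.known | E.Validates (max τ₀ τ₁) k v})
    ((finite_validated (max τ₀ τ₁) k).subset fun v hv => hv.2) (Set.sep_subset _ _) ?_ hj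
    ⟨hu, h₀ _ (le_max_left _ _) u (Set.mem_insert _ _)⟩
  rintro u' ⟨hu'k, hu'⟩ v hv hvD
  have hvn : ¬ E.Validates (max τ₀ τ₁) k v := fun h => hvD ⟨hv, h⟩
  -- If `u'` is validated at `τ₀`, every correct process stamps it before `v`, otherwise `v` would
  -- be among the updates validated by `τ₁`. If `u'` is validated later, no faulty process stamps
  -- it, so the majority of `Before` consists of correct processes.
  by_cases hu0 : E.Validates τ₀ k u'
  · refine (correct_majority hE).trans_le
      (Nat.mul_le_mul_left 2 (Finset.card_le_card fun l hl => ?_))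
    have hl' := (Finset.mem_filter.1 hl).2
    obtain ⟨m', h2, h3⟩ := exists_sent_of_known hu'k hl'
    refine Finset.mem_filter.2 ⟨Finset.mem_univ _, hl', m', h2, h3, fun m hm hkey => ?_⟩
    by_contra hle
    exact hvn (h₁ _ (le_max_right _ _) v
      ⟨hv, l, m, hm, hkey, m', h2, h3 ▸ hu0, not_lt.mp hle⟩)
  · obtain ⟨m₀, h2, h3⟩ := exists_own_of_known hu'k
    have h3' := h3
    simp only [Msg.key, Prod.ext_iff] at h3'
    have hbef := E.before (max τ₀ τ₁) k h2 h3'.1 (h3'.2 ▸ hu') (not_le.mp hvn)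
    refine hbef.trans_le (Nat.mul_le_mul_left 2 (Finset.card_le_card fun l hl => ?_))
    obtain ⟨m', h4, h5, h6, h7⟩ := (Finset.mem_filter.1 hl).2
    have h8 : m'.key = u' := Prod.ext h5 (h6.trans h3'.2)
    refine Finset.mem_filter.2 ⟨Finset.mem_univ _, fun hlf => hu0 ?_, m', h4, h8,
      fun m hm hkey => ?_⟩
    · exact h₀ _ le_rfl u' (Set.mem_insert_of_mem _ ⟨hu'k, l, hlf, m', h4, h8⟩)
    · simp only [Msg.key, Prod.ext_iff] at hkey
      exact h7 m hm hkey.1 hkey.2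

end Execution

end SnapMem

namespace SnapMem

/-! ### Words of histories ordered by a key -/

lemma seq_take_succ {A : Type*} (w : Stream'.Seq A) (k : ℕ) :
    w.take (k + 1) = w.take k ++ (w.get? k).toList := by
  induction k generalizing w with
  | zero =>
    cases w using Stream'.Seq.recOn with
    | nil => simp
    | cons x s => simp
  | succ k ih =>
    cases w using Stream'.Seq.recOn with
    | nil => simp
    | cons x s =>
      rw [Stream'.Seq.take_succ_cons, ih, Stream'.Seq.take_succ_cons, Stream'.Seq.get?_cons_succ]
      simp

namespace History

variable {A : Type} (H : History A) {L : Type*} [LinearOrder L] (key : H.Op → L)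

/-- The number of operations with a smaller key. -/
noncomputable def rank (o : H.Op) : ℕ := {b | key b ≤ key o ∧ b ≠ o}.ncard

variable {H key}

lemma rank_lt_rank (hfin : ∀ o, {b | key b ≤ key o}.Finite)
    {a b : H.Op} (h : key a < key b) : H.rank key a < H.rank key b := by
  refine Set.ncard_lt_ncard ?_ ((hfin b).subset fun c hc => hc.1)
  refine (Set.ssubset_iff_of_subset ?_).2 ⟨a, ⟨h.le, fun hab => h.ne (hab ▸ rfl)⟩, fun h' => h'.2 rfl⟩
  intro c hc
  exact ⟨hc.1.trans h.le, fun hcb => (hc.1.trans_lt h).ne (hcb ▸ rfl)⟩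

lemma rank_lt_rank_iff (hinj : Function.Injective key) (hfin : ∀ o, {b | key b ≤ key o}.Finite)
    {a b : H.Op} : H.rank key a < H.rank key b ↔ key a < key b := by
  refine ⟨fun h => ?_, rank_lt_rank hfin⟩
  by_contra hc
  rcases (not_lt.mp hc).lt_or_eq with h' | h'
  · exact absurd h (rank_lt_rank hfin h').le.not_gt
  · rw [hinj h'] at h
    exact lt_irrefl _ h

lemma rank_injective (hinj : Function.Injective key) (hfin : ∀ o, {b | key b ≤ key o}.Finite) :
    Function.Injective (H.rank key) := by
  intro a b h
  rcases lt_trichotomy (key a) (key b) with h' | h' | h'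
  · exact absurd h (rank_lt_rank hfin h').ne
  · exact hinj h'
  · exact absurd h (rank_lt_rank hfin h').ne'

/-- Ranks leave no gap: the `rank o` predecessors of `o` have distinct ranks below `rank o`, hence
fill that interval. A sequence needs this, since it must not resume after `none`. -/
lemma exists_rank_eq (hinj : Function.Injective key) (hfin : ∀ o, {b | key b ≤ key o}.Finite)
    (o : H.Op) {k : ℕ} (hk : k ≤ H.rank key o) : ∃ b, H.rank key b = k := by
  have hmaps : ∀ b ∈ {b | key b ≤ key o ∧ b ≠ o}, H.rank key b ∈ Set.Iio (H.rank key o) := by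
    rintro b ⟨h1, h2⟩
    exact rank_lt_rank hfin (lt_of_le_of_ne h1 fun h => h2 (hinj h))
  have himg : H.rank key '' {b | key b ≤ key o ∧ b ≠ o} = Set.Iio (H.rank key o) := by
    refine Set.eq_of_subset_of_ncard_le ?_ ?_ (Set.finite_Iio _)
    · rintro _ ⟨b, hb, rfl⟩
      exact hmaps b hb
    · rw [Set.ncard_image_of_injective _ (rank_injective hinj hfin)]
      rw [← Nat.card_coe_set_eq]
      simp [rank]
  rcases hk.lt_or_eq with h | h
  · obtain ⟨b, -, hb⟩ := himg.ge h
    exact ⟨b, hb⟩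
  · exact ⟨o, h.symm⟩

lemma exists_isWord (hinj : Function.Injective key) (hfin : ∀ o, {b | key b ≤ key o}.Finite) :
    ∃ w, H.IsWord (fun a b => key a ≤ key b) w := by
  classical
  let f : Stream' (Option A) := fun k =>
    if h : ∃ o, H.rank key o = k then some (H.letter h.choose) else none
  have hseq : f.IsSeq := by
    intro k hk
    have h1 : ¬ ∃ o, H.rank key o = k := by
      intro h
      have hk' : (if h : ∃ o, H.rank key o = k then some (H.letter h.choose) else none) = none := hk
      rw [dif_pos h] at hk'
      simp at hk'
    exact dif_neg fun ⟨o, ho⟩ => h1 (exists_rank_eq hinj hfin o (by omega))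
  refine ⟨⟨f, hseq⟩, fun k a => ?_⟩
  have hget : Stream'.Seq.get? ⟨f, hseq⟩ k =
        if h : ∃ o, H.rank key o = k then some (H.letter h.choose) else none := rfl
  rw [hget]
  constructor
  · intro h
    split_ifs at h with ho
    exact ⟨ho.choose, ho.choose_spec, by simpa using h⟩
  · rintro ⟨o, ho, rfl⟩
    have ho : H.rank key o = k := ho
    have hex : ∃ o, H.rank key o = k := ⟨o, ho⟩
    rw [dif_pos hex, rank_injective hinj hfin (hex.choose_spec.trans ho.symm)]

end History

lemma registers_append_write {n : ℕ} (l : List (Letter n)) (i : Fin n) (v : ℕ) :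
    registers (l ++ [.write i v]) = Function.update (registers l) i v := by
  simp [registers]

lemma registers_append_snap {n : ℕ} (l : List (Letter n)) (i : Fin n) (r : Fin n → ℕ) :
    registers (l ++ [.snap i r]) = registers l := by
  simp [registers]

/-! ### Last written values in the word of a history -/

namespace History

variable {n : ℕ} {H : History (Letter n)} {L : Type*} [LinearOrder L] {key : H.Op → L}

/-- `x` is the value of the last write of `j` among the operations that satisfy the downward closed
predicate `P`, or `0` if there is none. -/
def LastValue (key : H.Op → L) (P : H.Op → Prop) (j : Fin n) (x : ℕ) : Prop :=
  (x = 0 ∧ ∀ b v, P b → H.letter b ≠ .write j v) ∨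
  ∃ b, P b ∧ H.letter b = .write j x ∧ ∀ b' v, H.letter b' = .write j v → key b < key b' → ¬ P b'

lemma LastValue.unique (hinj : Function.Injective key) {P : H.Op → Prop} {j : Fin n} {x y : ℕ}
    (hx : LastValue key P j x) (hy : LastValue key P j y) : x = y := by
  rcases hx with ⟨rfl, hx⟩ | ⟨a, ha, hax, ha'⟩
  · rcases hy with ⟨rfl, -⟩ | ⟨b, hb, hby, -⟩
    · rfl
    · exact absurd hby (hx b y hb)
  · rcases hy with ⟨rfl, hy⟩ | ⟨b, hb, hby, hb'⟩
    · exact absurd hax (hy a x ha)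
    · rcases lt_trichotomy (key a) (key b) with h | h | h
      · exact absurd hb (ha' b y hby h)
      · have := hinj h
        subst this
        rw [hax] at hby
        simpa using hby
      · exact absurd ha (hb' a x hax h)

lemma IsWord.lastValue_registers (hinj : Function.Injective key)
    (hfin : ∀ o, {b | key b ≤ key o}.Finite) {w : Stream'.Seq (Letter n)}
    (hw : H.IsWord (fun a b => key a ≤ key b) w) (j : Fin n) (k : ℕ) :
    LastValue key (fun b => H.rank key b < k) j (registers (w.take k) j) := by
  induction k with
  | zero => exact .inl ⟨by simp [registers], fun b v h => absurd h (Nat.not_lt_zero _)⟩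
  | succ k ih =>
    rw [seq_take_succ]
    -- The last value of `j` is unaffected unless the operation of rank `k` is a write of `j`.
    have hlift : (∀ o v, H.rank key o = k → H.letter o ≠ .write j v) →
        LastValue key (fun b => H.rank key b < k + 1) j (registers (w.take k) j) := by
      intro hno
      rcases ih with ⟨h1, h2⟩ | ⟨b, h1, h2, h3⟩
      · refine .inl ⟨h1, fun b v hb => ?_⟩
        rcases (Nat.lt_succ_iff.1 hb).lt_or_eq with h | h
        · exact h2 b v h
        · exact hno b v h
      · refine .inr ⟨b, Nat.lt_succ_of_lt h1, h2, fun b' v h4 h5 h6 => ?_⟩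
        rcases (Nat.lt_succ_iff.1 h6).lt_or_eq with h | h
        · exact h3 b' v h4 h5 h
        · exact hno b' v h h4
    rcases hget : w.get? k with _ | a
    · simp only [Option.toList_none, List.append_nil]
      refine hlift fun o v ho hl => ?_
      have := (hw k _).2 ⟨o, ho, hl⟩
      rw [hget] at this
      simp at this
    · obtain ⟨o, ho, hl⟩ := (hw k a).1 hget
      have ho : H.rank key o = k := ho
      simp only [Option.toList_some]
      cases a with
      | snap i r =>
        rw [registers_append_snap]
        refine hlift fun o' v ho' hl' => ?_
        rw [rank_injective hinj hfin (ho'.trans ho.symm), hl] at hl'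
        simp at hl'
      | write i v =>
        rw [registers_append_write]
        by_cases hij : j = i
        · subst hij
          rw [Function.update_self]
          refine .inr ⟨o, by omega, hl, fun b' v' h1 h2 h3 => ?_⟩
          have := rank_lt_rank hfin h2
          omega
        · rw [Function.update_of_ne hij]
          refine hlift fun o' v ho' hl' => ?_
          rw [rank_injective hinj hfin (ho'.trans ho.symm), hl] at hl'
          simp only [Letter.write.injEq] at hl'
          exact hij hl'.1.symm

/-- A history is sequentially consistent if its operations can be ordered by keys in such a way
that every snapshot returns the last values. -/
theorem sequentiallyConsistent (hinj : Function.Injective key)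
    (hfin : ∀ o, {b | key b ≤ key o}.Finite) (hord : ∀ a b, H.precedes a b → key a ≤ key b)
    (hval : ∀ o i r, H.letter o = .snap i r → ∀ j, LastValue key (fun b => key b < key o) j (r j)) :
    SequentiallyConsistent (snapshotSpec n) H := by
  obtain ⟨w, hw⟩ := exists_isWord hinj hfin
  refine ⟨fun a b => key a ≤ key b, ⟨fun _ => le_rfl, fun a b h h' => hinj (le_antisymm h h'),
    fun _ _ _ => le_trans, fun a b => le_total _ _, hord, hfin⟩, w, ?_, hw⟩
  intro k i r hk
  obtain ⟨o, ho, hl⟩ := (hw k _).1 hk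
  have ho : H.rank key o = k := ho
  funext j
  have h1 := hval o i r hl j
  have h2 := IsWord.lastValue_registers hinj hfin hw j k
  subst ho
  simp only [rank_lt_rank_iff hinj hfin] at h2
  exact h1.unique hinj h2

end History

/-! ### Operations and updates -/

lemma Step.of_isWrite {c c' : Config n} {e : Event n} (h : Step c e c') {i : Fin n} {v : ℕ}
    (hw : e.IsWrite i v) : (c.loc i).crashed = false ∧ (c.loc i).inSnap = false ∧
      (e = .crashWrite i v → (c'.loc i).crashed = true) := by
  cases h <;> simp [Event.IsWrite] at hw
  · next h1 h2 =>
    obtain ⟨rfl, rfl⟩ := hw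
    exact ⟨h1.1, h2, by simp⟩
  · next h1 h2 h3 =>
    obtain ⟨rfl, rfl⟩ := hw
    exact ⟨h1.1, h2, by simp [Config.act_loc]⟩

lemma Step.of_callSnap {c c' : Config n} {i : Fin n} (h : Step c (.callSnap i) c') :
    (c.loc i).crashed = false := by
  cases h with
  | callSnap _ h1 h2 => exact h1.1

lemma Step.of_retSnap {c c' : Config n} {i : Fin n} {r : Fin n → ℕ}
    (h : Step c (.retSnap i r) c') : c.Ready i ∧ (c.loc i).inSnap = true ∧ (c.loc i).V = none ∧
      (c.loc i).NoOwn i ∧ r = (c.loc i).X ∧ (c'.loc i).inSnap = false := by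
  cases h with
  | retSnap _ h1 h2 h3 h4 => exact ⟨h1, h2, h3, h4, rfl, by simp [Config.act_loc]⟩

lemma Step.inSnap {c c' : Config n} {e : Event n} (h : Step c e c') {i : Fin n}
    (hi : (c'.loc i).inSnap = true) (he : e ≠ .callSnap i) : (c.loc i).inSnap = true := by
  cases h with
  | idle => exact hi
  | write j v h1 h2 =>
    rw [Config.act_loc] at hi
    split_ifs at hi with hij
    · subst hij
      rcases writeCode_cases i v (c.loc i) with ⟨-, h⟩ | ⟨-, h⟩ <;> rwa [h] at hi
    · exact hi
  | receive j j' m q s' out h1 h2 h3 h4 =>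
    rw [Config.act_loc] at hi
    split_ifs at hi with hij
    · subst hij
      rwa [h4.frame.inSnap] at hi
    · exact hi
  | callSnap j h1 h2 =>
    rw [Config.act_loc] at hi
    split_ifs at hi with hij
    · exact absurd (hij ▸ rfl) he
    · exact hi
  | retSnap j h1 h2 h3 h4 =>
    rw [Config.act_loc] at hi
    split_ifs at hi
    exact hi
  | crashWrite j v sent h1 h2 h3 =>
    rw [Config.act_loc] at hi
    split_ifs at hi with hij
    · rw [hij]; exact hi
    · exact hi
  | crashReceive j j' m q s' out sent h1 h2 h3 h4 h5 =>
    rw [Config.act_loc] at hi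
    split_ifs at hi with hij
    · rw [hij]; exact hi
    · exact hi
  | crash j h1 =>
    rw [Config.act_loc] at hi
    split_ifs at hi with hij
    · rw [hij]; exact hi
    · exact hi

/-- The origin of the updates of `i`: a write, or the postponed write of `i`. -/
lemma GhostStep.own_sent {g g' : Ghost n} {e : Event n} (hs : GhostStep g e g') {i : Fin n}
    {m : Msg n} (hm : m ∈ g'.S i) (hk : m.k = i) :
    m ∈ g.S i ∨ ((g.c.loc i).SC < m.t ∧ (e.IsWrite i m.v ∨
      ((g.c.loc i).V = some m.v ∧ (g.c.loc i).crashed = false ∧ ∀ v, ¬ e.IsWrite i v))) := by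
  have hw : ∀ v, m ∈ (writeCode i v (g.c.loc i)).2 → (g.c.loc i).SC < m.t ∧ v = m.v := by
    intro v hm
    rcases writeCode_cases i v (g.c.loc i) with ⟨-, h⟩ | ⟨-, h⟩
    · rw [h, List.mem_singleton] at hm
      rw [hm]; exact ⟨Nat.lt_succ_self _, rfl⟩
    · simp [h] at hm
  cases hs with
  | idle => exact .inl hm
  | quiet e j a b hb _ _ => exact .inl hm
  | write j v hr =>
    rcases mem_update_append.1 hm with hm | ⟨rfl, hm'⟩
    · exact .inl hm
    · obtain ⟨h1, h2⟩ := hw v hm'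
      exact .inr ⟨h1, .inl (.inl (by rw [h2]))⟩
  | crashWrite j v sent hr hp =>
    rcases mem_update_append.1 hm with hm | ⟨rfl, hm'⟩
    · exact .inl hm
    · obtain ⟨h1, h2⟩ := hw v hm'
      exact .inr ⟨h1, .inl (.inr (by rw [h2]))⟩
  | receive j j' m' q s' out hcr hq hH =>
    rcases mem_update_append.1 hm with hm | ⟨rfl, hm'⟩
    · exact .inl hm
    · obtain ⟨h1, h2⟩ := hH.frame.own m hm' hk
      exact .inr ⟨h2, .inr ⟨h1, hcr, by simp [Event.IsWrite]⟩⟩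
  | crashReceive j j' m' q s' out sent hcr hq hH hp =>
    rcases mem_update_append.1 hm with hm | ⟨rfl, hm'⟩
    · exact .inl hm
    · obtain ⟨h1, h2⟩ := hH.frame.own m hm' hk
      exact .inr ⟨h2, .inr ⟨h1, hcr, by simp [Event.IsWrite]⟩⟩

/-- The origin of the postponed write of a process that has not crashed. -/
lemma GhostStep.postponed {g g' : Ghost n} {e : Event n} (hs : GhostStep g e g') (h : Inv g)
    {i : Fin n} {v : ℕ} (hcr : (g'.c.loc i).crashed = false) (hV : (g'.c.loc i).V = some v) :
    e = .write i v ∨ ((g.c.loc i).crashed = false ∧ (g.c.loc i).V = some v ∧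
      ∀ v', ¬ e.IsWrite i v') := by
  have hcr₀ : (g.c.loc i).crashed = false := by
    by_contra hc
    simp [(hs.mono.2.2.2.2 i (by simpa using hc)).1] at hcr
  cases hs with
  | idle => exact .inr ⟨hcr, hV, by simp [Event.IsWrite]⟩
  | quiet e j a b hb hw _ =>
    rw [Config.act_loc] at hV
    split_ifs at hV with hij
    · subst hij
      exact .inr ⟨hcr₀, hV, hw i⟩
    · exact .inr ⟨hcr₀, hV, hw i⟩
  | write j w hr =>
    rw [Config.act_loc] at hV
    split_ifs at hV with hij
    · subst hij
      rcases writeCode_cases i w (g.c.loc i) with ⟨h1, h2⟩ | ⟨h1, h2⟩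
      · rw [h2] at hV
        simp only at hV
        exact absurd h1 ((h.rest i).postponed (by simp [hV]))
      · rw [h2] at hV
        simp only [Option.some.injEq] at hV
        rw [hV]
        exact .inl rfl
    · exact .inr ⟨hcr₀, hV, by simp [Event.IsWrite, Ne.symm hij]⟩
  | crashWrite j w sent hr hp =>
    rw [Config.act_loc] at hV hcr
    split_ifs at hV hcr with hij
    exact .inr ⟨hcr₀, hV, by simp [Event.IsWrite, Ne.symm hij]⟩
  | receive j j' m' q s' out hcr hq hH =>
    rw [Config.act_loc] at hV
    split_ifs at hV with hij
    · subst hij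
      refine .inr ⟨hcr₀, ?_, by simp [Event.IsWrite]⟩
      rcases hH.frame.V with ⟨h1, -⟩ | ⟨h1, -⟩
      · rw [← h1, hV]
      · simp [h1] at hV
    · exact .inr ⟨hcr₀, hV, by simp [Event.IsWrite]⟩
  | crashReceive j j' m' q s' out sent hcr' hq hH hp =>
    rw [Config.act_loc] at hV hcr
    split_ifs at hV hcr with hij
    exact .inr ⟨hcr₀, hV, by simp [Event.IsWrite]⟩

/-- A postponed write remains postponed until its broadcast is complete. -/
lemma GhostStep.flushed {g g' : Ghost n} {e : Event n} (hs : GhostStep g e g') {i : Fin n}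
    (hV : (g.c.loc i).V ≠ none) : (g'.c.loc i).V ≠ none ∨
      ((g'.c.loc i).crashed = false ∧ ∃ m ∈ g'.S i, m.k = i ∧ (g.c.loc i).SC < m.t) := by
  cases hs with
  | idle => exact .inl hV
  | quiet e j a b hb hw _ =>
    rw [Config.act_loc]
    split_ifs with hij
    · subst hij; exact .inl hV
    · exact .inl hV
  | write j w hr =>
    rw [Config.act_loc]
    split_ifs with hij
    · subst hij
      rcases writeCode_cases i w (g.c.loc i) with ⟨h1, h2⟩ | ⟨h1, h2⟩ <;> rw [h2]
      · exact .inl hV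
      · exact .inl (by simp)
    · exact .inl hV
  | crashWrite j w sent hr hp =>
    rw [Config.act_loc]
    split_ifs with hij
    · subst hij; exact .inl hV
    · exact .inl hV
  | receive j j' m' q s' out hcr hq hH =>
    rw [Config.act_loc]
    split_ifs with hij
    · subst hij
      rcases hH.frame.V with ⟨h1, -⟩ | ⟨-, m, hm, hk⟩
      · rw [h1]; exact .inl hV
      · refine .inr ⟨hH.frame.crashed.trans hcr, m, mem_update_append.2 (.inr ⟨rfl, hm⟩), hk, ?_⟩
        exact (hH.frame.own m hm hk).2
    · exact .inl hV
  | crashReceive j j' m' q s' out sent hcr hq hH hp =>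
    rw [Config.act_loc]
    split_ifs with hij
    · subst hij; exact .inl hV
    · exact .inl hV

/-- A write is broadcast or postponed. -/
lemma GhostStep.write_sent {g g' : Ghost n} {i : Fin n} {v : ℕ}
    (hs : GhostStep g (.write i v) g') : (g'.c.loc i).V ≠ none ∨
      ((g'.c.loc i).crashed = false ∧ ∃ m ∈ g'.S i, m.k = i ∧ (g.c.loc i).SC < m.t) := by
  cases hs with
  | quiet e j a b hb hw _ => exact absurd (.inl rfl) (hw i v)
  | write j w hr =>
    rw [Config.act_loc, if_pos rfl]
    rcases writeCode_cases i v (g.c.loc i) with ⟨-, h2⟩ | ⟨-, h2⟩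
    · right
      simp only [h2]
      exact ⟨hr.1, ⟨v, i, (g.c.loc i).SC + 1, (g.c.loc i).SC + 1⟩,
        mem_update_append.2 (.inr ⟨rfl, List.mem_singleton_self _⟩), rfl, Nat.lt_succ_self _⟩
    · rw [h2]; exact .inl (by simp)

/-! ### Snapshots and writes compared through the stamps -/

namespace Execution

variable {E : Execution n}

lemma inSnap_of_le {τ σ : ℕ} {i : Fin n} (h : τ ≤ σ) (hi : (E.loc σ i).inSnap = true)
    (he : ∀ ρ, τ ≤ ρ → ρ < σ → E.event ρ ≠ .callSnap i) : (E.loc τ i).inSnap = true := by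
  induction h with
  | refl => exact hi
  | step h ih =>
    exact ih ((E.step _).inSnap hi (he _ h (Nat.lt_succ_self _)))
      fun ρ h1 h2 => he ρ h1 (Nat.lt_succ_of_lt h2)

variable (E) in
/-- The snapshot of `i` invoked at time `τ` returns `r` at time `ρ`. -/
def ReturnsAt (τ : ℕ) (i : Fin n) (r : Fin n → ℕ) (ρ : ℕ) : Prop :=
  E.event τ = .callSnap i ∧ τ < ρ ∧ E.event ρ = .retSnap i r ∧
    ∀ σ, τ < σ → σ < ρ → E.event σ ≠ .callSnap i

lemma snapReturns_iff {τ : ℕ} {i : Fin n} {r : Fin n → ℕ} :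
    E.SnapReturns τ i r ↔ ∃ ρ, E.ReturnsAt τ i r ρ := by
  simp [SnapReturns, ReturnsAt]

lemma ReturnsAt.facts {τ ρ : ℕ} {i : Fin n} {r : Fin n → ℕ} (h : E.ReturnsAt τ i r ρ) :
    (E.conf ρ).Ready i ∧ (E.loc ρ i).inSnap = true ∧ (E.loc ρ i).V = none ∧
      (E.loc ρ i).NoOwn i ∧ r = (E.loc ρ i).X ∧ (E.loc (ρ + 1) i).inSnap = false := by
  have hs := E.step ρ
  rw [h.2.2.1] at hs
  exact hs.of_retSnap

/-- A return resets `inSnap`, and only an invocation sets it again; so a second return would need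
another invocation in between. -/
lemma ReturnsAt.unique {τ ρ ρ' : ℕ} {i i' : Fin n} {r r' : Fin n → ℕ} (h : E.ReturnsAt τ i r ρ)
    (h' : E.ReturnsAt τ i' r' ρ') : i = i' ∧ ρ = ρ' ∧ r = r' := by
  have hi : i = i' := by
    have := h.1.symm.trans h'.1
    simpa using this
  subst hi
  have aux : ∀ {ρ ρ' : ℕ} {r r' : Fin n → ℕ}, E.ReturnsAt τ i r ρ → E.ReturnsAt τ i r' ρ' →
      ¬ ρ < ρ' := by
    intro ρ ρ' r r' h h' hlt
    have h1 := inSnap_of_le (τ := ρ + 1) hlt h'.facts.2.1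
      fun σ h1 h2 => h'.2.2.2 σ (h.2.1.trans h1) h2
    simp [h.facts.2.2.2.2.2] at h1
  have hρ : ρ = ρ' := le_antisymm (not_lt.mp (aux h' h)) (not_lt.mp (aux h h'))
  subst hρ
  exact ⟨rfl, rfl, h.facts.2.2.2.2.1.trans h'.facts.2.2.2.2.1.symm⟩

lemma ReturnsAt.lt_of_lt {τ τ' ρ ρ' : ℕ} {i : Fin n} {r r' : Fin n → ℕ} (h : E.ReturnsAt τ i r ρ)
    (h' : E.ReturnsAt τ' i r' ρ') (hτ : τ < τ') : ρ < ρ' := by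
  refine lt_of_le_of_lt ?_ h'.2.1
  by_contra hc
  exact h.2.2.2 τ' hτ (not_le.mp hc) h'.1

/-- A process starts no write while it is inside a snapshot. -/
lemma ReturnsAt.lt_of_isWrite {τ τ' ρ : ℕ} {i : Fin n} {r : Fin n → ℕ} {v : ℕ}
    (h : E.ReturnsAt τ i r ρ) (hw : (E.event τ').IsWrite i v) (hτ : τ < τ') : ρ < τ' := by
  by_contra hc
  have h1 := inSnap_of_le (not_lt.mp hc) h.facts.2.1
    fun σ h1 h2 => h.2.2.2 σ (hτ.trans_le h1) h2
  have h2 := ((E.step τ').of_isWrite hw).2.1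
  simp only [Execution.loc] at h1
  simp [h1] at h2

/-- The own updates validated by a process are not stamped later than its clock. -/
lemma VC_le_SC {τ : ℕ} {i : Fin n} (hi : (E.loc τ i).crashed = false) :
    (E.loc τ i).VC i ≤ (E.loc τ i).SC := by
  have hf := (E.inv τ).full hi
  rcases hf.loc.vc_sent i with ⟨h1, -⟩ | ⟨m, h1, h2, h3, -⟩
  · exact h1.le.trans (Nat.zero_le _)
  · have h4 := hf.own_lt h1 h2
    rw [h3] at h4
    exact Nat.lt_succ_iff.1 h4

/-- The state of a write after its return: postponed, or replaced by an update that has been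
broadcast completely. -/
lemma postponed_or_sent {τ σ : ℕ} {i : Fin n} {v : ℕ} (hw : E.event τ = .write i v) (h : τ < σ) :
    (E.loc σ i).V ≠ none ∨ ∃ ρ ≤ σ, (E.loc ρ i).crashed = false ∧
      ∃ m ∈ E.S ρ i, m.k = i ∧ (E.loc τ i).SC < m.t := by
  induction h with
  | refl =>
    have hs := E.ghostStep τ
    rw [hw] at hs
    rcases hs.write_sent with h | ⟨h1, m, h2⟩
    · exact .inl h
    · exact .inr ⟨_, le_rfl, h1, m, h2⟩
  | @step σ h ih =>
    rcases ih with ih | ⟨ρ, h1, h2⟩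
    · rcases (E.ghostStep σ).flushed ih with h' | ⟨h1, m, h2, h3, h4⟩
      · exact .inl h'
      · exact .inr ⟨_, le_rfl, h1, m, h2, h3,
          (E.SC_mono (Nat.le_of_lt h) i).trans_lt h4⟩
    · exact .inr ⟨ρ, Nat.le_succ_of_le h1, h2⟩

lemma exists_write_of_postponed {τ : ℕ} {i : Fin n} {v : ℕ} (hcr : (E.loc τ i).crashed = false)
    (hV : (E.loc τ i).V = some v) : ∃ σ < τ, E.event σ = .write i v ∧
      ∀ σ' v', σ < σ' → σ' < τ → ¬ (E.event σ').IsWrite i v' := by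
  induction τ with
  | zero =>
    unfold Execution.loc at hV
    rw [E.init] at hV
    simp [Config.initial, Loc.initial] at hV
  | succ τ ih =>
    rcases (E.ghostStep τ).postponed (E.inv τ) hcr hV with h | ⟨h1, h2, h3⟩
    · exact ⟨τ, Nat.lt_succ_self _, h, fun σ' v' h1 h2 => by omega⟩
    · obtain ⟨σ, h4, h5, h6⟩ := ih h1 h2
      refine ⟨σ, by omega, h5, fun σ' v' h7 h8 => ?_⟩
      rcases (Nat.lt_succ_iff.1 h8).lt_or_eq with h9 | rfl
      · exact h6 σ' v' h7 h9
      · exact h3 v'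

/-- Every update carries the value of the last write that precedes its broadcast. -/
lemma exists_write_of_sent {i : Fin n} {m : Msg n} (hm : E.Sent i m) (hk : m.k = i) :
    ∃ σ, (E.event σ).IsWrite i m.v ∧ (E.loc σ i).SC < m.t ∧
      ∀ σ' v, σ < σ' → (E.event σ').IsWrite i v → m.t ≤ (E.loc σ' i).SC := by
  have key : ∀ τ, m ∈ E.S τ i → ∃ σ < τ, (E.event σ).IsWrite i m.v ∧ (E.loc σ i).SC < m.t ∧
      ∀ σ' v, σ < σ' → σ' < τ → (E.event σ').IsWrite i v → m.t ≤ (E.loc σ' i).SC := by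
    intro τ hm
    induction τ with
    | zero => exact absurd hm (by simp [Execution.S, ghostAux])
    | succ τ ih =>
      rcases (E.ghostStep τ).own_sent hm hk with h | ⟨h1, h2 | ⟨h2, h3, h4⟩⟩
      · obtain ⟨σ, h1, h2, h3, h4⟩ := ih h
        refine ⟨σ, by omega, h2, h3, fun σ' v h5 h6 h7 => ?_⟩
        rcases (Nat.lt_succ_iff.1 h6).lt_or_eq with h8 | rfl
        · exact h4 σ' v h5 h8 h7
        · have hf := (E.inv σ').full ((E.step σ').of_isWrite h7).1
          exact Nat.lt_succ_iff.1 (hf.own_lt h hk)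
      · exact ⟨τ, Nat.lt_succ_self _, h2, h1, fun σ' v h3 h4 => by omega⟩
      · obtain ⟨σ, h5, h6, h7⟩ := exists_write_of_postponed h3 h2
        refine ⟨σ, by omega, .inl h6, (E.SC_mono h5.le i).trans_lt h1, fun σ' v h8 h9 h10 => ?_⟩
        rcases (Nat.lt_succ_iff.1 h9).lt_or_eq with h11 | rfl
        · exact absurd h10 (h7 σ' v h8 h11)
        · exact absurd h10 (h4 v)
  obtain ⟨τ, hτ⟩ := hm
  obtain ⟨σ, h1, h2, h3, h4⟩ := key τ hτ
  refine ⟨σ, h2, h3, fun σ' v h5 h6 => ?_⟩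
  rcases lt_or_ge σ' τ with h7 | h7
  · exact h4 σ' v h5 h7 h6
  · have hf := (E.inv σ').full ((E.step σ').of_isWrite h6).1
    exact Nat.lt_succ_iff.1 (hf.own_lt ((E.S_mono h7 i).subset hτ) hk)

/-- A snapshot sees the previous writes of the same process. -/
lemma ReturnsAt.of_isWrite_lt {τ τ' ρ : ℕ} {i : Fin n} {r : Fin n → ℕ} {v : ℕ}
    (h : E.ReturnsAt τ i r ρ) (hw : (E.event τ').IsWrite i v) (hτ : τ' < τ) :
    (E.loc τ' i).SC < (E.loc ρ i).VC i := by
  obtain ⟨h1, h2, h3, h4, -⟩ := h.facts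
  have hτρ : τ' < ρ := hτ.trans h.2.1
  have hw' : E.event τ' = .write i v := by
    refine hw.resolve_right fun hc => ?_
    have h5 : (E.loc (τ' + 1) i).crashed = true := ((E.step τ').of_isWrite hw).2.2 hc
    have h6 : (E.loc (τ' + 1) i).crashed = false := E.not_crashed_of_le hτρ h1.1
    simp [h5] at h6
  rcases postponed_or_sent hw' hτρ with h5 | ⟨ρ', h5, -, m, h6, h7, h8⟩
  · exact absurd h3 h5
  · have h9 := (E.inv ρ).mem_received h1.1 ((E.S_mono h5 i).subset h6) (by simp [h1.2])
    exact h8.trans_le (((E.inv ρ).full h1.1).own_validated h4 h9 h7)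

/-- A snapshot does not see the following writes of the same process. -/
lemma ReturnsAt.of_lt_isWrite {τ τ' ρ : ℕ} {i : Fin n} {r : Fin n → ℕ} {v : ℕ}
    (h : E.ReturnsAt τ i r ρ) (hw : (E.event τ').IsWrite i v) (hτ : τ < τ') :
    (E.loc ρ i).VC i ≤ (E.loc τ' i).SC :=
  (VC_le_SC h.facts.1.1).trans (E.SC_mono (h.lt_of_isWrite hw hτ).le i)

/-- Every write that has returned and is not lost is eventually seen by all correct processes. -/
lemma exists_validates_write (hE : 2 * E.faulty.ncard < n) {τ : ℕ} {i : Fin n} {v : ℕ}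
    (hw : E.event τ = .write i v)
    (hlost : i ∈ E.faulty → ∃ σ, τ < σ ∧ (E.loc σ i).V = none) {j : Fin n} (hj : j ∉ E.faulty) :
    ∃ σ, (E.loc τ i).SC < (E.loc σ j).VC i := by
  have hsent : ∃ ρ, (E.loc ρ i).crashed = false ∧
      ∃ m ∈ E.S ρ i, m.k = i ∧ (E.loc τ i).SC < m.t := by
    by_contra hno
    -- Without any complete broadcast the write stays postponed forever, so `i` is correct and sends
    -- no own update with a stamp above its clock at `τ`. These finitely many updates are eventually
    -- validated by `i`; then no own entry is left in `G` to justify the postponement.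
    have hV : ∀ σ, τ < σ → (E.loc σ i).V ≠ none := by
      intro σ hσ
      refine (postponed_or_sent hw hσ).resolve_right fun ⟨ρ, _, h⟩ => hno ⟨ρ, h⟩
    have hi : i ∉ E.faulty := fun hi => by
      obtain ⟨σ, h1, h2⟩ := hlost hi
      exact hV σ h1 h2
    have hle : ∀ σ, ∀ m ∈ E.S σ i, m.k = i → m.t ≤ (E.loc τ i).SC := by
      intro σ m hm hk
      by_contra hc
      exact hno ⟨σ, E.not_crashed hi σ, m, hm, hk, not_le.mp hc⟩
    have hev : ∀ᶠ σ in Filter.atTop, ∀ t ∈ Set.Iic (E.loc τ i).SC, (i, t) ∈ E.known →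
        t ≤ (E.loc σ i).VC i := by
      refine (Filter.eventually_all_finite (Set.finite_Iic _)).2 fun t _ => ?_
      by_cases ht : (i, t) ∈ E.known
      · obtain ⟨σ, h⟩ := exists_validates hE ht hi
        exact Filter.eventually_atTop.2 ⟨σ, fun ρ hρ _ => h.mono hρ⟩
      · exact Filter.Eventually.of_forall fun _ h => absurd h ht
    obtain ⟨σ, h1, h2⟩ := (hev.and (Filter.eventually_gt_atTop τ)).exists
    have h3 := ((E.inv σ).rest i).postponed (hV σ h2)
    simp only [Loc.NoOwn, not_forall, not_not] at h3
    obtain ⟨e, he, hek⟩ := h3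
    obtain ⟨m, h4, h5, h6, -⟩ := ((E.inv σ).loc i).g_sent e he
    have h7 := hle σ m h4 (h5.trans hek)
    have h8 := h1 m.t h7 ⟨i, hi, m, ⟨σ, h4⟩, by simp [Msg.key, h5, hek]⟩
    have h9 : (E.loc σ i).VC e.k < e.t := ((E.inv σ).loc i).g_vc e he
    rw [hek] at h9
    omega
  obtain ⟨ρ, h1, m, h2, h3, h4⟩ := hsent
  obtain ⟨σ, h5⟩ := E.exists_mem_R hj h1 h2
  obtain ⟨m', h6, h7⟩ := exists_sent_of_mem_R hj (h5 σ le_rfl)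
  obtain ⟨σ', h8⟩ := exists_validates hE (u := (i, m.t))
    ⟨j, hj, m', h6, by rw [h7, Msg.key, h3]⟩ hj
  exact ⟨σ', h4.trans_le h8⟩

end Execution

namespace Execution

/-! ### The linearization -/

variable (E : Execution n)

/-- The snapshots that return. -/
def snaps : Set ℕ := {τ | ∃ i r, E.SnapReturns τ i r}

open Classical in
/-- The last updates validated by the process of a snapshot when it returns. -/
noncomputable def view (τ : ℕ) : Fin n → ℕ :=
  if h : ∃ i r ρ, E.ReturnsAt τ i r ρ then
    (E.loc h.choose_spec.choose_spec.choose h.choose).VC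
  else 0

/-- The snapshots that see the write invoked by `i` at time `τ`. -/
def covers (τ : ℕ) (i : Fin n) : Set ℕ := {s ∈ E.snaps | (E.loc τ i).SC < E.view s i}

/-- The position of a snapshot in the linearization. -/
noncomputable def weight (s : ℕ) : ℕ∞ := ((∑ k, E.view s k : ℕ) : ℕ∞)

/-- The position in the linearization of a write invoked by `i`: just before the first snapshot
that sees it. -/
noncomputable def level (τ : ℕ) (i : Fin n) : ℕ∞ := sInf (E.weight '' E.covers τ i)

variable {E}

lemma ReturnsAt.view_eq {τ ρ : ℕ} {i : Fin n} {r : Fin n → ℕ} (h : E.ReturnsAt τ i r ρ) :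
    E.view τ = (E.loc ρ i).VC := by
  have hex : ∃ i r ρ, E.ReturnsAt τ i r ρ := ⟨i, r, ρ, h⟩
  have hvc : ∀ i' ρ', i' = i → ρ' = ρ → (E.loc ρ' i').VC = (E.loc ρ i).VC := by
    rintro _ _ rfl rfl; rfl
  obtain ⟨h2, h3, -⟩ := hex.choose_spec.choose_spec.choose_spec.unique h
  rw [view, dif_pos hex, hvc _ _ h2 h3]

lemma ReturnsAt.mem_snaps {τ ρ : ℕ} {i : Fin n} {r : Fin n → ℕ} (h : E.ReturnsAt τ i r ρ) :
    τ ∈ E.snaps := ⟨i, r, snapReturns_iff.2 ⟨ρ, h⟩⟩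

lemma exists_returnsAt {s : ℕ} (h : s ∈ E.snaps) : ∃ i r ρ, E.ReturnsAt s i r ρ := by
  obtain ⟨i, r, h⟩ := h
  obtain ⟨ρ, h⟩ := snapReturns_iff.1 h
  exact ⟨i, r, ρ, h⟩

/-- Views are totally ordered, so the sum of the entries loses nothing: comparable vectors with
equal sums coincide. -/
lemma weight_le_iff {s s' : ℕ} (hs : s ∈ E.snaps) (hs' : s' ∈ E.snaps) :
    E.weight s ≤ E.weight s' ↔ E.view s ≤ E.view s' := by
  simp only [weight, Nat.cast_le]
  refine ⟨fun h => ?_, fun h => Finset.sum_le_sum fun k _ => h k⟩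
  obtain ⟨i, r, ρ, h1⟩ := exists_returnsAt hs
  obtain ⟨i', r', ρ', h1'⟩ := exists_returnsAt hs'
  have htot := E.VC_total ρ ρ' i i'
  rw [← h1.view_eq, ← h1'.view_eq] at htot
  rcases htot with h2 | h2
  · exact h2
  · have h3 := (Finset.sum_eq_sum_iff_of_le (fun k _ => h2 k)).1
      (le_antisymm (Finset.sum_le_sum fun k _ => h2 k) h)
    exact fun k => (h3 k (Finset.mem_univ k)).ge

/-- The infimum is attained because `ℕ∞` is well ordered; the value `⊤` means that no snapshot sees
the write. -/
lemma exists_weight_eq_level {τ : ℕ} {i : Fin n} (h : E.level τ i ≠ ⊤) :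
    ∃ s ∈ E.covers τ i, E.weight s = E.level τ i := by
  have hne : (E.weight '' E.covers τ i).Nonempty := by
    by_contra hc
    rw [Set.not_nonempty_iff_eq_empty] at hc
    simp [level, hc] at h
  exact csInf_mem hne

/-- Seeing a write is inherited by larger views, so the first snapshot that sees it decides for all
snapshots of at least its weight. -/
lemma level_le_iff {τ s : ℕ} {i : Fin n} (hs : s ∈ E.snaps) :
    E.level τ i ≤ E.weight s ↔ s ∈ E.covers τ i := by
  refine ⟨fun h => ?_, fun h => sInf_le ⟨s, h, rfl⟩⟩
  have htop : E.level τ i ≠ ⊤ := (h.trans_lt (ENat.natCast_lt_top _)).ne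
  obtain ⟨s', h1, h2⟩ := exists_weight_eq_level htop
  rw [← h2, weight_le_iff h1.1 hs] at h
  exact ⟨hs, h1.2.trans_le (h i)⟩

/-- A property that is eventually true at all correct processes holds for all but finitely many
snapshots. -/
lemma exists_forall_view {P : (Fin n → ℕ) → Prop} (hP : ∀ v v', v ≤ v' → P v → P v')
    (h : ∀ j ∉ E.faulty, ∃ σ, P (E.loc σ j).VC) :
    ∃ θ, ∀ s ∈ E.snaps, θ ≤ s → P (E.view s) := by
  have hev : ∀ᶠ s in Filter.atTop, ∀ j r ρ, E.ReturnsAt s j r ρ → P (E.view s) := by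
    refine Filter.eventually_all.2 fun j => Filter.eventually_atTop.2 ?_
    -- A faulty process invokes no snapshot after its crash, so it contributes only finitely many
    -- exceptions.
    by_cases hj : j ∈ E.faulty
    · obtain ⟨θ, hθ⟩ := hj
      refine ⟨θ, fun s hs r ρ hr => ?_⟩
      have h1 := E.step s
      rw [hr.1] at h1
      have h2 : (E.loc s j).crashed = false := h1.of_callSnap
      have h3 : (E.loc s j).crashed = true := E.crashed_mono hs hθ
      simp [h2] at h3
    · obtain ⟨θ, hθ⟩ := h j hj
      refine ⟨θ, fun s hs r ρ hr => hP _ _ (fun k => ?_) hθ⟩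
      rw [hr.view_eq]
      exact E.VC_mono (hs.trans hr.2.1.le) j k
  obtain ⟨θ, hθ⟩ := Filter.eventually_atTop.1 hev
  refine ⟨θ, fun s hs hθs => ?_⟩
  obtain ⟨j, r, ρ, hr⟩ := exists_returnsAt hs
  exact hθ s hθs j r ρ hr

/-- Every update validated by some process is known to a correct process. -/
lemma known_of_pos_VC (hE : 2 * E.faulty.ncard < n) {τ : ℕ} {i k : Fin n}
    (h : 0 < (E.loc τ i).VC k) : (k, (E.loc τ i).VC k) ∈ E.known := by
  classical
  obtain ⟨m₀, h1, h2, h3, -⟩ := E.exists_sent_VC τ i k h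
  have hb := E.before τ i h1 h2 h3.le (Nat.lt_succ_self ((E.loc τ i).VC k))
  obtain ⟨l, h4, h5⟩ := exists_mem_of_majorities hb (correct_majority hE)
  obtain ⟨m, h6, h7, h8, -⟩ := (Finset.mem_filter.1 h4).2
  exact ⟨l, (Finset.mem_filter.1 h5).2, m, h6, by rw [Msg.key, h7, h8, h3]⟩

/-- All but finitely many snapshots see what a given snapshot sees. -/
lemma exists_forall_view_le (hE : 2 * E.faulty.ncard < n) {s : ℕ} (hs : s ∈ E.snaps) :
    ∃ θ, ∀ s' ∈ E.snaps, θ ≤ s' → E.view s ≤ E.view s' := by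
  refine exists_forall_view (P := fun v => E.view s ≤ v) (fun _ _ h h' => h'.trans h) fun j hj => ?_
  obtain ⟨i, r, ρ, hr⟩ := exists_returnsAt hs
  have hev : ∀ᶠ σ in Filter.atTop, ∀ k, E.view s k ≤ (E.loc σ j).VC k := by
    refine Filter.eventually_all.2 fun k => ?_
    rcases Nat.eq_zero_or_pos (E.view s k) with h | h
    · exact Filter.Eventually.of_forall fun σ => h.le.trans (Nat.zero_le _)
    · rw [hr.view_eq] at h ⊢
      obtain ⟨σ, hσ⟩ := exists_validates hE (known_of_pos_VC hE h) hj
      exact Filter.eventually_atTop.2 ⟨σ, fun ρ hρ => hσ.mono hρ⟩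
  obtain ⟨σ, hσ⟩ := hev.exists
  exact ⟨σ, hσ⟩

/-- Finitely many writes are seen by a given snapshot. -/
lemma finite_writes_of_snap {s : ℕ} (hs : s ∈ E.snaps) :
    {τ | ∃ i v, (E.event τ).IsWrite i v ∧ s ∈ E.covers τ i}.Finite := by
  have h : ∀ i, {τ | ∃ v, (E.event τ).IsWrite i v ∧ s ∈ E.covers τ i}.Finite := by
    intro i
    obtain ⟨j, r, ρ, hr⟩ := exists_returnsAt hs
    rcases Nat.eq_zero_or_pos (E.view s i) with h | h
    · refine Set.finite_empty.subset ?_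
      rintro τ ⟨v, -, -, hc⟩
      omega
    · rw [hr.view_eq] at h
      obtain ⟨m, h1, h2, h3, -⟩ := E.exists_sent_VC ρ j i h
      obtain ⟨σ, -, -, h4⟩ := exists_write_of_sent h1 h2
      refine (Set.finite_Iic σ).subset ?_
      rintro τ ⟨v, hw, -, hc⟩
      rw [hr.view_eq, ← h3] at hc
      by_contra hlt
      exact absurd (h4 τ v (not_le.mp hlt) hw) hc.not_ge
  refine (Set.finite_iUnion h).subset ?_
  rintro τ ⟨i, h⟩
  exact Set.mem_iUnion.2 ⟨i, h⟩

variable (E)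

/-- The operations of the history: the snapshots that return, the writes that are seen by them, and,
if finitely many snapshots return, all writes. -/
def InHistory (τ : ℕ) : Letter n → Prop
  | .write i v => (E.event τ).IsWrite i v ∧ ((E.covers τ i).Nonempty ∨ E.snaps.Finite)
  | .snap i r => E.SnapReturns τ i r

/-- The history that models the execution. -/
abbrev history : History (Letter n) where
  Op := {p : ℕ × Letter n // E.InHistory p.1 p.2}
  letter o := o.1.2
  precedes o o' := o.1.2.proc = o'.1.2.proc ∧ o.1.1 < o'.1.1

/-- The first component of the keys. -/
noncomputable def position (τ : ℕ) : Letter n → ℕ∞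
  | .write i _ => E.level τ i
  | .snap _ _ => E.weight τ

/-- The keys that order the operations: writes precede the snapshots at the same position. -/
noncomputable def key (o : E.history.Op) : ℕ∞ ×ₗ ℕ ×ₗ ℕ :=
  toLex (E.position o.1.1 o.1.2,
    toLex ((match o.1.2 with | .write _ _ => 0 | .snap _ _ => 1), o.1.1))

variable {E}

lemma InHistory.unique {τ : ℕ} {a b : Letter n} (ha : E.InHistory τ a) (hb : E.InHistory τ b) :
    a = b := by
  cases a with
  | write i v =>
    cases b with
    | write j w =>
      rcases ha.1 with h | h <;> rcases hb.1 with h' | h' <;> rw [h] at h' <;> simp at h' <;>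
      simp [h']
    | snap j r =>
      have h' := hb.1
      rcases ha.1 with h | h <;> rw [h] at h' <;> simp at h'
  | snap i r =>
    cases b with
    | write j w =>
      have h' := ha.1
      rcases hb.1 with h | h <;> rw [h] at h' <;> simp at h'
    | snap j r' =>
      obtain ⟨ρ, h⟩ := snapReturns_iff.1 ha
      obtain ⟨ρ', h'⟩ := snapReturns_iff.1 hb
      obtain ⟨rfl, -, rfl⟩ := h.unique h'
      rfl

lemma time_injective : Function.Injective fun o : E.history.Op => o.1.1 := by
  rintro ⟨⟨τ, a⟩, ha⟩ ⟨⟨σ, b⟩, hb⟩ h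
  obtain rfl : τ = σ := h
  obtain rfl : a = b := ha.unique hb
  rfl

lemma key_injective : Function.Injective E.key := by
  intro a b h
  refine time_injective ?_
  simp only [key, EmbeddingLike.apply_eq_iff_eq, Prod.mk.injEq] at h
  exact h.2.2

lemma key_le_key {o o' : E.history.Op} : E.key o ≤ E.key o' ↔
    E.position o.1.1 o.1.2 < E.position o'.1.1 o'.1.2 ∨
    (E.position o.1.1 o.1.2 = E.position o'.1.1 o'.1.2 ∧
      toLex ((match o.1.2 with | .write _ _ => 0 | .snap _ _ => 1 : ℕ), o.1.1) ≤
      toLex ((match o'.1.2 with | .write _ _ => 0 | .snap _ _ => 1 : ℕ), o'.1.1)) :=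
  Prod.Lex.toLex_le_toLex

lemma write_lt_snap {τ s : ℕ} {i j : Fin n} {v : ℕ} {r : Fin n → ℕ}
    (hw : E.InHistory τ (.write i v)) (hs : E.InHistory s (.snap j r)) :
    E.key ⟨(τ, .write i v), hw⟩ < E.key ⟨(s, .snap j r), hs⟩ ↔ s ∈ E.covers τ i := by
  rw [← level_le_iff (E := E) ⟨j, r, hs⟩]
  simp only [key, position, Prod.Lex.toLex_lt_toLex]
  constructor
  · rintro (h | h)
    · exact h.le
    · exact h.1.le
  · intro h
    rcases h.lt_or_eq with h | h
    · exact .inl h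
    · exact .inr ⟨h, .inl Nat.zero_lt_one⟩

/-- Between writes, the level grows with the clock of the writer. A snapshot sees exactly the writes
of its own process that precede it, by `ReturnsAt.of_isWrite_lt` and `ReturnsAt.of_lt_isWrite`.
Between snapshots, `VC` grows. -/
lemma key_le_of_precedes {a b : E.history.Op} (h : E.history.precedes a b) :
    E.key a ≤ E.key b := by
  obtain ⟨⟨τ, a⟩, ha⟩ := a
  obtain ⟨⟨σ, b⟩, hb⟩ := b
  obtain ⟨hp, hlt⟩ := h
  simp only at hp hlt
  cases a with
  | write i v =>
    cases b with
    | write j w =>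
      obtain rfl : i = j := hp
      have hle : E.level τ i ≤ E.level σ i := by
        refine sInf_le_sInf (Set.image_mono ?_)
        rintro s ⟨h1, h2⟩
        exact ⟨h1, (E.SC_mono hlt.le i).trans_lt h2⟩
      rw [key_le_key]
      rcases hle.lt_or_eq with h | h
      · exact .inl h
      · exact .inr ⟨h, Prod.Lex.toLex_le_toLex.2 (.inr ⟨rfl, hlt.le⟩)⟩
    | snap j r =>
      obtain rfl : i = j := hp
      obtain ⟨ρ, hr⟩ := snapReturns_iff.1 hb
      refine ((write_lt_snap ha hb).2 ⟨hr.mem_snaps, ?_⟩).le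
      rw [hr.view_eq]
      exact hr.of_isWrite_lt ha.1 hlt
  | snap i r =>
    obtain ⟨ρ, hr⟩ := snapReturns_iff.1 ha
    cases b with
    | write j w =>
      obtain rfl : i = j := hp
      rw [key_le_key]
      refine .inl (not_le.mp fun h => ?_)
      have h2 := ((level_le_iff hr.mem_snaps).1 h).2
      rw [hr.view_eq] at h2
      exact absurd (hr.of_lt_isWrite hb.1 hlt) h2.not_ge
    | snap j r' =>
      obtain rfl : i = j := hp
      obtain ⟨ρ', hr'⟩ := snapReturns_iff.1 hb
      have hle : E.weight τ ≤ E.weight σ := by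
        rw [weight_le_iff hr.mem_snaps hr'.mem_snaps, hr.view_eq, hr'.view_eq]
        exact E.VC_mono (hr.lt_of_lt hr' hlt).le i
      rw [key_le_key]
      rcases hle.lt_or_eq with h | h
      · exact .inl h
      · exact .inr ⟨h, Prod.Lex.toLex_le_toLex.2 (.inr ⟨rfl, hlt.le⟩)⟩

/-- Every operation has a finite past in the linearization. -/
lemma finite_past (hE : 2 * E.faulty.ncard < n) (o : E.history.Op) :
    {b | E.key b ≤ E.key o}.Finite := by
  refine Set.Finite.of_finite_image (f := fun o => o.1.1) ?_ time_injective.injOn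
  -- At the position of a snapshot `s`, preceding writes are seen by `s`, strictly lighter snapshots
  -- are invoked before some time `θ`, and snapshots of equal weight are ordered by invocation.
  by_cases hpos : ∃ s ∈ E.snaps, E.weight s = E.position o.1.1 o.1.2
  · obtain ⟨s, hs, hws⟩ := hpos
    obtain ⟨θ, hθ⟩ := exists_forall_view_le hE hs
    refine (((finite_writes_of_snap hs).union (Set.finite_Iio θ)).union
      (Set.finite_Iic o.1.1)).subset ?_
    rintro _ ⟨⟨⟨τ, a⟩, ha⟩, hle, rfl⟩
    have hle : E.key ⟨(τ, a), ha⟩ ≤ E.key o := hle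
    rw [key_le_key, ← hws] at hle
    cases a with
    | write i v =>
      refine .inl (.inl ⟨i, v, ha.1, (level_le_iff hs).1 ?_⟩)
      rcases hle with h | h
      · exact h.le
      · exact h.1.le
    | snap i r =>
      rcases hle with h | ⟨-, h⟩
      · refine .inl (.inr (show τ < θ from not_le.mp fun hτ => ?_))
        exact absurd ((weight_le_iff hs ⟨i, r, ha⟩).2 (hθ τ ⟨i, r, ha⟩ hτ)) h.not_ge
      · refine .inr ?_
        obtain ⟨⟨σ, b⟩, hb⟩ := o
        cases b with
        | write j w => simp [Prod.Lex.toLex_le_toLex] at h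
        | snap j r' => simpa [Prod.Lex.toLex_le_toLex] using h
  · obtain ⟨⟨σ, b⟩, hb⟩ := o
    cases b with
    | snap j r => exact absurd ⟨σ, ⟨j, r, hb⟩, rfl⟩ hpos
    | write j w =>
      -- The remaining operations are unseen writes, which belong to the history only if finitely
      -- many snapshots return; they are ordered by invocation.
      have htop : E.level σ j = ⊤ := by
        by_contra hc
        obtain ⟨s, h1, h2⟩ := exists_weight_eq_level hc
        exact hpos ⟨s, h1.1, h2⟩
      have hfin : E.snaps.Finite := by
        refine hb.2.resolve_left ?_
        rintro ⟨s, h1⟩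
        have h2 := (level_le_iff h1.1).2 h1
        rw [htop, top_le_iff] at h2
        exact ENat.natCast_ne_top _ h2
      refine (((hfin.biUnion fun s hs => finite_writes_of_snap hs).union hfin).union
        (Set.finite_Iic σ)).subset ?_
      rintro _ ⟨⟨⟨τ, a⟩, ha⟩, hle, rfl⟩
      cases a with
      | snap i r => exact .inl (.inr ⟨i, r, ha⟩)
      | write i v =>
        by_cases hl : E.level τ i = ⊤
        · have hle : E.key _ ≤ E.key _ := hle
          rw [key_le_key] at hle
          rcases hle with h | ⟨-, h⟩
          · simp [position, hl] at h
          · exact .inr (by simpa [Prod.Lex.toLex_le_toLex] using h)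
        · obtain ⟨s, h1, -⟩ := exists_weight_eq_level hl
          exact .inl (.inl (Set.mem_biUnion h1.1 ⟨i, v, ha.1, h1⟩))

/-- The snapshots return the last values written before them in the linearization. -/
lemma lastValue_snap {o : E.history.Op} {i : Fin n} {r : Fin n → ℕ}
    (ho : E.history.letter o = .snap i r) (j : Fin n) :
    History.LastValue E.key (fun b => E.key b < E.key o) j (r j) := by
  obtain ⟨⟨s, a⟩, ha⟩ := o
  obtain rfl : a = .snap i r := ho
  obtain ⟨ρ, hr⟩ := snapReturns_iff.1 ha
  have hX : r = (E.loc ρ i).X := hr.facts.2.2.2.2.1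
  rcases Nat.eq_zero_or_pos ((E.loc ρ i).VC j) with h0 | h0
  · refine .inl ⟨?_, ?_⟩
    · rw [hX]
      rcases ((E.inv ρ).loc i).vc_sent j with ⟨-, h⟩ | ⟨m, h1, -, h2, -⟩
      · exact h
      · have := (E.inv ρ).sent.pos i m h1
        exact absurd (h2.trans h0) this.ne'
    · rintro ⟨⟨τ, b⟩, hb⟩ v hlt hl
      obtain rfl : b = .write j v := hl
      have h1 := ((write_lt_snap hb ha).1 hlt).2
      rw [hr.view_eq, h0] at h1
      exact absurd h1 (Nat.not_lt_zero _)
  · obtain ⟨m, h1, h2, h3, h4⟩ := E.exists_sent_VC ρ i j h0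
    obtain ⟨σ, h5, h6, h7⟩ := exists_write_of_sent h1 h2
    have hcov : s ∈ E.covers σ j := by
      refine ⟨hr.mem_snaps, ?_⟩
      rw [hr.view_eq, ← h3]
      exact h6
    -- This write may be one during which its process crashed: it never returned, but its value is
    -- read, so it belongs to the history.
    have hin : E.InHistory σ (.write j m.v) := ⟨h5, .inl ⟨s, hcov⟩⟩
    refine .inr ⟨⟨(σ, .write j m.v), hin⟩, (write_lt_snap hin ha).2 hcov, ?_, ?_⟩
    · rw [hX, ← h4]
    · rintro ⟨⟨τ, b⟩, hb⟩ v hl hlt hlt'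
      obtain rfl : b = .write j v := hl
      have h8 := ((write_lt_snap hb ha).1 hlt').2
      rw [hr.view_eq, ← h3] at h8
      rcases lt_trichotomy σ τ with h | h | h
      · exact absurd (h7 τ v h hb.1) h8.not_ge
      · subst h
        obtain rfl : v = m.v := by simpa using hb.unique hin
        exact absurd hlt (lt_irrefl _)
      · refine absurd (key_le_of_precedes (a := ⟨(τ, .write j v), hb⟩)
          (b := ⟨(σ, .write j m.v), hin⟩) ⟨rfl, h⟩) hlt.not_ge

lemma modelledBy_history (hE : 2 * E.faulty.ncard < n) : E.ModelledBy E.history := by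
  refine ⟨fun o => o.1.1, time_injective, ?_, ?_, fun _ _ => Iff.rfl⟩
  · rintro ⟨⟨τ, a⟩, ha⟩
    cases a with
    | write i v => exact ha.1
    | snap i r =>
      refine ⟨ha.1, fun r' hr' => ?_⟩
      obtain ⟨ρ, h⟩ := snapReturns_iff.1 ha
      obtain ⟨ρ', h'⟩ := snapReturns_iff.1 hr'
      exact (h.unique h').2.2
  · rintro τ (⟨i, v, hw⟩ | ⟨i, r, hr⟩) hlost
    · have hcov : (E.covers τ i).Nonempty ∨ E.snaps.Finite := by
        by_cases hfin : E.snaps.Finite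
        · exact .inr hfin
        -- By liveness, all but finitely many snapshots see a write that is not lost, and infinitely
        -- many snapshots return.
        · left
          obtain ⟨θ, hθ⟩ := exists_forall_view (E := E) (P := fun v => (E.loc τ i).SC < v i)
            (fun v v' h h' => h'.trans_le (h i)) fun j hj => by
              refine exists_validates_write hE hw (fun hi => ?_) hj
              by_contra hc
              push Not at hc
              exact hlost ⟨⟨i, v, hw, hi, hc⟩, hfin⟩
          obtain ⟨s, hs, hlt⟩ := Set.Infinite.exists_gt hfin θ
          exact ⟨s, hs, hθ s hs hlt.le⟩
      exact ⟨⟨(τ, .write i v), .inl hw, hcov⟩, rfl⟩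
    · exact ⟨⟨(τ, .snap i r), hr⟩, rfl⟩

end Execution

end SnapMem

theorem mainTheorem1 (n : ℕ) (E : SnapMem.Execution n) (hE : 2 * E.faulty.ncard < n) :
    ∃ H : SnapMem.History (SnapMem.Letter n),
      E.ModelledBy H ∧ SnapMem.SequentiallyConsistent (SnapMem.snapshotSpec n) H :=
  ⟨E.history, SnapMem.Execution.modelledBy_history hE,
    SnapMem.History.sequentiallyConsistent SnapMem.Execution.key_injective
      (SnapMem.Execution.finite_past hE) (fun _ _ => SnapMem.Execution.key_le_of_precedes)
      fun _ _ _ => SnapMem.Execution.lastValue_snap⟩
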